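/- **Conventions.** $C^\infty(S^1)$ is the space of smooth functions $S^1\to\mathbb C$ with the Fréchet topology of the norms $\|f\|_{C^N}=\sum_{j=0}^N\|\tfrac{d^j}{d\theta^j}f\|_\infty$, and $\operatorname{supp}$ denotes the closed support. $\mathrm{Möb}=\mathrm{PSU}(1,1)$ is the group of transformations $z\mapsto \frac{az+b}{\bar b z+\bar a}$ with $|a|^2-|b|^2=1$; $r_\theta(z)=e^{i\theta}z$. For $\gamma\in\mathrm{Möb}$, $d\in\mathbb Z_{\ge0}$ and $f\in C^\infty(S^1)$ put $X_\gamma(e^{i\theta})=-i\frac{d}{d\theta}\log\gamma(e^{i\theta})$ and $(\beta_d(\gamma)f)(z)=X_\gamma(\gamma^{-1}(z))^{d-1}f(\gamma^{-1}(z))$. **Wightman CFT.** Let $\mathcal D$ be a complex vector space, $\mathcal F$ a set of linear maps $\varphi$ from $C^\infty(S^1)$ to the linear operators on $\mathcal D$, $U$ a representation of $\mathrm{Möb}$ on $\mathcal D$, and $\Omega\in\mathcal D$ a nonzero vector. Let $\mathcal D_{\mathcal F}^*$ be the space of linear functionals $\lambda:\mathcal D\to\mathbb C$ such that $(f_1,\dots,f_k)\mapsto\lambda(\varphi_1(f_1)\cdots\varphi_k(f_k)\Phi)$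 is jointly continuous on $C^\infty(S^1)^k$ for all $k\ge 0$, $\varphi_1,\dots,\varphi_k\in\mathcal F$ and $\Phi\in\mathcal D$. We say that $\varphi$ has conformal dimension $d\in\mathbb Z_{\ge 0}$ if $U(\gamma)\varphi(f)U(\gamma)^{-1}=\varphi(\beta_d(\gamma)f)$ for all $\gamma\in\mathrm{Möb}$ and $f\in C^\infty(S^1)$. The data $(\mathcal F,\mathcal D,U,\Omega)$ is a (possibly non-unitary) Möbius-covariant Wightman CFT on $S^1$ if - $\mathcal D_{\mathcal F}^*$ separates the points of $\mathcal D$; - every $\varphi\in\mathcal F$ has some conformal dimension $d\in\mathbb Z_{\ge0}$; - $\varphi_1(f)$ and $\varphi_2(g)$ commute whenever $\varphi_1,\varphi_2\in\mathcal F$ and $\operatorname{supp}f\cap\operatorname{supp}g=\emptyset$; - if $\Phi\in\mathcal D$ and $d\in\mathbb Z$, $d<0$, are such that $U(r_\theta)\Phi=e^{id\theta}\Phi$ for all $\theta$, then $\Phi=0$; - $U(\gamma)\Omega=\Omega$ for all $\gamma$, and $\mathcal D$ is the linear span of the vectors $\varphi_1(f_1)\cdots\varphi_k(f_k)\Omega$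 ($k\ge 0$, $\varphi_j\in\mathcal F$, $f_j\in C^\infty(S^1)$). For $I\subset S^1$ let $\mathcal P(I)$ be the unital algebra generated by the operators $\varphi(f)$ with $\varphi\in\mathcal F$ and $\operatorname{supp} f\subset I$. Let $I_\pm=\{z\in S^1:\pm\operatorname{Im}z>0\}$. **Analytic continuation.** Let $V_t=U(v_t)$ where $v_t(z)=\frac{\cosh(t/2)z-\sinh(t/2)}{-\sinh(t/2)z+\cosh(t/2)}$, $t\in\mathbb R$. For $\tau\in\mathbb C$ let $\mathbb S_\tau$ be the closed strip bounded by $\mathbb R$ and $\mathbb R+\tau$. The domain $D(\widetilde V_\tau)\subset\mathcal D$ is the set of all $\Phi\in\mathcal D$ for which there is $\Psi\in\mathcal D$ such that for every $\lambda\in\mathcal D_{\mathcal F}^*$ there is a function $G_\lambda:\mathbb S_\tau\to\mathbb C$, continuous on $\mathbb S_\tau$ and holomorphic in its interior, with $G_\lambda(t)=\lambda(V_t\Phi)$ and $G_\lambda(\tau+t)=\lambda(V_t\Psi)$ for all $t\in\mathbb R$; such a $\Psi$ is unique, and $\widetilde V_\tau\Phi:=\Psi$. **Theorem.** Let $(\mathcal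 F,\mathcal D,U,\Omega)$ be a possibly non-unitary Möbius-covariant Wightman CFT on $S^1$. 1. $\mathcal P(I_+)\Omega\subset D(\widetilde V_{i\pi})$ and $\mathcal P(I_-)\Omega\subset D(\widetilde V_{-i\pi})$. 2. Let $k\ge 0$, let $\varphi_1,\dots,\varphi_k\in\mathcal F$ have conformal dimensions $d_1,\dots,d_k$, and let $f_1,\dots,f_k\in C^\infty(S^1)$ with $\operatorname{supp}f_j\subset I_+$ for all $j$. Then $$\widetilde V_{i\pi}\,\varphi_1(f_1)\cdots\varphi_k(f_k)\Omega=(-1)^{\sum_j d_j}\,\varphi_k(f_k\circ z^{-1})\cdots\varphi_1(f_1\circ z^{-1})\Omega,$$ where $(f\circ z^{-1})(z)=f(z^{-1})$. 3. The same formula holds for $\widetilde V_{-i\pi}$ if instead $\operatorname{supp}f_j\subset I_-$ for all $j$. -/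

import Mathlib

open scoped ContDiff

noncomputable section

namespace WightmanCFT

/-! ## Smooth functions on the unit circle -/

/-- The smooth functions `S¹ → ℂ`: those for which `θ ↦ f (e^{iθ})` is smooth on `ℝ`. -/
def smoothSubmodule : Submodule ℂ (Circle → ℂ) where
  carrier := {f | ContDiff ℝ ∞ fun θ : ℝ => f (Circle.exp θ)}
  add_mem' {f g} hf hg := by
    simp only [Set.mem_ofPred_eq] at hf hg ⊢
    exact hf.add hg
  zero_mem' := by
    simp only [Set.mem_ofPred_eq]
    exact contDiff_const
  smul_mem' c f hf := by
    simp only [Set.mem_ofPred_eq] at hf ⊢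
    exact contDiff_const.mul hf

/-- `C^∞(S¹)`. This is a type of its own, so that it does not inherit the topology of pointwise
convergence from `Circle → ℂ`. -/
def SmoothCircle : Type := ↥smoothSubmodule

namespace SmoothCircle

instance : AddCommGroup SmoothCircle := inferInstanceAs (AddCommGroup ↥smoothSubmodule)

instance : Module ℂ SmoothCircle := inferInstanceAs (Module ℂ ↥smoothSubmodule)

instance : CoeFun SmoothCircle fun _ => Circle → ℂ := ⟨fun f => f.1⟩

/-- The function `θ ↦ f (e^{iθ})`. -/
def pull (f : SmoothCircle) (θ : ℝ) : ℂ := f (Circle.exp θ)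

theorem contDiff_pull (f : SmoothCircle) : ContDiff ℝ ∞ f.pull := f.2

theorem contDiffAt_pull (f : SmoothCircle) (j : ℕ) (θ : ℝ) : ContDiffAt ℝ j f.pull θ :=
  (f.contDiff_pull.of_le (by exact_mod_cast le_top)).contDiffAt

theorem bddAbove_deriv (f : SmoothCircle) (j : ℕ) :
    BddAbove (Set.range fun θ : ℝ => ‖iteratedDeriv j f.pull θ‖) := by
  have hper : Function.Periodic (iteratedDeriv j f.pull) (2 * Real.pi) := by
    intro θ
    have h : (fun z => f.pull (z + 2 * Real.pi)) = f.pull := by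
      funext z
      simp [pull]
    have h2 := iteratedDeriv_comp_add_const j f.pull (2 * Real.pi)
    rw [h] at h2
    exact (congrFun h2 θ).symm
  have hc : Continuous fun θ : ℝ => ‖iteratedDeriv j f.pull θ‖ :=
    (f.contDiff_pull.continuous_iteratedDeriv j (by exact_mod_cast le_top)).norm
  obtain ⟨C, hC⟩ := (isCompact_Icc (a := (0 : ℝ)) (b := 2 * Real.pi)).bddAbove_image hc.continuousOn
  refine ⟨C, ?_⟩
  rintro _ ⟨θ, rfl⟩
  obtain ⟨y, hy, hxy⟩ := hper.exists_mem_Ico₀ Real.two_pi_pos θ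
  simp only [hxy]
  exact hC ⟨y, ⟨hy.1, hy.2.le⟩, rfl⟩

/-- The seminorm `‖f^{(j)}‖_∞ = sup_θ |(d/dθ)^j f (e^{iθ})|`. -/
def supSeminorm (j : ℕ) : Seminorm ℂ SmoothCircle :=
  Seminorm.of (fun f => ⨆ θ : ℝ, ‖iteratedDeriv j f.pull θ‖)
    (by
      intro f g
      refine ciSup_le fun θ => ?_
      have h : iteratedDeriv j (f + g).pull θ
          = iteratedDeriv j f.pull θ + iteratedDeriv j g.pull θ :=
        iteratedDeriv_add (f.contDiffAt_pull j θ) (g.contDiffAt_pull j θ)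
      rw [h]
      exact (norm_add_le _ _).trans
        (add_le_add (le_ciSup (f.bddAbove_deriv j) θ) (le_ciSup (g.bddAbove_deriv j) θ)))
    (by
      intro c f
      have h : ∀ θ, iteratedDeriv j (c • f).pull θ = c • iteratedDeriv j f.pull θ := fun θ =>
        iteratedDeriv_const_smul (f.contDiffAt_pull j θ) c
      simp only [h, norm_smul]
      exact (Real.mul_iSup_of_nonneg (norm_nonneg c) _).symm)

/-- The norm `‖f‖_{C^N} = ∑_{j = 0}^N ‖f^{(j)}‖_∞`. -/
def cNorm (N : ℕ) : Seminorm ℂ SmoothCircle := ∑ j ∈ Finset.range (N + 1), supSeminorm j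

/-- The family of all `C^N` norms. -/
def cNormFamily : SeminormFamily ℂ SmoothCircle ℕ := cNorm

/-- The Fréchet topology of `C^∞(S¹)`, defined by the `C^N` norms. -/
instance : TopologicalSpace SmoothCircle := cNormFamily.moduleFilterBasis.topology'

/-- The function `f ∘ z⁻¹`, that is `z ↦ f (z⁻¹)`. -/
def reflect (f : SmoothCircle) : SmoothCircle :=
  ⟨fun z => f z⁻¹, by
    have h : (fun θ : ℝ => f (Circle.exp θ)⁻¹) = fun θ : ℝ => f.pull (-θ) := by
      funext θ
      simp [pull, Circle.exp_neg]
    change ContDiff ℝ ∞ fun θ : ℝ => f (Circle.exp θ)⁻¹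
    rw [h]
    exact f.contDiff_pull.comp contDiff_neg⟩

end SmoothCircle

/-! ## The Möbius group of the circle -/

open ComplexConjugate

/-- `γ` is the transformation `z ↦ (a z + b) / (b̄ z + ā)` of the circle, where
`|a|² - |b|² = 1`. -/
def IsMobius (γ : Equiv.Perm Circle) (a b : ℂ) : Prop :=
  Complex.normSq a - Complex.normSq b = 1 ∧
    ∀ z : Circle, (γ z : ℂ) = (a * z + b) / (conj b * z + conj a)

theorem mul_conj_sub {a b : ℂ} (h : Complex.normSq a - Complex.normSq b = 1) :
    a * conj a - b * conj b = 1 := by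
  rw [Complex.mul_conj, Complex.mul_conj]
  exact_mod_cast h

theorem circle_mul_conj (z : Circle) : (z : ℂ) * conj (z : ℂ) = 1 := by
  rw [Complex.mul_conj, Circle.normSq_coe]; simp

/-- `a z + b = z · conj (b̄ z + ā)` on the circle. -/
theorem num_eq (a b : ℂ) (z : Circle) :
    a * z + b = z * conj (conj b * z + conj a) := by
  simp only [map_add, map_mul, Complex.conj_conj]
  linear_combination (-b) * circle_mul_conj z

theorem den_ne_zero {a b : ℂ} (h : Complex.normSq a - Complex.normSq b = 1) (z : Circle) :
    conj b * z + conj a ≠ 0 := by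
  intro h0
  have h1 := mul_conj_sub h
  have h3 : conj a = - (conj b * z) := by linear_combination h0
  have h4 : a = - (b * conj (z : ℂ)) := by
    have := congrArg conj h3
    simpa using this
  rw [h3] at h1
  rw [h4] at h1
  have h5 := circle_mul_conj z
  have : (0 : ℂ) = 1 := by linear_combination h1 - b * conj b * h5
  exact zero_ne_one this

/-- The transformation `z ↦ (a z + b) / (b̄ z + ā)` as a self-map of the circle. -/
def mobFun (a b : ℂ) (h : Complex.normSq a - Complex.normSq b = 1) (z : Circle) : Circle :=
  ⟨(a * z + b) / (conj b * z + conj a), by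
    have hd := den_ne_zero h z
    refine mem_sphere_zero_iff_norm.2 ?_
    rw [norm_div, num_eq, norm_mul, Circle.norm_coe, one_mul,
      RCLike.norm_conj, div_self (norm_ne_zero_iff.2 hd)]⟩

theorem mobFun_coe (a b : ℂ) (h : Complex.normSq a - Complex.normSq b = 1) (z : Circle) :
    (mobFun a b h z : ℂ) = (a * z + b) / (conj b * z + conj a) := rfl

theorem inv_normSq {a b : ℂ} (h : Complex.normSq a - Complex.normSq b = 1) :
    Complex.normSq (conj a) - Complex.normSq (-b) = 1 := by
  rwa [Complex.normSq_conj, Complex.normSq_neg]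

theorem mobFun_inv (a b : ℂ) (h : Complex.normSq a - Complex.normSq b = 1)
    (h' : Complex.normSq (conj a) - Complex.normSq (-b) = 1) (z : Circle) :
    mobFun (conj a) (-b) h' (mobFun a b h z) = z := by
  apply Circle.ext
  have hd := den_ne_zero h z
  have hd' := den_ne_zero h' (mobFun a b h z)
  rw [mobFun_coe, div_eq_iff hd', mobFun_coe]
  simp only [map_neg, Complex.conj_conj]
  set u := conj b * (z : ℂ) + conj a with hu
  have h2 : (a * (z : ℂ) + b) / u * u = a * z + b := div_mul_cancel₀ _ hd
  apply mul_right_cancel₀ hd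
  linear_combination (conj a + z * conj b) * h2 + (-b - a * z) * hu

/-- The transformation `z ↦ (a z + b) / (b̄ z + ā)` as a permutation of the circle. -/
def mobPerm (a b : ℂ) (h : Complex.normSq a - Complex.normSq b = 1) : Equiv.Perm Circle where
  toFun := mobFun a b h
  invFun := mobFun (conj a) (-b) (inv_normSq h)
  left_inv := mobFun_inv a b h _
  right_inv z := by
    have := mobFun_inv (conj a) (-b) (inv_normSq h) (by simpa using h) z
    simpa using this

theorem isMobius_mobPerm (a b : ℂ) (h : Complex.normSq a - Complex.normSq b = 1) :
    IsMobius (mobPerm a b h) a b := ⟨h, fun _ => rfl⟩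

theorem IsMobius.eq_mobPerm {γ : Equiv.Perm Circle} {a b : ℂ} (h : IsMobius γ a b) :
    γ = mobPerm a b h.1 := by
  ext z
  exact h.2 z

theorem IsMobius.inv {γ : Equiv.Perm Circle} {a b : ℂ} (h : IsMobius γ a b) :
    IsMobius γ⁻¹ (conj a) (-b) := by
  refine ⟨inv_normSq h.1, fun z => ?_⟩
  rw [h.eq_mobPerm]
  rfl

theorem IsMobius.mul {γ δ : Equiv.Perm Circle} {a b c d : ℂ} (h : IsMobius γ a b)
    (h' : IsMobius δ c d) : IsMobius (γ * δ) (a * c + b * conj d) (a * d + b * conj c) := by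
  have key : (a * c + b * conj d) * conj (a * c + b * conj d)
      - (a * d + b * conj c) * conj (a * d + b * conj c) = 1 := by
    simp only [map_add, map_mul, Complex.conj_conj]
    linear_combination (c * conj c - d * conj d) * mul_conj_sub h.1 + mul_conj_sub h'.1
  have hn : Complex.normSq (a * c + b * conj d) - Complex.normSq (a * d + b * conj c) = 1 := by
    rw [Complex.mul_conj, Complex.mul_conj] at key
    exact_mod_cast key
  refine ⟨hn, fun z => ?_⟩
  have h1 := den_ne_zero h'.1 z
  have h2 := den_ne_zero h.1 (δ z)
  have h3 := den_ne_zero hn z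
  rw [Equiv.Perm.mul_apply, h.2, div_eq_div_iff h2 h3, h'.2]
  simp only [map_add, map_mul, Complex.conj_conj]
  set u := conj d * (z : ℂ) + conj c with hu
  have h4 : (c * (z : ℂ) + d) / u * u = c * z + d := div_mul_cancel₀ _ h1
  apply mul_right_cancel₀ h1
  linear_combination
    (a * (conj a * u + conj b * (c * z + d)) - conj b * (a * (c * z + d) + b * u)) * h4

/-- The Möbius group `Möb = PSU(1,1)` of holomorphic automorphisms of the unit disk, realised
through its faithful action on the boundary circle. -/
def Mob : Subgroup (Equiv.Perm Circle) where
  carrier := {γ | ∃ a b : ℂ, IsMobius γ a b}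
  mul_mem' := by
    rintro γ δ ⟨a, b, h⟩ ⟨c, d, h'⟩
    exact ⟨_, _, h.mul h'⟩
  one_mem' := ⟨1, 0, by simp, fun z => by simp⟩
  inv_mem' := by
    rintro γ ⟨a, b, h⟩
    exact ⟨_, _, h.inv⟩

instance : CoeFun Mob fun _ => Circle → Circle := ⟨fun γ => γ.1⟩

/-- The element `z ↦ (a z + b) / (b̄ z + ā)` of `Möb`. -/
def Mob.mk (a b : ℂ) (h : Complex.normSq a - Complex.normSq b = 1) : Mob :=
  ⟨mobPerm a b h, a, b, isMobius_mobPerm a b h⟩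

/-- The rotation `z ↦ e^{iθ} z`. -/
def rotation (θ : ℝ) : Mob :=
  Mob.mk (Complex.exp (θ / 2 * Complex.I)) 0 (by
    have h : (θ / 2 * Complex.I : ℂ) = ((θ / 2 : ℝ) : ℂ) * Complex.I := by push_cast; ring
    rw [h, Complex.normSq_eq_norm_sq, Complex.norm_exp_ofReal_mul_I]
    simp)

theorem rotation_apply (θ : ℝ) (z : Circle) : (rotation θ) z = Circle.exp θ * z := by
  apply Circle.ext
  change (Complex.exp (θ / 2 * Complex.I) * z + 0) /
    (conj 0 * z + conj (Complex.exp (θ / 2 * Complex.I))) = _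
  have h : conj (Complex.exp (θ / 2 * Complex.I)) = (Complex.exp (θ / 2 * Complex.I))⁻¹ := by
    rw [← Complex.exp_conj, ← Complex.exp_neg]
    simp [map_ofNat]
  rw [h, Circle.coe_mul, Circle.coe_exp]
  have h2 : Complex.exp (θ * Complex.I)
      = Complex.exp (θ / 2 * Complex.I) * Complex.exp (θ / 2 * Complex.I) := by
    rw [← Complex.exp_add]; congr 1; ring
  rw [h2, map_zero, zero_mul, zero_add, add_zero, div_inv_eq_mul]
  ring

/-- The one-parameter group
`v_t z = (cosh (t/2) z - sinh (t/2)) / (- sinh (t/2) z + cosh (t/2))`. -/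
def dilation (t : ℝ) : Mob :=
  Mob.mk (Real.cosh (t / 2) : ℂ) (-(Real.sinh (t / 2) : ℂ)) (by
    rw [Complex.normSq_neg, Complex.normSq_ofReal, Complex.normSq_ofReal]
    have := Real.cosh_sq (t / 2)
    nlinarith)

theorem dilation_apply (t : ℝ) (z : Circle) : (dilation t z : ℂ) =
    (Real.cosh (t / 2) * z - Real.sinh (t / 2)) /
      (-Real.sinh (t / 2) * z + Real.cosh (t / 2)) := by
  change ((Real.cosh (t / 2) : ℂ) * z + -(Real.sinh (t / 2) : ℂ)) /
    (conj (-(Real.sinh (t / 2) : ℂ)) * z + conj (Real.cosh (t / 2) : ℂ)) = _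
  rw [map_neg, Complex.conj_ofReal, Complex.conj_ofReal, sub_eq_add_neg]

/-! ## The action of the Möbius group on smooth functions -/

/-- `X_γ (e^{iθ}) = -i (d/dθ) log γ (e^{iθ})`. -/
def xFactor (γ : Mob) (z : Circle) : ℂ :=
  -Complex.I * logDeriv (fun θ : ℝ => (γ (Circle.exp θ) : ℂ)) (Complex.arg z)

theorem contDiff_exp_coe : ContDiff ℝ ∞ fun θ : ℝ => (Circle.exp θ : ℂ) := by
  simp only [Circle.coe_exp]
  exact (Complex.ofRealCLM.contDiff.mul contDiff_const).cexp

theorem xFactor_eq {γ : Mob} {a b : ℂ} (h : IsMobius γ.1 a b) (z : Circle) :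
    xFactor γ z = 1 / ((conj b * z + conj a) * conj (conj b * z + conj a)) := by
  have hz : (Complex.exp (Complex.arg z * Complex.I) : ℂ) = z := by
    rw [← Circle.coe_exp, Circle.exp_arg]
  have hd := den_ne_zero h.1 z
  have hf : (fun θ : ℝ => (γ (Circle.exp θ) : ℂ)) = fun θ : ℝ =>
      (a * Complex.exp (θ * Complex.I) + b) /
        (conj b * Complex.exp (θ * Complex.I) + conj a) := by
    funext θ
    rw [h.2, Circle.coe_exp]
  have he : HasDerivAt (fun θ : ℝ => Complex.exp (θ * Complex.I)) ((z : ℂ) * Complex.I)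
      (Complex.arg z) := by
    have := ((Complex.ofRealCLM.hasDerivAt (x := Complex.arg z)).mul_const Complex.I).cexp
    simpa [hz] using this
  have hD := ((he.const_mul a).add_const b).fun_div ((he.const_mul (conj b)).add_const (conj a))
    (by rw [hz]; exact hd)
  have hz0 : (z : ℂ) ≠ 0 := Circle.coe_ne_zero z
  have hdc : conj (conj b * (z : ℂ) + conj a) ≠ 0 := (map_ne_zero _).2 hd
  have hdet := mul_conj_sub h.1
  unfold xFactor
  rw [hf, logDeriv_apply, hD.deriv, hz, num_eq a b z]
  set D := conj b * (z : ℂ) + conj a with hDdef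
  have h1 : a * ((z : ℂ) * Complex.I) * D - z * conj D * (conj b * (z * Complex.I))
      = z * Complex.I := by
    rw [← num_eq a b z, hDdef]
    linear_combination (z * Complex.I) * hdet
  rw [h1]
  field_simp
  rw [Complex.I_sq]
  ring

/-- An explicit formula for `X_γ ∘ γ⁻¹`. -/
theorem xFactor_inv_eq {γ : Mob} {a b : ℂ} (h : IsMobius γ.1 a b) (z : Circle) :
    xFactor γ ((γ⁻¹ : Mob) z) = (a - conj b * z) * conj (a - conj b * z) := by
  have hi : (((γ⁻¹ : Mob) z : Circle) : ℂ) = (conj a * z - b) / (a - conj b * z) := by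
    have := h.inv.2 z
    simp only [map_neg, Complex.conj_conj] at this
    rw [show ((γ⁻¹ : Mob) z : Circle) = (γ.1⁻¹ : Equiv.Perm Circle) z from rfl, this]
    congr 1; ring
  have hd : a - conj b * (z : ℂ) ≠ 0 := by
    have := den_ne_zero h.inv.1 z
    simp only [map_neg, Complex.conj_conj] at this
    intro h0
    exact this (by linear_combination h0)
  have hdc : conj (a - conj b * (z : ℂ)) ≠ 0 := (map_ne_zero _).2 hd
  have hkey : conj b * (((γ⁻¹ : Mob) z : Circle) : ℂ) + conj a = 1 / (a - conj b * z) := by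
    rw [hi]
    field_simp
    linear_combination mul_conj_sub h.1
  rw [xFactor_eq h, hkey, map_div₀, map_one]
  field_simp

theorem contDiff_xFactor_zpow (γ : Mob) (n : ℤ) :
    ContDiff ℝ ∞ fun θ : ℝ => xFactor γ ((γ⁻¹ : Mob) (Circle.exp θ)) ^ n := by
  obtain ⟨a, b, h⟩ := γ.2
  have h1 : ContDiff ℝ ∞ fun θ : ℝ => a - conj b * (Circle.exp θ : ℂ) :=
    contDiff_const.sub (contDiff_const.mul contDiff_exp_coe)
  have h2 : ContDiff ℝ ∞ fun θ : ℝ => xFactor γ ((γ⁻¹ : Mob) (Circle.exp θ)) := by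
    simp only [xFactor_inv_eq h]
    exact h1.mul (Complex.conjCLE.contDiff.comp h1)
  have h3 : ∀ θ : ℝ, xFactor γ ((γ⁻¹ : Mob) (Circle.exp θ)) ≠ 0 := by
    intro θ
    rw [xFactor_inv_eq h]
    have := den_ne_zero h.inv.1 (Circle.exp θ)
    simp only [map_neg, Complex.conj_conj] at this
    have hd : a - conj b * (Circle.exp θ : ℂ) ≠ 0 := by
      intro h0
      exact this (by linear_combination h0)
    exact mul_ne_zero hd ((map_ne_zero _).2 hd)
  cases n with
  | ofNat m => simpa using h2.pow m
  | negSucc m =>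
    simp only [zpow_negSucc]
    exact (h2.pow (m + 1)).inv fun θ => pow_ne_zero _ (h3 θ)

theorem contDiff_comp_mob (γ : Mob) (f : SmoothCircle) :
    ContDiff ℝ ∞ fun θ : ℝ => f (γ (Circle.exp θ)) := by
  obtain ⟨a, b, h⟩ := γ.2
  rw [contDiff_iff_contDiffAt]
  intro θ₀
  set w : ℝ → Circle := fun θ => γ (Circle.exp θ) with hw
  have hws : ContDiff ℝ ∞ fun θ : ℝ => (w θ : ℂ) := by
    have : (fun θ : ℝ => (w θ : ℂ)) = fun θ : ℝ =>
        (a * (Circle.exp θ : ℂ) + b) / (conj b * (Circle.exp θ : ℂ) + conj a) :=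
      funext fun θ => h.2 _
    rw [this]
    simp only [div_eq_mul_inv]
    exact ((contDiff_const.mul contDiff_exp_coe).add contDiff_const).mul
      (((contDiff_const.mul contDiff_exp_coe).add contDiff_const).inv fun θ => den_ne_zero h.1 _)
  have hq : ContDiff ℝ ∞ fun θ : ℝ => ((w θ / w θ₀ : Circle) : ℂ) := by
    simp only [Circle.coe_div]
    exact hws.div_const _
  have hlift : ContDiffAt ℝ ∞
      (fun θ : ℝ => Complex.arg (w θ₀) + (Complex.log ((w θ / w θ₀ : Circle) : ℂ)).im) θ₀ := by
    refine contDiffAt_const.add ?_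
    have h1 : ContDiffAt ℝ ∞ Complex.log ((w θ₀ / w θ₀ : Circle) : ℂ) := by
      refine (Complex.contDiffAt_log ?_).restrict_scalars ℝ
      simp
    exact Complex.imCLM.contDiff.contDiffAt.comp θ₀
      (ContDiffAt.comp θ₀ (f := fun θ : ℝ => ((w θ / w θ₀ : Circle) : ℂ)) h1 hq.contDiffAt)
  have heq : (fun θ : ℝ => f (w θ)) = f.pull ∘
      (fun θ : ℝ => Complex.arg (w θ₀) + (Complex.log ((w θ / w θ₀ : Circle) : ℂ)).im) := by
    funext θ
    simp only [Function.comp, SmoothCircle.pull, Complex.log_im, Circle.exp_add, Circle.exp_arg]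
    simp
  rw [heq]
  exact f.contDiff_pull.contDiffAt.comp θ₀ hlift

/-- `(β_d(γ) f) z = (X_γ (γ⁻¹ z))^{d - 1} f (γ⁻¹ z)`. -/
def beta (d : ℕ) (γ : Mob) (f : SmoothCircle) : SmoothCircle :=
  ⟨fun z => xFactor γ ((γ⁻¹ : Mob) z) ^ ((d : ℤ) - 1) * f ((γ⁻¹ : Mob) z),
    (contDiff_xFactor_zpow γ _).mul (contDiff_comp_mob γ⁻¹ f)⟩

/-! ## Möbius-covariant Wightman conformal field theories -/

/-- The product of smeared fields `φ₁(f₁) ⋯ φ_k(f_k)`, in this order. -/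
def smear {D : Type*} [AddCommGroup D] [Module ℂ D] {k : ℕ}
    (φ : Fin k → SmoothCircle →ₗ[ℂ] Module.End ℂ D) (f : Fin k → SmoothCircle) :
    Module.End ℂ D :=
  (List.ofFn fun j => φ j (f j)).prod

/-- The space `D_F^*` of linear functionals compatible with `F`: those for which every
`(f₁, …, f_k) ↦ lam (φ₁(f₁) ⋯ φ_k(f_k) Φ)` is jointly continuous. It is the dual of `D` with
respect to the `F`-strong topology. -/
def compatibleDual {D : Type*} [AddCommGroup D] [Module ℂ D]
    (F : Set (SmoothCircle →ₗ[ℂ] Module.End ℂ D)) : Set (D →ₗ[ℂ] ℂ) :=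
  {lam | ∀ (k : ℕ) (φ : Fin k → SmoothCircle →ₗ[ℂ] Module.End ℂ D), (∀ j, φ j ∈ F) →
    ∀ Φ : D, Continuous fun f : Fin k → SmoothCircle => lam (smear φ f Φ)}

/-- `φ` is Möbius-covariant with conformal dimension `d` under `U`. -/
def IsCovariant {D : Type*} [AddCommGroup D] [Module ℂ D] (U : Mob →* Module.End ℂ D)
    (φ : SmoothCircle →ₗ[ℂ] Module.End ℂ D) (d : ℕ) : Prop :=
  ∀ (γ : Mob) (f : SmoothCircle), U γ * φ f * U γ⁻¹ = φ (beta d γ f)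

/-- A (possibly non-unitary) Möbius-covariant Wightman conformal field theory `(F, D, U, Ω)` on
the circle. -/
structure MobiusWightmanCFT (D : Type*) [AddCommGroup D] [Module ℂ D] where
  /-- The set `F` of operator-valued distributions. -/
  F : Set (SmoothCircle →ₗ[ℂ] Module.End ℂ D)
  /-- The representation of the Möbius group. -/
  U : Mob →* Module.End ℂ D
  /-- The vacuum vector. -/
  Ω : D
  vacuum_ne_zero : Ω ≠ 0
  /-- `F` acts regularly: the compatible functionals separate points. -/
  regular : ∀ Φ : D, Φ ≠ 0 → ∃ lam ∈ compatibleDual F, lam Φ ≠ 0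
  /-- Möbius covariance. -/
  covariance : ∀ φ ∈ F, ∃ d : ℕ, IsCovariant U φ d
  /-- Locality. -/
  locality : ∀ φ₁ ∈ F, ∀ φ₂ ∈ F, ∀ f g : SmoothCircle,
    Disjoint (tsupport f) (tsupport g) → Commute (φ₁ f) (φ₂ g)
  /-- Spectrum condition. -/
  spectrum : ∀ (d : ℤ) (Φ : D), d < 0 →
    (∀ θ : ℝ, U (rotation θ) Φ = Complex.exp (Complex.I * d * θ) • Φ) → Φ = 0
  /-- The vacuum is Möbius-invariant. -/
  vacuum_invariant : ∀ γ : Mob, U γ Ω = Ω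
  /-- `D` is spanned by the vectors `φ₁(f₁) ⋯ φ_k(f_k) Ω`. -/
  vacuum_cyclic : Submodule.span ℂ {Φ : D | ∃ (k : ℕ)
    (φ : Fin k → SmoothCircle →ₗ[ℂ] Module.End ℂ D) (f : Fin k → SmoothCircle),
    (∀ j, φ j ∈ F) ∧ Φ = smear φ f Ω} = ⊤

/-- The upper semicircle `I_+`. -/
def upperArc : Set Circle := {z | 0 < (z : ℂ).im}

/-- The lower semicircle `I_-`. -/
def lowerArc : Set Circle := {z | (z : ℂ).im < 0}

/-- The closed strip bounded by the lines `ℝ` and `ℝ + τ`. -/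
def strip (τ : ℂ) : Set ℂ := {z | z.im ∈ Set.uIcc 0 τ.im}

namespace MobiusWightmanCFT

variable {D : Type*} [AddCommGroup D] [Module ℂ D] (W : MobiusWightmanCFT D)

/-- `P(I)`: the unital algebra generated by the `φ(f)` with `φ ∈ F` and `supp f ⊆ I`. -/
def polyAlg (I : Set Circle) : Subalgebra ℂ (Module.End ℂ D) :=
  Algebra.adjoin ℂ {T | ∃ φ ∈ W.F, ∃ f : SmoothCircle, tsupport f ⊆ I ∧ T = φ f}

/-- The one-parameter group `V_t = U(v_t)`. -/
def V (t : ℝ) : Module.End ℂ D := W.U (dilation t)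

/-- For every compatible functional `lam` the function `t ↦ lam (V_t Φ)` extends to a function `G`,
continuous on the closed strip bounded by `ℝ` and `ℝ + τ` and holomorphic in its interior, such
that `G (τ + t) = lam (V_t Ψ)`. -/
def IsContinuation (τ : ℂ) (Φ Ψ : D) : Prop :=
  ∀ lam ∈ compatibleDual W.F, ∃ G : ℂ → ℂ,
    ContinuousOn G (strip τ) ∧ DifferentiableOn ℂ G (interior (strip τ)) ∧
    (∀ t : ℝ, G t = lam (W.V t Φ)) ∧ ∀ t : ℝ, G (τ + t) = lam (W.V t Ψ)

/-- The domain of the analytically continued operator `Ṽ_τ`. -/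
def domV (τ : ℂ) : Set D := {Φ | ∃ Ψ, W.IsContinuation τ Φ Ψ}

/-- The partially defined operator `Ṽ_τ`, which sends `Φ` to the vector `Ψ` given by analytic
continuation. Such a `Ψ` is unique, because the values of `G` on `ℝ` determine `G` and the compatible
functionals separate points. -/
def contV (τ : ℂ) (Φ : W.domV τ) : D := Classical.choose Φ.2

end MobiusWightmanCFT

end WightmanCFT

end

noncomputable section
namespace WightmanCFT

open Complex MeasureTheory Set Filter Topology ComplexConjugate

/-! ## Bounded holomorphic functions on a strip -/

/-! By covariance, `V t` passes through a product of fields and replaces each test function by its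
transport under the dilation `v_t`, while the vacuum stays fixed (`V_smear`). The theorem is thus
about continuing vacuum correlations of transported test functions from real `t` to `t + iπ`.

One field. In the coordinate `θ = 2 arctan (eˣ)` on the upper semicircle, `v_t` is the translation
`x ↦ x + t`. For `n ≥ d` the Fourier coefficient of index `-n` of a transported function is the
integral of a fixed compactly supported profile against a translate of `stripMap ^ (n - d) *
stripDensity ^ d`, a kernel that is holomorphic and bounded by 1 on the strip `0 ≤ Im w ≤ π`.
Shifting by `iπ` inverts `stripMap` and turns `stripDensity` into minus its reflected value, which
produces both the reflection `f ∘ z⁻¹` and the sign `(-1)^d` (`isStripBoundary_coef`). The remaining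
modes do not contribute: `φ(zⁿ)Ω = 0` for `n > -d` (`field_monomial_vacuum`). For `n > 0` this is
the spectrum condition; the others are reached by transporting a positive power of `z` with a
dilation and separating Fourier modes by rotations. Summing the modes needs uniformity in `t`, which
a Gaussian damping factor supplies; the maximum principle on the strip then carries uniform limits
from the boundary inside (`IsStripBoundary.of_approx`, `isStripBoundary_field`).

Several fields. By induction, give the leftmost field a parameter `s` and the others a parameter
`t`. Continuing in `t` reverses the other fields and moves their supports to the lower semicircle;
locality then lets the leftmost field pass through them to the vacuum, where the one-field case
continues in `s`. These are two separate continuations, and what is needed is a single one along `s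
= t`. `IsStripBoundary.diagonal` obtains it without any joint holomorphy: convolution with entire
Gaussians gives entire functions of the diagonal variable, whose values on the upper line are found
by shifting one contour at a time, and the mollified functions converge uniformly on both boundary
lines.

Continuations are unique because a holomorphic function on the strip that vanishes continuously on
`ℝ` is zero (`eq_zero_of_eq_zero_on_real`). The lower semicircle is the upper one read backwards
(`IsContinuation.symm`). -/

theorem differentiableOn_integral_of_norm_le {α : Type*} [MeasurableSpace α] {μ : Measure α}
    {F : ℂ → α → ℂ} {U : Set ℂ} (hU : IsOpen U)
    (hmeas : ∀ z ∈ U, AEStronglyMeasurable (F z) μ)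
    (hdiff : ∀ a, DifferentiableOn ℂ (fun z => F z a) U) {bound : α → ℝ}
    (hb : ∀ z ∈ U, ∀ a, ‖F z a‖ ≤ bound a) (hint : Integrable bound μ) :
    DifferentiableOn ℂ (fun z => ∫ a, F z a ∂μ) U := by
  intro z₀ hz₀
  obtain ⟨r, hr, hrU⟩ := Metric.isOpen_iff.1 hU z₀ hz₀
  -- With a third of the radius, closed balls of radius `s` about points of `ball z₀ s` stay inside
  -- `U`, which leaves room for Cauchy estimates.
  set s := r / 3 with hs
  have hs0 : 0 < s := by positivity
  have hsub : ∀ z ∈ Metric.ball z₀ s, Metric.closedBall z s ⊆ U := by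
    intro z hz w hw
    apply hrU
    rw [Metric.mem_ball] at hz ⊢
    rw [Metric.mem_closedBall] at hw
    have := dist_triangle w z z₀
    linarith
  have hderiv : ∀ z ∈ Metric.ball z₀ s, ∀ a, HasDerivAt (fun w => F w a) (deriv (fun w => F w a) z) z := by
    intro z hz a
    exact ((hdiff a).differentiableAt
      (hU.mem_nhds (hsub z hz (Metric.mem_closedBall_self hs0.le)))).hasDerivAt
  have hz₀s : z₀ ∈ Metric.ball z₀ s := Metric.mem_ball_self hs0
  have key := hasDerivAt_integral_of_dominated_loc_of_deriv_le (μ := μ) (𝕜 := ℂ) (F := F)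
    (F' := fun z a => deriv (fun w => F w a) z) (x₀ := z₀) (s := Metric.ball z₀ s)
    (bound := fun a => bound a / s) (Metric.ball_mem_nhds z₀ hs0) ?_ ?_ ?_ ?_ ?_ ?_
  · exact key.2.differentiableAt.differentiableWithinAt
  · filter_upwards [hU.mem_nhds hz₀] with z hz using hmeas z hz
  · exact hint.mono' (hmeas z₀ hz₀) (Eventually.of_forall fun a => hb z₀ hz₀ a)
  -- The derivative at `z₀` is measurable in the parameter as a limit of difference quotients along
  -- a sequence.
  · have hseq : Tendsto (fun n : ℕ => z₀ + ((s / (n + 2) : ℝ) : ℂ)) atTop (𝓝[≠] z₀) := by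
      refine tendsto_nhdsWithin_iff.2 ⟨?_, Eventually.of_forall fun n => ?_⟩
      · have h1 : Tendsto (fun n : ℕ => s / ((n : ℝ) + 2)) atTop (𝓝 0) :=
          tendsto_const_nhds.div_atTop
            (tendsto_atTop_add_const_right _ _ tendsto_natCast_atTop_atTop)
        have h2 := (continuous_ofReal.tendsto 0).comp h1
        simpa using h2.const_add z₀
      · have : (s / ((n : ℝ) + 2)) ≠ 0 := by positivity
        simp only [mem_compl_iff, mem_singleton_iff, add_eq_left, ofReal_eq_zero]
        exact this
    refine aestronglyMeasurable_of_tendsto_ae atTop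
      (f := fun (n : ℕ) a => slope (fun w => F w a) z₀ (z₀ + ((s / (n + 2) : ℝ) : ℂ))) ?_ ?_
    · intro n
      have hm : z₀ + ((s / (n + 2) : ℝ) : ℂ) ∈ U := by
        apply hsub z₀ hz₀s
        rw [Metric.mem_closedBall, dist_eq_norm, add_sub_cancel_left, norm_real, Real.norm_eq_abs,
          abs_of_nonneg (by positivity)]
        exact div_le_self hs0.le (by linarith [(Nat.cast_nonneg n : (0 : ℝ) ≤ n)])
      simp only [slope_def_field, div_eq_mul_inv]
      exact ((hmeas _ hm).sub (hmeas _ hz₀)).mul_const _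
    · exact Eventually.of_forall fun a =>
        (hasDerivAt_iff_tendsto_slope.1 (hderiv z₀ hz₀s a)).comp hseq
  -- Cauchy's estimate on a circle of radius `s` dominates the derivative, so no separate hypothesis
  -- on derivatives is needed.
  · refine Eventually.of_forall fun a z hz => ?_
    refine norm_deriv_le_of_forall_mem_sphere_norm_le hs0 ?_ ?_
    · refine DifferentiableOn.diffContOnCl ((hdiff a).mono ?_)
      exact (closure_minimal Metric.ball_subset_closedBall Metric.isClosed_closedBall).trans
        (hsub z hz)
    · intro w hw
      exact hb w (hsub z hz (Metric.sphere_subset_closedBall hw)) a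
  · exact hint.div_const s
  · exact Eventually.of_forall fun a z hz => hderiv z hz a

/-- The closed strip `0 ≤ Im z ≤ π`. -/
def cstrip : Set ℂ := im ⁻¹' Icc 0 Real.pi

/-- The open strip `0 < Im z < π`. -/
def ostrip : Set ℂ := im ⁻¹' Ioo 0 Real.pi

theorem ostrip_subset_cstrip : ostrip ⊆ cstrip := preimage_mono Ioo_subset_Icc_self

theorem isOpen_ostrip : IsOpen ostrip := isOpen_Ioo.preimage continuous_im

theorem closure_ostrip : closure ostrip = cstrip := by
  rw [ostrip, Complex.closure_preimage_im, closure_Ioo Real.pi_pos.ne, cstrip]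

theorem ofReal_mem_cstrip (t : ℝ) : (t : ℂ) ∈ cstrip := by
  simp [cstrip, Real.pi_pos.le]

theorem ofReal_add_pi_mem_cstrip (t : ℝ) : (t : ℂ) + Real.pi * I ∈ cstrip := by
  simp [cstrip, Real.pi_pos.le]

theorem eq_ofReal_of_im_eq_zero {z : ℂ} (h : z.im = 0) : z = (z.re : ℂ) := by
  apply Complex.ext <;> simp [h]

theorem eq_ofReal_add_pi_of_im_eq {z : ℂ} (h : z.im = Real.pi) :
    z = (z.re : ℂ) + Real.pi * I := by
  apply Complex.ext <;> simp [h]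

/-- `A` and `B` are the boundary values, on `ℝ` and on `ℝ + iπ`, of a bounded function that is
continuous on the closed strip and holomorphic in its interior. -/
def IsStripBoundary (A B : ℝ → ℂ) : Prop :=
  ∃ G : ℂ → ℂ, ContinuousOn G cstrip ∧ DifferentiableOn ℂ G ostrip ∧
    (∃ M : ℝ, ∀ z ∈ cstrip, ‖G z‖ ≤ M) ∧
    (∀ t : ℝ, G t = A t) ∧ ∀ t : ℝ, G (t + Real.pi * I) = B t

/-- The maximum principle on the strip. -/
theorem norm_le_of_boundary {G : ℂ → ℂ} (hc : ContinuousOn G cstrip)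
    (hd : DifferentiableOn ℂ G ostrip) {M : ℝ} (hM : ∀ z ∈ cstrip, ‖G z‖ ≤ M) {C : ℝ}
    (h0 : ∀ t : ℝ, ‖G t‖ ≤ C) (h1 : ∀ t : ℝ, ‖G (t + Real.pi * I)‖ ≤ C) {z : ℂ}
    (hz : z ∈ cstrip) : ‖G z‖ ≤ C := by
  refine PhragmenLindelof.horizontal_strip (a := 0) (b := Real.pi) (f := G) ⟨hd, ?_⟩
    ⟨0, by simp, 0, ?_⟩ ?_ ?_ hz.1 hz.2
  · rw [← closure_ostrip] at hc
    exact hc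
  · simp only [zero_mul, Real.exp_zero]
    refine Asymptotics.IsBigO.of_bound M ?_
    have : im ⁻¹' Ioo 0 Real.pi ∈ comap (fun x : ℂ => |x.re|) atTop ⊓ 𝓟 (im ⁻¹' Ioo 0 Real.pi) :=
      mem_inf_of_right (mem_principal_self _)
    filter_upwards [this] with w hw
    simpa using hM w (ostrip_subset_cstrip hw)
  · intro w hw
    rw [eq_ofReal_of_im_eq_zero hw]
    exact h0 _
  · intro w hw
    rw [eq_ofReal_add_pi_of_im_eq hw]
    exact h1 _

namespace IsStripBoundary

theorem zero : IsStripBoundary (fun _ => 0) (fun _ => 0) :=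
  ⟨fun _ => 0, continuousOn_const, differentiableOn_const _, ⟨0, by simp⟩, by simp, by simp⟩

theorem add {A B A' B' : ℝ → ℂ} (h : IsStripBoundary A B) (h' : IsStripBoundary A' B') :
    IsStripBoundary (fun t => A t + A' t) (fun t => B t + B' t) := by
  obtain ⟨G, hc, hd, ⟨M, hM⟩, h0, h1⟩ := h
  obtain ⟨G', hc', hd', ⟨M', hM'⟩, h0', h1'⟩ := h'
  refine ⟨fun z => G z + G' z, hc.add hc', hd.add hd', ⟨M + M', fun z hz => ?_⟩, ?_, ?_⟩
  · exact (norm_add_le _ _).trans (add_le_add (hM z hz) (hM' z hz))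
  · intro t; simp [h0, h0']
  · intro t; simp [h1, h1']

theorem mul {A B A' B' : ℝ → ℂ} (h : IsStripBoundary A B) (h' : IsStripBoundary A' B') :
    IsStripBoundary (fun t => A t * A' t) (fun t => B t * B' t) := by
  obtain ⟨G, hc, hd, ⟨M, hM⟩, h0, h1⟩ := h
  obtain ⟨G', hc', hd', ⟨M', hM'⟩, h0', h1'⟩ := h'
  refine ⟨fun z => G z * G' z, hc.mul hc', hd.mul hd', ⟨M * M', fun z hz => ?_⟩, ?_, ?_⟩
  · rw [norm_mul]
    exact mul_le_mul (hM z hz) (hM' z hz) (norm_nonneg _) ((norm_nonneg _).trans (hM z hz))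
  · intro t; simp [h0, h0']
  · intro t; simp [h1, h1']

theorem const (c : ℂ) : IsStripBoundary (fun _ => c) (fun _ => c) :=
  ⟨fun _ => c, continuousOn_const, differentiableOn_const _, ⟨‖c‖, by simp⟩, by simp, by simp⟩

theorem sum {ι : Type*} (s : Finset ι) {A B : ι → ℝ → ℂ}
    (h : ∀ i ∈ s, IsStripBoundary (A i) (B i)) :
    IsStripBoundary (fun t => ∑ i ∈ s, A i t) (fun t => ∑ i ∈ s, B i t) := by
  classical
  induction s using Finset.induction_on with
  | empty => simpa using zero
  | insert i s hi ih =>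
    simp only [Finset.sum_insert hi]
    exact (h i (Finset.mem_insert_self i s)).add
      (ih fun j hj => h j (Finset.mem_insert_of_mem hj))

/-- Since `Re (-a z²) = a (Im z)² - a (Re z)²`, the Gaussian is bounded on any horizontal strip. It
is the damping factor that tames exponential growth in `t`. -/
theorem gaussian {a : ℝ} (ha : 0 < a) :
    IsStripBoundary (fun t => cexp (-a * (t : ℂ) ^ 2))
      (fun t => cexp (-a * ((t : ℂ) + Real.pi * I) ^ 2)) := by
  refine ⟨fun z => cexp (-a * z ^ 2), by fun_prop, by fun_prop,
    ⟨Real.exp (a * Real.pi ^ 2), fun z hz => ?_⟩, fun t => rfl, fun t => rfl⟩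
  rw [norm_exp, Real.exp_le_exp]
  have h1 : (-(a : ℂ) * z ^ 2).re = a * z.im ^ 2 - a * z.re ^ 2 := by
    simp [pow_two]; ring
  rw [h1]
  have h2 : z.im ^ 2 ≤ Real.pi ^ 2 := pow_le_pow_left₀ hz.1 hz.2 2
  nlinarith [sq_nonneg z.re, mul_le_mul_of_nonneg_left h2 ha.le, mul_nonneg ha.le (sq_nonneg z.re)]

/-- Pairs of boundary values are closed under uniform limits. -/
theorem of_approx {A B : ℝ → ℂ}
    (h : ∀ δ > 0, ∃ A' B', IsStripBoundary A' B' ∧ ∀ t, ‖A' t - A t‖ ≤ δ ∧ ‖B' t - B t‖ ≤ δ) :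
    IsStripBoundary A B := by
  have hpos : ∀ n : ℕ, (0 : ℝ) < 1 / (n + 1) := fun n => by positivity
  choose A' B' hAB happ using fun n : ℕ => h _ (hpos n)
  choose G hc hd hM h0 h1 using hAB
  -- The maximum principle applied to differences: closeness on the two boundary lines makes the
  -- continuations uniformly Cauchy on the whole strip.
  have hdiff : ∀ m n : ℕ, ∀ z ∈ cstrip, ‖G m z - G n z‖ ≤ 1 / (m + 1) + 1 / (n + 1) := by
    intro m n z hz
    obtain ⟨M, hM⟩ := hM m
    obtain ⟨M', hM'⟩ := ‹∀ n, ∃ M : ℝ, ∀ z ∈ cstrip, ‖G n z‖ ≤ M› n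
    refine norm_le_of_boundary ((hc m).sub (hc n)) ((hd m).sub (hd n)) (M := M + M') ?_ ?_ ?_ hz
    · intro w hw
      exact (norm_sub_le _ _).trans (add_le_add (hM w hw) (hM' w hw))
    · intro t
      simp only [h0, Pi.sub_apply]
      rw [← sub_sub_sub_cancel_right _ _ (A t)]
      exact (norm_sub_le _ _).trans (add_le_add (happ m t).1 (happ n t).1)
    · intro t
      simp only [h1, Pi.sub_apply]
      rw [← sub_sub_sub_cancel_right _ _ (B t)]
      exact (norm_sub_le _ _).trans (add_le_add (happ m t).2 (happ n t).2)
  have hlim0 : Tendsto (fun n : ℕ => (1 : ℝ) / (n + 1)) atTop (𝓝 0) :=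
    tendsto_one_div_add_atTop_nhds_zero_nat
  have hcauchy : UniformCauchySeqOn G atTop cstrip := by
    rw [Metric.uniformCauchySeqOn_iff]
    intro ε hε
    obtain ⟨N, hN⟩ := (hlim0.eventually (gt_mem_nhds (half_pos hε))).exists_forall_of_atTop
    refine ⟨N, fun m hm n hn z hz => ?_⟩
    rw [dist_eq_norm]
    have := hdiff m n z hz
    have := hN m hm
    have := hN n hn
    linarith
  have hex : ∀ z, ∃ w, z ∈ cstrip → Tendsto (fun n => G n z) atTop (𝓝 w) := by
    intro z
    by_cases hz : z ∈ cstrip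
    · obtain ⟨w, hw⟩ := cauchySeq_tendsto_of_complete (hcauchy.cauchySeq hz)
      exact ⟨w, fun _ => hw⟩
    · exact ⟨0, fun h => absurd h hz⟩
  choose Gl hGl using hex
  have hunif : TendstoUniformlyOn G Gl atTop cstrip :=
    hcauchy.tendstoUniformlyOn_of_tendsto fun z hz => hGl z hz
  refine ⟨Gl, hunif.continuousOn (Frequently.of_forall hc), ?_, ?_, ?_, ?_⟩
  · exact (hunif.mono ostrip_subset_cstrip).tendstoLocallyUniformlyOn.differentiableOn
      (Eventually.of_forall hd) isOpen_ostrip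
  · obtain ⟨M, hM⟩ := hM 0
    refine ⟨M + 2, fun z hz => ?_⟩
    refine le_of_tendsto (hGl z hz).norm (Eventually.of_forall fun n => ?_)
    have e1 := hdiff n 0 z hz
    have e2 := hM z hz
    have e3 := norm_sub_norm_le (G n z) (G 0 z)
    have e4 : (1 : ℝ) / (n + 1) ≤ 1 := by
      rw [div_le_one (by positivity)]; linarith [(Nat.cast_nonneg n : (0 : ℝ) ≤ n)]
    norm_num at e1 e4
    linarith
  · intro t
    refine tendsto_nhds_unique (hGl t (ofReal_mem_cstrip t)) ?_
    simp only [h0]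
    rw [tendsto_iff_norm_sub_tendsto_zero]
    exact squeeze_zero (fun _ => norm_nonneg _) (fun n => (happ n t).1) hlim0
  · intro t
    refine tendsto_nhds_unique (hGl _ (ofReal_add_pi_mem_cstrip t)) ?_
    simp only [h1]
    rw [tendsto_iff_norm_sub_tendsto_zero]
    exact squeeze_zero (fun _ => norm_nonneg _) (fun n => (happ n t).2) hlim0

end IsStripBoundary

/-! ## Gaussian mollification -/

/-- The entire extension of the normalised Gaussian density `(m / √π) exp (- m² x²)`. -/
def mollifier (m : ℝ) (z : ℂ) : ℂ := ((m / √Real.pi : ℝ) : ℂ) * cexp (-(m : ℂ) ^ 2 * z ^ 2)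

theorem continuous_mollifier (m : ℝ) : Continuous (mollifier m) := by
  unfold mollifier; fun_prop

theorem differentiable_mollifier (m : ℝ) : Differentiable ℂ (mollifier m) := by
  unfold mollifier; fun_prop

theorem norm_mollifier {m : ℝ} (hm : 0 < m) (z : ℂ) :
    ‖mollifier m z‖ = m / √Real.pi * (Real.exp (m ^ 2 * z.im ^ 2) * Real.exp (-m ^ 2 * z.re ^ 2)) := by
  rw [mollifier, norm_mul, norm_real, Real.norm_of_nonneg (by positivity), norm_exp, ← Real.exp_add]
  congr 2
  rw [neg_mul, ← ofReal_pow, neg_re, re_ofReal_mul]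
  simp [pow_two]; ring

theorem mollifier_ofReal (m x : ℝ) :
    mollifier m x = ((m / √Real.pi * Real.exp (-m ^ 2 * x ^ 2) : ℝ) : ℂ) := by
  simp [mollifier]

theorem integrable_gaussian_sub {m : ℝ} (hm : 0 < m) (t : ℝ) :
    Integrable fun x : ℝ => Real.exp (-m ^ 2 * (t - x) ^ 2) := by
  have := (integrable_exp_neg_mul_sq (b := m ^ 2) (by positivity)).comp_sub_left t
  simpa using this

theorem integrable_norm_mollifier {m : ℝ} (hm : 0 < m) (z : ℂ) :
    Integrable fun x : ℝ => ‖mollifier m (z - x)‖ := by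
  have h : (fun x : ℝ => ‖mollifier m (z - x)‖) = fun x : ℝ =>
      m / √Real.pi * Real.exp (m ^ 2 * z.im ^ 2) * Real.exp (-m ^ 2 * (z.re - x) ^ 2) := by
    funext x
    rw [norm_mollifier hm]
    simp [mul_assoc]
  rw [h]
  exact (integrable_gaussian_sub hm z.re).const_mul _

theorem integrable_mollifier {m : ℝ} (hm : 0 < m) (z : ℂ) :
    Integrable fun x : ℝ => mollifier m (z - x) :=
  (integrable_norm_iff ((continuous_mollifier m).comp (by fun_prop)).aestronglyMeasurable).1
    (integrable_norm_mollifier hm z)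

theorem integral_mollifier {m : ℝ} (hm : 0 < m) (t : ℝ) :
    ∫ x : ℝ, m / √Real.pi * Real.exp (-m ^ 2 * (t - x) ^ 2) = 1 := by
  rw [integral_const_mul, integral_sub_left_eq_self (fun x : ℝ => Real.exp (-m ^ 2 * x ^ 2)),
    integral_gaussian, Real.sqrt_div Real.pi_pos.le, Real.sqrt_sq hm.le]
  have : √Real.pi ≠ 0 := by positivity
  field_simp

theorem integrable_sq_mul_gaussian {m : ℝ} (hm : 0 < m) (t : ℝ) :
    Integrable fun x : ℝ => (t - x) ^ 2 * Real.exp (-m ^ 2 * (t - x) ^ 2) := by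
  have := (integrable_rpow_mul_exp_neg_mul_sq (b := m ^ 2) (by positivity) (s := 2)
    (by norm_num)).comp_sub_left t
  simpa using this

/-- The second moment of the unit mollifier. -/
def secondMoment : ℝ := ∫ x : ℝ, 1 / √Real.pi * (x ^ 2 * Real.exp (-x ^ 2))

/-- Rescaling by `m` extracts the factor `m⁻²`, whose decay drives the convergence of the
mollification. -/
theorem integral_sq_mul_mollifier {m : ℝ} (hm : 0 < m) (t : ℝ) :
    ∫ x : ℝ, m / √Real.pi * ((t - x) ^ 2 * Real.exp (-m ^ 2 * (t - x) ^ 2)) =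
      secondMoment / m ^ 2 := by
  rw [integral_sub_left_eq_self
    (fun x : ℝ => m / √Real.pi * (x ^ 2 * Real.exp (-m ^ 2 * x ^ 2)))]
  have h := Measure.integral_comp_mul_left
    (fun x : ℝ => 1 / √Real.pi * (x ^ 2 * Real.exp (-x ^ 2))) m
  rw [abs_of_pos (inv_pos.2 hm), smul_eq_mul] at h
  rw [← inv_mul_eq_iff_eq_mul₀ (by positivity), inv_inv] at h
  rw [secondMoment, ← h, ← integral_const_mul, ← integral_div]
  refine integral_congr_ae (Eventually.of_forall fun x => ?_)
  have h1 : -m ^ 2 * x ^ 2 = -(m * x) ^ 2 := by ring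
  simp only [h1]
  field_simp

/-- The mollification of a function on the plane, at complex points of the diagonal. -/
def mollify (m : ℝ) (Θ : ℝ → ℝ → ℂ) (z : ℂ) : ℂ :=
  ∫ p : ℝ × ℝ, Θ p.1 p.2 * (mollifier m (z - p.1) * mollifier m (z - p.2))

theorem integrable_mul_mollifier {Θ : ℝ → ℝ → ℂ} (hc : Continuous fun p : ℝ × ℝ => Θ p.1 p.2)
    {M : ℝ} (hM : ∀ x y, ‖Θ x y‖ ≤ M) {m : ℝ} (hm : 0 < m) (z w : ℂ) :
    Integrable (fun p : ℝ × ℝ => Θ p.1 p.2 * (mollifier m (z - p.1) * mollifier m (w - p.2)))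
      (volume.prod volume) := by
  refine Integrable.bdd_mul (c := M) ((integrable_mollifier hm z).mul_prod (integrable_mollifier hm w))
    hc.aestronglyMeasurable (Eventually.of_forall fun p => hM _ _)

/-- The product kernel is a probability density for real `t`, so the constant `δ` survives
integration and each square contributes one second moment. The quadratic form of the hypothesis is
what makes the error explicit in `m` and uniform in `t`. -/
theorem norm_mollify_sub_le {Θ : ℝ → ℝ → ℂ} (hc : Continuous fun p : ℝ × ℝ => Θ p.1 p.2)
    {M : ℝ} (hM : ∀ x y, ‖Θ x y‖ ≤ M) {δ C : ℝ}
    (hδ : ∀ t x y, ‖Θ x y - Θ t t‖ ≤ δ + C * ((t - x) ^ 2 + (t - y) ^ 2)) {m : ℝ} (hm : 0 < m)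
    (t : ℝ) : ‖mollify m Θ t - Θ t t‖ ≤ δ + C * (2 * (secondMoment / m ^ 2)) := by
  set k : ℝ → ℝ := fun x => m / √Real.pi * Real.exp (-m ^ 2 * (t - x) ^ 2) with hk
  have hk0 : ∀ x, 0 ≤ k x := fun x => by simp only [hk]; positivity
  have hkm : ∀ x : ℝ, mollifier m ((t : ℂ) - x) = (k x : ℂ) := by
    intro x
    rw [← ofReal_sub, mollifier_ofReal]
  have hki : Integrable k := (integrable_gaussian_sub hm t).const_mul _
  have hk1 : ∫ x, k x = 1 := integral_mollifier hm t
  set q : ℝ → ℝ := fun x => m / √Real.pi * ((t - x) ^ 2 * Real.exp (-m ^ 2 * (t - x) ^ 2)) with hq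
  have hqi : Integrable q := (integrable_sq_mul_gaussian hm t).const_mul _
  have hq1 : ∫ x, q x = secondMoment / m ^ 2 := integral_sq_mul_mollifier hm t
  have hkq : ∀ x, (t - x) ^ 2 * k x = q x := fun x => by simp only [hk, hq]; ring
  have hkk : Integrable (fun p : ℝ × ℝ => k p.1 * k p.2) (volume.prod volume) := hki.mul_prod hki
  have hqk : Integrable (fun p : ℝ × ℝ => q p.1 * k p.2) (volume.prod volume) := hqi.mul_prod hki
  have hkq' : Integrable (fun p : ℝ × ℝ => k p.1 * q p.2) (volume.prod volume) := hki.mul_prod hqi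
  have hone : ∫ p : ℝ × ℝ, k p.1 * k p.2 = 1 := by
    rw [Measure.volume_eq_prod, integral_prod_mul, hk1, one_mul]
  have hconst : Θ t t = ∫ p : ℝ × ℝ, Θ t t * ((k p.1 * k p.2 : ℝ) : ℂ) := by
    rw [integral_const_mul, integral_complex_ofReal, hone]; simp
  have hint : Integrable fun p : ℝ × ℝ =>
      Θ p.1 p.2 * (mollifier m ((t : ℂ) - p.1) * mollifier m ((t : ℂ) - p.2)) :=
    integrable_mul_mollifier hc hM hm (t : ℂ) (t : ℂ)
  have hint2 : Integrable (fun p : ℝ × ℝ => Θ t t * ((k p.1 * k p.2 : ℝ) : ℂ)) := hkk.ofReal.const_mul _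
  have hbi : Integrable (fun p : ℝ × ℝ => δ * (k p.1 * k p.2) + C * (q p.1 * k p.2 + k p.1 * q p.2)) :=
    (hkk.const_mul _).add ((hqk.add hkq').const_mul _)
  rw [hconst, mollify, ← integral_sub hint hint2]
  refine (norm_integral_le_of_norm_le hbi (Eventually.of_forall fun p => ?_)).trans_eq ?_
  · simp only [hkm]
    rw [← ofReal_mul, ← sub_mul, norm_mul, norm_real,
      Real.norm_of_nonneg (mul_nonneg (hk0 _) (hk0 _))]
    refine (mul_le_mul_of_nonneg_right (hδ t p.1 p.2) (mul_nonneg (hk0 _) (hk0 _))).trans_eq ?_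
    rw [← hkq, ← hkq]; ring
  · rw [Measure.volume_eq_prod] at hone ⊢
    have hadd : Integrable (fun p : ℝ × ℝ => q p.1 * k p.2 + k p.1 * q p.2)
      (volume.prod volume) := hqk.add hkq'
    rw [integral_add (hkk.const_mul _) (hadd.const_mul _), integral_const_mul,
      integral_const_mul, integral_add hqk hkq', hone, integral_prod_mul,
      integral_prod_mul, hk1, hq1]
    ring

theorem differentiable_mollify {Θ : ℝ → ℝ → ℂ} (hc : Continuous fun p : ℝ × ℝ => Θ p.1 p.2)
    {M : ℝ} (hM : ∀ x y, ‖Θ x y‖ ≤ M) {m : ℝ} (hm : 0 < m) : Differentiable ℂ (mollify m Θ) := by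
  intro z₀
  have hM0 : 0 ≤ M := (norm_nonneg _).trans (hM 0 0)
  -- A majorant valid on the unit ball about `z₀`: half of the Gaussian exponent and the additional
  -- `m ^ 2` pay for a change of the real part by at most 1, and `|z₀.im| + 1` bounds the imaginary
  -- part.
  set k : ℝ → ℝ := fun x => m / √Real.pi * (Real.exp (m ^ 2 * (|z₀.im| + 1) ^ 2 + m ^ 2) *
    Real.exp (-(m ^ 2 / 2) * (z₀.re - x) ^ 2)) with hk
  have hki : Integrable k := by
    have := ((integrable_exp_neg_mul_sq (b := m ^ 2 / 2) (by positivity)).comp_sub_left z₀.re)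
    exact (this.const_mul _).const_mul _
  have hkb : ∀ z ∈ Metric.ball z₀ 1, ∀ x : ℝ, ‖mollifier m (z - x)‖ ≤ k x := by
    intro z hz x
    rw [norm_mollifier hm, hk]
    refine mul_le_mul_of_nonneg_left ?_ (by positivity)
    rw [← Real.exp_add, ← Real.exp_add, Real.exp_le_exp]
    have hz' : ‖z - z₀‖ < 1 := by simpa [dist_eq_norm] using hz
    have h1 : |z.re - z₀.re| ≤ 1 := by
      simpa using (abs_re_le_norm (z - z₀)).trans hz'.le
    have h2 : |z.im - z₀.im| ≤ 1 := by
      simpa using (abs_im_le_norm (z - z₀)).trans hz'.le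
    have h3 : z.im ^ 2 ≤ (|z₀.im| + 1) ^ 2 := by
      rw [← sq_abs z.im]
      refine pow_le_pow_left₀ (abs_nonneg _) ?_ 2
      have := abs_sub_abs_le_abs_sub z.im z₀.im
      linarith
    have h4 : (z₀.re - x) ^ 2 / 2 ≤ (z.re - x) ^ 2 + 1 := by
      have h5 : (z.re - z₀.re) ^ 2 ≤ 1 := by
        rw [← sq_abs]; nlinarith [abs_nonneg (z.re - z₀.re)]
      nlinarith [sq_nonneg (z.re - x + (z.re - z₀.re))]
    simp only [sub_im, ofReal_im, sub_zero, sub_re, ofReal_re]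
    have hm2 : 0 ≤ m ^ 2 := by positivity
    nlinarith [mul_le_mul_of_nonneg_left h3 hm2, mul_le_mul_of_nonneg_left h4 hm2]
  have := differentiableOn_integral_of_norm_le (μ := (volume : Measure (ℝ × ℝ)))
    (F := fun z (p : ℝ × ℝ) => Θ p.1 p.2 * (mollifier m (z - p.1) * mollifier m (z - p.2)))
    (U := Metric.ball z₀ 1) (bound := fun p => M * (k p.1 * k p.2)) Metric.isOpen_ball ?_ ?_ ?_ ?_
  · exact this.differentiableAt (Metric.ball_mem_nhds z₀ one_pos)
  · intro z _
    exact (integrable_mul_mollifier hc hM hm z z).aestronglyMeasurable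
  · intro p
    refine Differentiable.differentiableOn ?_
    have h := differentiable_mollifier m
    exact (((h.comp (differentiable_id.sub_const _)).mul
      (h.comp (differentiable_id.sub_const _))).const_mul _)
  · intro z hz p
    rw [norm_mul, norm_mul]
    exact mul_le_mul (hM _ _) (mul_le_mul (hkb z hz _) (hkb z hz _) (norm_nonneg _)
      ((norm_nonneg _).trans (hkb z hz _))) (by positivity) hM0
  · exact (hki.mul_prod hki).const_mul M

/-- On the strip each kernel grows at most by `exp (m² π²)`. The bound deteriorates with `m`, but
only finiteness matters: it is what admits the maximum principle. -/
theorem norm_mollify_le {Θ : ℝ → ℝ → ℂ} {M : ℝ} (hM : ∀ x y, ‖Θ x y‖ ≤ M) {m : ℝ} (hm : 0 < m)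
    {z : ℂ} (hz : z ∈ cstrip) : ‖mollify m Θ z‖ ≤ M * Real.exp (m ^ 2 * Real.pi ^ 2) ^ 2 := by
  have hM0 : 0 ≤ M := (norm_nonneg _).trans (hM 0 0)
  set k : ℝ → ℝ := fun x => m / √Real.pi * Real.exp (-m ^ 2 * (z.re - x) ^ 2) with hk
  have hk0 : ∀ x, 0 ≤ k x := fun x => by simp only [hk]; positivity
  have hki : Integrable k := (integrable_gaussian_sub hm z.re).const_mul _
  have hk1 : ∫ x, k x = 1 := integral_mollifier hm z.re
  set E := Real.exp (m ^ 2 * Real.pi ^ 2) with hE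
  have hb : ∀ x : ℝ, ‖mollifier m (z - x)‖ ≤ E * k x := by
    intro x
    rw [norm_mollifier hm, hk]
    simp only [sub_im, ofReal_im, sub_zero, sub_re, ofReal_re]
    have : Real.exp (m ^ 2 * z.im ^ 2) ≤ E := by
      rw [hE, Real.exp_le_exp]
      exact mul_le_mul_of_nonneg_left (pow_le_pow_left₀ hz.1 hz.2 2) (by positivity)
    have h2 := mul_le_mul_of_nonneg_right this (hk0 x)
    simp only [hk] at h2
    linarith
  have hbi : Integrable (fun p : ℝ × ℝ => (M * E ^ 2) * (k p.1 * k p.2)) :=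
    (hki.mul_prod hki).const_mul _
  refine (norm_integral_le_of_norm_le hbi (Eventually.of_forall fun p => ?_)).trans_eq ?_
  · rw [norm_mul, norm_mul]
    refine (mul_le_mul (hM _ _) (mul_le_mul (hb _) (hb _) (norm_nonneg _)
      (mul_nonneg (Real.exp_pos _).le (hk0 _))) (by positivity) hM0).trans_eq ?_
    ring
  · rw [integral_const_mul, Measure.volume_eq_prod, integral_prod_mul, hk1]; ring

/-- Shifting the contour of integration from one boundary line of the strip to the other. -/
theorem IsStripBoundary.integral_mul_mollifier {A B : ℝ → ℂ} (h : IsStripBoundary A B) {m : ℝ}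
    (hm : 0 < m) (t : ℝ) :
    ∫ x : ℝ, A x * mollifier m (t + Real.pi * I - x) = ∫ x : ℝ, B x * mollifier m (t - x) := by
  obtain ⟨G, hc, hd, ⟨M, hM⟩, h0, h1⟩ := h
  have hM0 : 0 ≤ M := (norm_nonneg _).trans (hM 0 (by simpa using ofReal_mem_cstrip 0))
  -- On the line `w = x + iπ` the kernel becomes `mollifier m (t - x)`, so the claim is equality of
  -- the integrals of `f` over the two boundary lines.
  set f : ℂ → ℂ := fun w => G w * mollifier m (t + Real.pi * I - w) with hf
  have hmc := continuous_mollifier m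
  have hfc : ContinuousOn f cstrip := hc.mul (hmc.comp (by fun_prop)).continuousOn
  have hfd : DifferentiableOn ℂ f ostrip :=
    hd.mul (((differentiable_mollifier m).comp (by fun_prop)).differentiableOn)
  set E := Real.exp (m ^ 2 * Real.pi ^ 2) with hE
  have hfb : ∀ w ∈ cstrip, ‖f w‖ ≤ M * (m / √Real.pi * (E * Real.exp (-m ^ 2 * (t - w.re) ^ 2))) := by
    intro w hw
    rw [hf, norm_mul, norm_mollifier hm]
    refine mul_le_mul (hM w hw) (mul_le_mul_of_nonneg_left (mul_le_mul ?_ ?_ (by positivity)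
      (by positivity)) (by positivity)) (by positivity) hM0
    · rw [hE, Real.exp_le_exp]
      refine mul_le_mul_of_nonneg_left (pow_le_pow_left₀ ?_ ?_ 2) (by positivity)
      · simpa using hw.2
      · simpa using hw.1
    · simp
  have hline : ∀ c : ℂ, (∀ x : ℝ, (x : ℂ) + c ∈ cstrip) → c.re = 0 →
      Integrable fun x : ℝ => f (x + c) := by
    intro c hcs hre
    refine Integrable.mono' (g := fun x : ℝ =>
      M * (m / √Real.pi * (E * Real.exp (-m ^ 2 * (t - x) ^ 2)))) ?_ ?_ ?_
    · exact (((integrable_gaussian_sub hm t).const_mul _).const_mul _).const_mul _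
    · exact (hfc.comp_continuous (by fun_prop) hcs).aestronglyMeasurable
    · refine Eventually.of_forall fun x => (hfb _ (hcs x)).trans_eq ?_
      simp [hre]
  have hi0 := hline 0 (fun x => by simpa using ofReal_mem_cstrip x) rfl
  have hi1 := hline (Real.pi * I) ofReal_add_pi_mem_cstrip (by simp)
  -- Cauchy's theorem on the rectangle `[-n, n] × [0, π]`.
  have hrect : ∀ n : ℕ, (((∫ x : ℝ in (-(n : ℝ))..n, f (x + 0)) -
      ∫ x : ℝ in (-(n : ℝ))..n, f (x + Real.pi * I)) +
      I • ∫ y : ℝ in (0 : ℝ)..Real.pi, f (((n : ℝ) : ℂ) + y * I)) -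
      I • ∫ y : ℝ in (0 : ℝ)..Real.pi, f (((-(n : ℝ) : ℝ) : ℂ) + y * I) = 0 := by
    intro n
    have := integral_boundary_rect_eq_zero_of_continuousOn_of_differentiableOn f
      (((-(n : ℝ) : ℝ) : ℂ)) (((n : ℝ) : ℂ) + Real.pi * I) ?_ ?_
    · simpa using this
    · refine hfc.mono fun w hw => ?_
      have := hw.2
      simpa [cstrip, uIcc_of_le Real.pi_pos.le] using this
    · refine hfd.mono fun w hw => ?_
      have := hw.2
      simpa [ostrip, Real.pi_pos.le] using this
  -- The vertical sides, at `n` for `s = 1` and at `-n` for `s = -1`, vanish in the limit because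
  -- `G` is bounded and the kernel decays like a Gaussian.
  have hvert : ∀ s : ℝ, (s = 1 ∨ s = -1) → Tendsto (fun n : ℕ =>
      ∫ y : ℝ in (0 : ℝ)..Real.pi, f (((s * n : ℝ) : ℂ) + y * I)) atTop (𝓝 0) := by
    intro s hs
    have hlim : Tendsto (fun n : ℕ =>
        M * (m / √Real.pi * (E * Real.exp (-m ^ 2 * (t - s * n) ^ 2))) * |Real.pi - 0|)
        atTop (𝓝 0) := by
      have h1 : Tendsto (fun n : ℕ => (t - s * n) ^ 2) atTop atTop := by
        have : ∀ n : ℕ, (t - s * n) ^ 2 = ((n : ℝ) - s * t) ^ 2 := by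
          intro n; rcases hs with rfl | rfl <;> ring
        simp only [this]
        exact (tendsto_pow_atTop two_ne_zero).comp
          (tendsto_atTop_add_const_right _ _ tendsto_natCast_atTop_atTop)
      have h2 : Tendsto (fun n : ℕ => Real.exp (-m ^ 2 * (t - s * n) ^ 2)) atTop (𝓝 0) := by
        refine Real.tendsto_exp_atBot.comp ?_
        exact h1.const_mul_atTop_of_neg (by simp; positivity)
      have h3 := (((h2.const_mul E).const_mul (m / √Real.pi)).const_mul M).mul_const |Real.pi - 0|
      simpa using h3
    refine squeeze_zero_norm (fun n => ?_) hlim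
    refine intervalIntegral.norm_integral_le_of_norm_le_const fun y hy => ?_
    rw [uIoc_of_le Real.pi_pos.le] at hy
    refine (hfb _ ?_).trans_eq (by simp)
    simpa [cstrip] using ⟨hy.1.le, hy.2⟩
  have hb0 := intervalIntegral_tendsto_integral hi0 (l := atTop) (a := fun n : ℕ => -(n : ℝ))
    (b := fun n : ℕ => (n : ℝ)) (tendsto_neg_atTop_atBot.comp tendsto_natCast_atTop_atTop)
    tendsto_natCast_atTop_atTop
  have hb1 := intervalIntegral_tendsto_integral hi1 (l := atTop) (a := fun n : ℕ => -(n : ℝ))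
    (b := fun n : ℕ => (n : ℝ)) (tendsto_neg_atTop_atBot.comp tendsto_natCast_atTop_atTop)
    tendsto_natCast_atTop_atTop
  have hv1 := (hvert 1 (Or.inl rfl)).const_smul I
  have hv2 := (hvert (-1) (Or.inr rfl)).const_smul I
  have hall := ((hb0.sub hb1).add hv1).sub hv2
  have hfin := tendsto_nhds_unique (hall.congr (f₂ := fun _ => 0) fun n => by
    simpa only [one_mul, neg_one_mul] using hrect n) tendsto_const_nhds
  rw [smul_zero, add_zero, sub_zero, sub_eq_zero] at hfin
  simpa [hf, h0, h1] using hfin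

/-- Within distance `η` of the diagonal point uniform continuity gives `δ`; farther away the trivial
bound `2M` is at most `2M / η²` times the squared distance. -/
theorem exists_norm_sub_le_add_sq {Θ : ℝ → ℝ → ℂ}
    (hc : UniformContinuous fun p : ℝ × ℝ => Θ p.1 p.2) {M : ℝ} (hM : ∀ x y, ‖Θ x y‖ ≤ M)
    {δ : ℝ} (hδ : 0 < δ) :
    ∃ C, ∀ t x y, ‖Θ x y - Θ t t‖ ≤ δ + C * ((t - x) ^ 2 + (t - y) ^ 2) := by
  have hM0 : 0 ≤ M := (norm_nonneg _).trans (hM 0 0)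
  obtain ⟨η, hη, h⟩ := Metric.uniformContinuous_iff.1 hc δ hδ
  refine ⟨2 * M / η ^ 2, fun t x y => ?_⟩
  by_cases hd : dist (x, y) (t, t) < η
  · have := (h hd).le
    rw [dist_eq_norm] at this
    refine this.trans (le_add_of_nonneg_right (by positivity))
  · rw [not_lt, Prod.dist_eq, Real.dist_eq, Real.dist_eq] at hd
    have hsq : η ^ 2 ≤ (t - x) ^ 2 + (t - y) ^ 2 := by
      rcases le_max_iff.1 hd with h | h
      · have := pow_le_pow_left₀ hη.le h 2
        rw [sq_abs] at this
        nlinarith [sq_nonneg (t - y)]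
      · have := pow_le_pow_left₀ hη.le h 2
        rw [sq_abs] at this
        nlinarith [sq_nonneg (t - x)]
    have h2 : ‖Θ x y - Θ t t‖ ≤ 2 * M := by
      have := norm_sub_le (Θ x y) (Θ t t)
      linarith [hM x y, hM t t]
    have h3 : 2 * M ≤ 2 * M / η ^ 2 * ((t - x) ^ 2 + (t - y) ^ 2) := by
      rw [div_mul_eq_mul_div, le_div_iff₀ (by positivity)]
      exact mul_le_mul_of_nonneg_left hsq (by positivity)
    linarith

theorem tendsto_mollify_bound (δ C : ℝ) :
    Tendsto (fun n : ℕ => δ + C * (2 * (secondMoment / ((n : ℝ) + 1) ^ 2))) atTop (𝓝 δ) := by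
  have h1 : Tendsto (fun n : ℕ => secondMoment / ((n : ℝ) + 1) ^ 2) atTop (𝓝 0) :=
    tendsto_const_nhds.div_atTop ((tendsto_pow_atTop two_ne_zero).comp
      (tendsto_atTop_add_const_right _ _ tendsto_natCast_atTop_atTop))
  simpa using ((h1.const_mul 2).const_mul C).const_add δ

/-- Two successive continuations, in the second and then in the first variable, give a simultaneous
continuation along the diagonal. -/
theorem IsStripBoundary.diagonal {Θ K Θ' : ℝ → ℝ → ℂ}
    (hΘ : UniformContinuous fun p : ℝ × ℝ => Θ p.1 p.2)
    (hK : Continuous fun p : ℝ × ℝ => K p.1 p.2)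
    (hΘ' : UniformContinuous fun p : ℝ × ℝ => Θ' p.1 p.2)
    {M : ℝ} (hΘM : ∀ x y, ‖Θ x y‖ ≤ M) (hKM : ∀ x y, ‖K x y‖ ≤ M) (hΘM' : ∀ x y, ‖Θ' x y‖ ≤ M)
    (h₂ : ∀ x, IsStripBoundary (Θ x) (K x))
    (h₁ : ∀ y, IsStripBoundary (fun x => K x y) (fun x => Θ' x y)) :
    IsStripBoundary (fun t => Θ t t) (fun t => Θ' t t) := by
  -- The contour in `y` is shifted with `x` fixed, which turns `Θ` into `K`; after Fubini the
  -- contour in `x` is shifted with `y` fixed, which turns `K` into `Θ'`.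
  have hshift : ∀ m : ℝ, 0 < m → ∀ t : ℝ,
      mollify m Θ (t + Real.pi * I) = mollify m Θ' t := by
    intro m hm t
    rw [mollify, mollify, Measure.volume_eq_prod,
      integral_prod _ (integrable_mul_mollifier hΘ.continuous hΘM hm _ _),
      integral_prod_symm _ (integrable_mul_mollifier hΘ'.continuous hΘM' hm _ _)]
    have hmid := integral_integral_swap (f := fun x y : ℝ => K x y *
      (mollifier m (t + Real.pi * I - x) * mollifier m (t - y)))
      (integrable_mul_mollifier hK hKM hm (t + Real.pi * I) t)
    calc _ = ∫ x : ℝ, mollifier m (t + Real.pi * I - x) *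
          ∫ y : ℝ, Θ x y * mollifier m (t + Real.pi * I - y) := by
            refine integral_congr_ae (Eventually.of_forall fun x => ?_)
            simp only
            rw [← integral_const_mul]
            refine integral_congr_ae (Eventually.of_forall fun y => ?_)
            simp only; ring
      _ = ∫ x : ℝ, ∫ y : ℝ, K x y *
          (mollifier m (t + Real.pi * I - x) * mollifier m (t - y)) := by
            refine integral_congr_ae (Eventually.of_forall fun x => ?_)
            simp only
            rw [(h₂ x).integral_mul_mollifier hm, ← integral_const_mul]
            refine integral_congr_ae (Eventually.of_forall fun y => ?_)
            simp only; ring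
      _ = _ := by
            rw [hmid]
            refine integral_congr_ae (Eventually.of_forall fun y => ?_)
            simp only
            have := (h₁ y).integral_mul_mollifier hm t
            calc _ = (∫ x : ℝ, K x y * mollifier m (t + Real.pi * I - x)) * mollifier m (t - y) := by
                  rw [← integral_mul_const]
                  refine integral_congr_ae (Eventually.of_forall fun x => ?_)
                  simp only; ring
              _ = _ := by
                  rw [this, ← integral_mul_const]
                  refine integral_congr_ae (Eventually.of_forall fun x => ?_)
                  simp only; ring
  refine IsStripBoundary.of_approx fun δ hδ => ?_
  obtain ⟨C, hC⟩ := exists_norm_sub_le_add_sq hΘ hΘM (half_pos hδ)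
  obtain ⟨C', hC'⟩ := exists_norm_sub_le_add_sq hΘ' hΘM' (half_pos hδ)
  obtain ⟨n, hn, hn'⟩ := (((tendsto_mollify_bound (δ / 2) C).eventually
    (gt_mem_nhds (half_lt_self hδ))).and ((tendsto_mollify_bound (δ / 2) C').eventually
    (gt_mem_nhds (half_lt_self hδ)))).exists
  have hm : (0 : ℝ) < (n : ℝ) + 1 := by positivity
  refine ⟨fun t => mollify (n + 1) Θ t, fun t => mollify (n + 1) Θ' t,
    ⟨mollify (n + 1) Θ, ?_, ?_, ⟨_, fun z hz => norm_mollify_le hΘM hm hz⟩, fun t => rfl,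
      hshift _ hm⟩, fun t => ⟨?_, ?_⟩⟩
  · exact (differentiable_mollify hΘ.continuous hΘM hm).continuous.continuousOn
  · exact (differentiable_mollify hΘ.continuous hΘM hm).differentiableOn
  · exact (norm_mollify_sub_le hΘ.continuous hΘM hC hm t).trans hn.le
  · exact (norm_mollify_sub_le hΘ'.continuous hΘM' hC' hm t).trans hn'.le

/-! ### Uniqueness of continuation from the real line. -/

/-- A function on the closed strip that vanishes on `ℝ` vanishes near `ℝ`: the product of the four
functions obtained by quarter turns about the centre of a square vanishes on its boundary. -/
theorem eq_zero_of_im_le {G : ℂ → ℂ} (hc : ContinuousOn G cstrip)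
    (hd : DifferentiableOn ℂ G ostrip) (h0 : ∀ t : ℝ, G t = 0) {c : ℂ} (hc0 : 0 < c.im)
    (hc1 : c.im ≤ Real.pi / 2) : G c = 0 := by
  -- The square centred at `c` with half-side `Im c` has its bottom side on `ℝ`, and `Im c ≤ π / 2`
  -- keeps its top side in the closed strip.
  set r := c.im with hr
  set Q : Set ℂ := Ioo (-r) r ×ℂ Ioo (-r) r with hQ
  have hcl : closure Q = Icc (-r) r ×ℂ Icc (-r) r := by
    rw [hQ, closure_reProdIm, closure_Ioo (by linarith)]
  have hQo : IsOpen Q := isOpen_Ioo.reProdIm isOpen_Ioo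
  have hmem : ∀ w : ℂ, |w.im| ≤ r → c + w ∈ cstrip := by
    intro w hw
    rw [abs_le] at hw
    simp only [cstrip, mem_preimage, add_im, mem_Icc]
    constructor <;> linarith
  have hmem' : ∀ w : ℂ, |w.im| < r → c + w ∈ ostrip := by
    intro w hw
    rw [abs_lt] at hw
    simp only [ostrip, mem_preimage, add_im, mem_Ioo]
    constructor <;> linarith
  have hfac : ∀ u : ℂ, (∀ w ∈ Q, |(u * w).im| < r) → (∀ w ∈ closure Q, |(u * w).im| ≤ r) →
      DiffContOnCl ℂ (fun w => G (c + u * w)) Q := by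
    intro u h1 h2
    refine ⟨hd.comp (by fun_prop) fun w hw => hmem' _ (h1 w hw),
      hc.comp (by fun_prop) fun w hw => hmem _ (h2 w hw)⟩
  have hQ1 : ∀ w ∈ Q, |w.re| < r ∧ |w.im| < r := fun w hw =>
    ⟨abs_lt.2 hw.1, abs_lt.2 hw.2⟩
  have hQ2 : ∀ w ∈ closure Q, |w.re| ≤ r ∧ |w.im| ≤ r := by
    intro w hw
    rw [hcl] at hw
    exact ⟨abs_le.2 hw.1, abs_le.2 hw.2⟩
  have hprod := (((hfac 1 (fun w hw => by simpa using (hQ1 w hw).2)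
      (fun w hw => by simpa using (hQ2 w hw).2)).smul
    (hfac (-1) (fun w hw => by simpa using (hQ1 w hw).2)
      (fun w hw => by simpa using (hQ2 w hw).2))).smul
    (hfac I (fun w hw => by simpa using (hQ1 w hw).1)
      (fun w hw => by simpa using (hQ2 w hw).1))).smul
    (hfac (-I) (fun w hw => by simpa using (hQ1 w hw).1)
      (fun w hw => by simpa using (hQ2 w hw).1))
  have hbd : Bornology.IsBounded Q :=
    (Metric.isBounded_Ioo (-r) r).reProdIm (Metric.isBounded_Ioo (-r) r)
  have hreal : ∀ w : ℂ, w.im = -r → G (c + w) = 0 := by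
    intro w hw
    rw [eq_ofReal_of_im_eq_zero (z := c + w) (by rw [add_im, hw]; ring)]
    exact h0 _
  have key := norm_le_of_forall_mem_frontier_norm_le hbd hprod (C := 0) ?_
    (subset_closure (show (0 : ℂ) ∈ Q from ⟨by simpa using hc0, by simpa using hc0⟩))
  · by_contra hne
    have hpos := norm_pos_iff.2 hne
    have : 0 < ‖G c‖ * ‖G c‖ * ‖G c‖ * ‖G c‖ := by positivity
    simp at key
    linarith
  · intro w hw
    have hw1 := hQ2 w (frontier_subset_closure hw)
    have hw2 : w ∉ Q := by
      have := hw.2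
      rwa [hQo.interior_eq] at this
    have hcases : w.re = r ∨ w.re = -r ∨ w.im = r ∨ w.im = -r := by
      by_contra! hne
      rw [abs_le, abs_le] at hw1
      exact hw2 ⟨⟨lt_of_le_of_ne hw1.1.1 (Ne.symm hne.2.1), lt_of_le_of_ne hw1.1.2 hne.1⟩,
        ⟨lt_of_le_of_ne hw1.2.1 (Ne.symm hne.2.2.2), lt_of_le_of_ne hw1.2.2 hne.2.2.1⟩⟩
    -- For each side of the square, one of the four quarter turns carries it to the bottom side,
    -- where `G` vanishes.
    rcases hcases with h | h | h | h
    · simp [hreal (-I * w) (by simp [h]), -neg_mul]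
    · simp [hreal (I * w) (by simp [h])]
    · simp [hreal (-1 * w) (by simp [h]), -neg_mul]
    · simp [hreal (1 * w) (by simp [h]), -one_mul]

/-- A function that is continuous on the closed strip and holomorphic in its interior is determined
by its values on `ℝ`. -/
theorem eq_zero_of_eq_zero_on_real {G : ℂ → ℂ} (hc : ContinuousOn G cstrip)
    (hd : DifferentiableOn ℂ G ostrip) (h0 : ∀ t : ℝ, G t = 0) {z : ℂ} (hz : z ∈ cstrip) :
    G z = 0 := by
  have hpi := Real.pi_pos
  have hint : EqOn G 0 ostrip := by
    refine AnalyticOnNhd.eqOn_of_preconnected_of_eventuallyEq (hd.analyticOnNhd isOpen_ostrip)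
      analyticOnNhd_const ?_ (z₀ := ((Real.pi / 4 : ℝ) : ℂ) * I) ?_ ?_
    · exact (convex_Ioo 0 Real.pi).is_linear_preimage imLm.isLinear |>.isPreconnected
    -- The base point `iπ/4` lies in the lower half of the strip, where vanishing is already known;
    -- the identity theorem spreads it over the open strip.
    · simp only [ostrip, mem_preimage, mem_Ioo, im_ofReal_mul, I_im]
      constructor <;> linarith
    · have hopen : IsOpen (im ⁻¹' Ioo 0 (Real.pi / 2)) := isOpen_Ioo.preimage continuous_im
      filter_upwards [hopen.mem_nhds (show ((Real.pi / 4 : ℝ) : ℂ) * I ∈ im ⁻¹' Ioo 0 (Real.pi / 2)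
        by simp only [mem_preimage, mem_Ioo, im_ofReal_mul, I_im]; constructor <;> linarith)]
        with w hw
      exact eq_zero_of_im_le hc hd h0 hw.1 hw.2.le
  have hcl : EqOn G 0 (closure ostrip) :=
    EqOn.of_subset_closure hint (closure_ostrip ▸ hc) continuousOn_const
      subset_closure subset_rfl
  exact hcl (closure_ostrip ▸ hz)

/-! ## The topology of `C^∞(S¹)` -/

namespace SmoothCircle

theorem withSeminorms_cNorm : WithSeminorms cNormFamily := ⟨rfl⟩

@[simp] theorem pull_add (f g : SmoothCircle) : (f + g).pull = f.pull + g.pull := rfl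

@[simp] theorem pull_smul (c : ℂ) (f : SmoothCircle) : (c • f).pull = c • f.pull := rfl

@[simp] theorem pull_sub (f g : SmoothCircle) : (f - g).pull = f.pull - g.pull := rfl

@[ext] theorem ext {f g : SmoothCircle} (h : ∀ z, f z = g z) : f = g := Subtype.ext (funext h)

theorem pull_injective : Function.Injective pull := by
  intro f g h
  ext z
  have := congrFun h (arg z)
  simpa [pull] using this

theorem periodic_pull (f : SmoothCircle) : Function.Periodic f.pull (2 * Real.pi) := by
  intro θ
  simp [pull]

theorem apply_eq_pull (f : SmoothCircle) (z : Circle) : f z = f.pull (arg z) := by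
  simp [pull]

/-- A smooth function on the circle from a smooth `2π`-periodic function. -/
def ofPeriodic (p : ℝ → ℂ) (hp : ContDiff ℝ ∞ p) (hper : Function.Periodic p (2 * Real.pi)) :
    SmoothCircle :=
  ⟨fun z => p (arg z), by
    have h : (fun θ : ℝ => p (arg (Circle.exp θ))) = p := by
      funext θ
      have h1 : (Circle.exp (arg (Circle.exp θ))) = Circle.exp θ := Circle.exp_arg _
      obtain ⟨n, hn⟩ := Circle.exp_eq_exp.1 h1
      rw [hn]
      exact (hper.int_mul n) θ
    change ContDiff ℝ ∞ fun θ : ℝ => p (arg (Circle.exp θ))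
    rw [h]; exact hp⟩

theorem pull_ofPeriodic (p : ℝ → ℂ) (hp : ContDiff ℝ ∞ p)
    (hper : Function.Periodic p (2 * Real.pi)) : (ofPeriodic p hp hper).pull = p := by
  funext θ
  have h1 : (Circle.exp (arg (Circle.exp θ))) = Circle.exp θ := Circle.exp_arg _
  obtain ⟨n, hn⟩ := Circle.exp_eq_exp.1 h1
  change p (arg (Circle.exp θ)) = p θ
  rw [hn]
  exact (hper.int_mul n) θ

/-- The derivative `d/dθ` on `C^∞(S¹)`. -/
def ddθ (f : SmoothCircle) : SmoothCircle :=
  ofPeriodic (deriv f.pull) ((contDiff_infty_iff_deriv.1 f.contDiff_pull).2) (by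
    intro θ
    have h : (fun z => f.pull (z + 2 * Real.pi)) = f.pull := funext f.periodic_pull
    rw [← deriv_comp_add_const, h])

theorem pull_ddθ (f : SmoothCircle) : f.ddθ.pull = deriv f.pull := pull_ofPeriodic _ _ _

theorem hasDerivAt_pull (f : SmoothCircle) (θ : ℝ) : HasDerivAt f.pull (f.ddθ.pull θ) θ := by
  rw [pull_ddθ]
  exact ((f.contDiff_pull.differentiable (by simp)) θ).hasDerivAt

theorem iteratedDeriv_pull (f : SmoothCircle) (j : ℕ) :
    iteratedDeriv j f.pull = (ddθ^[j] f).pull := by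
  induction j generalizing f with
  | zero => simp
  | succ j ih => rw [iteratedDeriv_succ', ← pull_ddθ, ih, Function.iterate_succ_apply]

theorem supSeminorm_apply (j : ℕ) (f : SmoothCircle) :
    supSeminorm j f = ⨆ θ : ℝ, ‖(ddθ^[j] f).pull θ‖ := by
  rw [← iteratedDeriv_pull]; rfl

theorem norm_pull_le (j : ℕ) (f : SmoothCircle) (θ : ℝ) :
    ‖(ddθ^[j] f).pull θ‖ ≤ supSeminorm j f := by
  rw [← iteratedDeriv_pull]
  exact le_ciSup (f.bddAbove_deriv j) θ

theorem supSeminorm_le {j : ℕ} {f : SmoothCircle} {C : ℝ} (h : ∀ θ, ‖(ddθ^[j] f).pull θ‖ ≤ C) :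
    supSeminorm j f ≤ C := by
  rw [supSeminorm_apply]
  exact ciSup_le h

theorem cNorm_apply (N : ℕ) (f : SmoothCircle) :
    cNorm N f = ∑ j ∈ Finset.range (N + 1), supSeminorm j f := by
  have h : ∀ s : Finset ℕ, (∑ j ∈ s, supSeminorm j) f = ∑ j ∈ s, supSeminorm j f := by
    intro s
    induction s using Finset.induction_on with
    | empty => rfl
    | insert i s hi ih => rw [Finset.sum_insert hi, Finset.sum_insert hi, ← ih]; rfl
  exact h _

theorem supSeminorm_le_cNorm {j N : ℕ} (h : j ≤ N) (f : SmoothCircle) :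
    supSeminorm j f ≤ cNorm N f := by
  rw [cNorm_apply]
  exact Finset.single_le_sum (f := fun j => supSeminorm j f) (fun i _ => apply_nonneg _ _)
    (Finset.mem_range.2 (by omega))

theorem cNorm_mono {M N : ℕ} (h : M ≤ N) (f : SmoothCircle) : cNorm M f ≤ cNorm N f := by
  rw [cNorm_apply, cNorm_apply]
  exact Finset.sum_le_sum_of_subset_of_nonneg
    (Finset.range_subset_range.2 (by omega)) fun i _ _ => apply_nonneg _ _

theorem ddθ_sub (f g : SmoothCircle) : (f - g).ddθ = f.ddθ - g.ddθ := by
  apply pull_injective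
  funext θ
  exact ((f - g).hasDerivAt_pull θ).unique ((f.hasDerivAt_pull θ).sub (g.hasDerivAt_pull θ))

theorem iterate_ddθ_sub (f g : SmoothCircle) (j : ℕ) :
    ddθ^[j] (f - g) = ddθ^[j] f - ddθ^[j] g := by
  induction j generalizing f g with
  | zero => rfl
  | succ j ih => simp only [Function.iterate_succ_apply, ddθ_sub, ih]

/-- Neighbourhoods of zero contain balls of the `C^N` norms. -/
theorem exists_cNorm_ball_subset {s : Set SmoothCircle} (hs : s ∈ 𝓝 (0 : SmoothCircle)) :
    ∃ N : ℕ, ∃ δ > 0, ∀ f : SmoothCircle, cNorm N f < δ → f ∈ s := by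
  obtain ⟨V, ⟨hV, h⟩⟩ := (withSeminorms_cNorm.hasBasis_zero_ball).mem_iff.1 hs
  refine ⟨V.1.sup id, V.2, hV, fun f hf => h ?_⟩
  rw [Seminorm.mem_ball_zero]
  refine Seminorm.finset_sup_apply_lt hV fun i hi => ?_
  exact (cNorm_mono (Finset.le_sup (f := id) hi) f).trans_lt hf

end SmoothCircle

/-! ## The dilations -/

theorem isMobius_dilation (t : ℝ) :
    IsMobius (dilation t).1 (Real.cosh (t / 2) : ℂ) (-(Real.sinh (t / 2) : ℂ)) :=
  isMobius_mobPerm _ _ _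

theorem dilation_inv (t : ℝ) : (dilation t)⁻¹ = dilation (-t) := by
  apply Subtype.ext
  ext z
  refine ((isMobius_dilation t).inv.2 z).trans ?_
  refine Eq.trans ?_ (dilation_apply (-t) z).symm
  simp only [neg_div, Real.cosh_neg, Real.sinh_neg, conj_ofReal, ofReal_neg, neg_neg,
    sub_neg_eq_add]

/-- The inverse of the conformal factor of the inverse dilation. -/
def dilFactor (t θ : ℝ) : ℝ := Real.cosh t + Real.sinh t * Real.cos θ

/-- The worst case is `cos θ = ±1`, where the factor can be as small as `cosh |t| - sinh |t|`. This
makes negative powers of the factor exponentially bounded. -/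
theorem exp_neg_abs_le_dilFactor (t θ : ℝ) : Real.exp (-|t|) ≤ dilFactor t θ := by
  have h1 : |Real.sinh t * Real.cos θ| ≤ |Real.sinh t| := by
    rw [abs_mul]
    exact mul_le_of_le_one_right (abs_nonneg _) (Real.abs_cos_le_one θ)
  have h2 : |Real.sinh t| = Real.sinh |t| := Real.abs_sinh t
  have h3 := Real.cosh_sub_sinh |t|
  rw [Real.cosh_abs] at h3
  have := neg_abs_le (Real.sinh t * Real.cos θ)
  unfold dilFactor
  linarith

theorem dilFactor_pos (t θ : ℝ) : 0 < dilFactor t θ :=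
  (Real.exp_pos _).trans_le (exp_neg_abs_le_dilFactor t θ)

theorem normSq_dilation_den (t θ : ℝ) :
    normSq (Real.cosh (t / 2) + Real.sinh (t / 2) * (Circle.exp θ : ℂ)) = dilFactor t θ := by
  rw [Circle.coe_exp, exp_mul_I, normSq_apply]
  have e1 : ((Real.cosh (t / 2) : ℂ) + Real.sinh (t / 2) * (Complex.cos θ + Complex.sin θ * I)).re =
      Real.cosh (t / 2) + Real.sinh (t / 2) * Real.cos θ := by
    rw [← ofReal_cos, ← ofReal_sin]; simp [-ofReal_cosh, -ofReal_sinh, -ofReal_cos, -ofReal_sin]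
  have e2 : ((Real.cosh (t / 2) : ℂ) + Real.sinh (t / 2) * (Complex.cos θ + Complex.sin θ * I)).im =
      Real.sinh (t / 2) * Real.sin θ := by
    rw [← ofReal_cos, ← ofReal_sin]; simp [-ofReal_cosh, -ofReal_sinh, -ofReal_cos, -ofReal_sin]
  rw [e1, e2, dilFactor]
  have h1 : Real.cosh t = Real.cosh (t / 2) ^ 2 + Real.sinh (t / 2) ^ 2 := by
    rw [← Real.cosh_two_mul]; congr 1; ring
  have h2 : Real.sinh t = 2 * Real.sinh (t / 2) * Real.cosh (t / 2) := by
    rw [← Real.sinh_two_mul]; congr 1; ring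
  rw [h1, h2]
  linear_combination (Real.sinh (t / 2) ^ 2) * Real.sin_sq_add_cos_sq θ

theorem xFactor_dilation (t θ : ℝ) :
    xFactor (dilation t) (((dilation t)⁻¹ : Mob) (Circle.exp θ)) = (dilFactor t θ : ℂ) := by
  rw [xFactor_inv_eq (isMobius_dilation t), mul_conj, ← normSq_dilation_den]
  congr 2
  rw [map_neg, conj_ofReal]; ring

theorem beta_apply_exp (d : ℕ) (t : ℝ) (f : SmoothCircle) (θ : ℝ) :
    (beta d (dilation t) f).pull θ =
      (dilFactor t θ : ℂ) ^ ((d : ℤ) - 1) * f (dilation (-t) (Circle.exp θ)) := by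
  rw [← dilation_inv, ← xFactor_dilation]; rfl

theorem SmoothCircle.continuous (f : SmoothCircle) : Continuous (f : Circle → ℂ) := by
  have hq : IsQuotientMap Circle.exp :=
    Circle.isCoveringMap_exp.isQuotientMap Circle.exp_surjective
  exact hq.continuous_iff.2 f.contDiff_pull.continuous

theorem SmoothCircle.norm_apply_le (f : SmoothCircle) (z : Circle) :
    ‖f z‖ ≤ SmoothCircle.supSeminorm 0 f := by
  rw [f.apply_eq_pull]
  exact f.norm_pull_le 0 _

theorem dilation_den_ne_zero (t : ℝ) (z : Circle) :
    (-Real.sinh (t / 2) * z + Real.cosh (t / 2) : ℂ) ≠ 0 := by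
  have := den_ne_zero (isMobius_dilation t).1 z
  simpa [-ofReal_cosh, -ofReal_sinh] using this

theorem continuous_dilation : Continuous fun p : ℝ × Circle => dilation p.1 p.2 := by
  rw [(show IsInducing fun z : Circle => (z : ℂ) from ⟨rfl⟩).continuous_iff]
  have h : (fun z : Circle => (z : ℂ)) ∘ (fun p : ℝ × Circle => dilation p.1 p.2) = fun p =>
      (Real.cosh (p.1 / 2) * p.2 - Real.sinh (p.1 / 2)) /
      (-Real.sinh (p.1 / 2) * p.2 + Real.cosh (p.1 / 2) : ℂ) := by
    funext p
    exact dilation_apply p.1 p.2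
  rw [h]
  refine Continuous.div ?_ ?_ fun p => dilation_den_ne_zero p.1 p.2
  · have : Continuous ((↑) : Circle → ℂ) := continuous_subtype_val
    fun_prop
  · have : Continuous ((↑) : Circle → ℂ) := continuous_subtype_val
    fun_prop

/-- The chain rule for a smooth function on the circle along a curve in the circle. -/
theorem hasDerivAt_comp_circle (g : SmoothCircle) {w : ℝ → Circle} {θ x : ℝ}
    (hw : HasDerivAt (fun s => (w s : ℂ)) (x * I * w θ) θ) :
    HasDerivAt (fun s => g (w s)) (x * g.ddθ (w θ)) θ := by
  -- Near `θ` the quotient `w s / w θ` is close to 1, so the principal logarithm provides a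
  -- differentiable lift of the angle.
  have hlog : HasDerivAt (fun s => (Complex.log ((w s / w θ : Circle) : ℂ))) (x * I) θ := by
    have h1 : HasDerivAt (fun s => ((w s / w θ : Circle) : ℂ)) (x * I) θ := by
      have := hw.div_const (w θ : ℂ)
      rw [mul_div_assoc, div_self (Circle.coe_ne_zero _), mul_one] at this
      simpa only [Circle.coe_div] using this
    have h2 := h1.clog_real (by simp)
    simpa using h2
  have him : HasDerivAt (fun s => arg (w θ) + (Complex.log ((w s / w θ : Circle) : ℂ)).im) x θ := by
    have := (imCLM.hasFDerivAt.comp_hasDerivAt θ hlog).const_add (arg (w θ))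
    simpa using this
  have heq : (fun s => g (w s)) = fun s =>
      g.pull (arg (w θ) + (Complex.log ((w s / w θ : Circle) : ℂ)).im) := by
    funext s
    simp only [SmoothCircle.pull, Complex.log_im, Circle.exp_add, Circle.exp_arg]
    simp
  rw [heq]
  have h0 : arg (w θ) + (Complex.log ((w θ / w θ : Circle) : ℂ)).im = arg (w θ) := by simp
  have hg := g.hasDerivAt_pull (arg (w θ) + (Complex.log ((w θ / w θ : Circle) : ℂ)).im)
  have := hg.scomp θ him
  rw [h0, ← SmoothCircle.apply_eq_pull, real_smul] at this
  exact this

/-- The determinant `c² - s² = 1` gives the derivative of the fraction, and on the circle `c z + s =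
z · conj (s z + c)`; together they show that the angular speed is the inverse conformal factor. -/
theorem hasDerivAt_dilation (t θ : ℝ) :
    HasDerivAt (fun s : ℝ => (dilation (-t) (Circle.exp s) : ℂ))
      (((dilFactor t θ)⁻¹ : ℝ) * I * dilation (-t) (Circle.exp θ)) θ := by
  obtain ⟨c, hc⟩ : ∃ c : ℂ, c = (Real.cosh (t / 2) : ℂ) := ⟨_, rfl⟩
  obtain ⟨s, hs⟩ : ∃ s : ℂ, s = (Real.sinh (t / 2) : ℂ) := ⟨_, rfl⟩
  have hf : ∀ z : Circle, (dilation (-t) z : ℂ) = (c * z + s) / (s * z + c) := by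
    intro z
    rw [dilation_apply]
    simp only [neg_div, Real.cosh_neg, Real.sinh_neg, ofReal_neg, neg_neg, sub_neg_eq_add, hc, hs]
  have hden : ∀ z : Circle, s * (z : ℂ) + c ≠ 0 := by
    intro z
    have := dilation_den_ne_zero (-t) z
    simpa only [neg_div, Real.cosh_neg, Real.sinh_neg, ofReal_neg, neg_neg, hc, hs] using this
  have he : HasDerivAt (fun r : ℝ => (Circle.exp r : ℂ)) (Circle.exp θ * I) θ := by
    simp only [Circle.coe_exp]
    have := ((Complex.ofRealCLM.hasDerivAt (x := θ)).mul_const Complex.I).cexp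
    simpa using this
  have hD := ((he.const_mul c).add_const s).fun_div ((he.const_mul s).add_const c) (hden _)
  simp only [hf]
  refine HasDerivAt.congr_deriv hD ?_
  have hdet : c ^ 2 - s ^ 2 = 1 := by
    rw [hc, hs]; exact_mod_cast Real.cosh_sq_sub_sinh_sq (t / 2)
  have hn : (dilFactor t θ : ℂ) = (s * Circle.exp θ + c) * (s * conj (Circle.exp θ : ℂ) + c) := by
    rw [← normSq_dilation_den, ← mul_conj, map_add, map_mul, conj_ofReal, conj_ofReal, ← hc, ← hs]
    ring
  have hz := circle_mul_conj (Circle.exp θ)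
  set z : ℂ := (Circle.exp θ : ℂ) with hzdef
  have hd := hden (Circle.exp θ)
  have hd' : s * conj z + c ≠ 0 := by
    have h := (map_ne_zero (starRingEnd ℂ)).2 hd
    rw [map_add, map_mul, hc, hs, conj_ofReal, conj_ofReal, ← hc, ← hs] at h
    exact h
  have hnum : c * z + s = z * (s * conj z + c) := by linear_combination (-s) * hz
  have hN : c * (z * I) * (s * z + c) - (c * z + s) * (s * (z * I)) = z * I := by
    linear_combination (z * I) * hdet
  rw [hN, ofReal_inv, hn, hnum]
  field_simp

/-! ## Functions with exponentially bounded derivatives -/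

/-- `h (t, θ)` is jointly continuous and bounded by a multiple of an exponential of `|t|`. -/
def IsExpBounded (h : ℝ → ℝ → ℂ) : Prop :=
  Continuous (fun p : ℝ × ℝ => h p.1 p.2) ∧
    ∃ C, 0 ≤ C ∧ ∀ t θ, ‖h t θ‖ ≤ C * Real.exp (C * |t|)

/-- `h` and its first `j` derivatives in the second variable are jointly continuous and
exponentially bounded in the first variable. -/
def HasExpBound : ℕ → (ℝ → ℝ → ℂ) → Prop
  | 0, h => IsExpBounded h
  | j + 1, h => IsExpBounded h ∧
      ∃ h' : ℝ → ℝ → ℂ, (∀ t θ, HasDerivAt (h t) (h' t θ) θ) ∧ HasExpBound j h'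

namespace HasExpBound

theorem pred {j : ℕ} {h : ℝ → ℝ → ℂ} (H : HasExpBound (j + 1) h) : HasExpBound j h := by
  induction j generalizing h with
  | zero => exact H.1
  | succ j ih =>
    obtain ⟨h0, h', hd, h1⟩ := H
    exact ⟨h0, h', hd, ih h1⟩

theorem mul_exp_mono {C C' t : ℝ} (hC : 0 ≤ C) (h : C ≤ C') :
    C * Real.exp (C * |t|) ≤ C' * Real.exp (C' * |t|) :=
  mul_le_mul h (Real.exp_le_exp.2 (mul_le_mul_of_nonneg_right h (abs_nonneg _)))
    (Real.exp_pos _).le (hC.trans h)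

theorem add {j : ℕ} {h k : ℝ → ℝ → ℂ} (H : HasExpBound j h) (K : HasExpBound j k) :
    HasExpBound j fun t θ => h t θ + k t θ := by
  induction j generalizing h k with
  | zero =>
    obtain ⟨hc, C, hC, hb⟩ := H
    obtain ⟨kc, D, hD, kb⟩ := K
    refine ⟨hc.add kc, C + D, by positivity, fun t θ => (norm_add_le _ _).trans ?_⟩
    have e1 := mul_exp_mono (t := t) hC (le_add_of_nonneg_right hD)
    rw [add_mul]
    refine add_le_add ((hb t θ).trans ?_) ((kb t θ).trans ?_)
    · exact mul_le_mul_of_nonneg_left (Real.exp_le_exp.2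
        (mul_le_mul_of_nonneg_right (by linarith) (abs_nonneg _))) hC
    · exact mul_le_mul_of_nonneg_left (Real.exp_le_exp.2
        (mul_le_mul_of_nonneg_right (by linarith) (abs_nonneg _))) hD
  | succ j ih =>
    obtain ⟨h0, h', hd, h1⟩ := H
    obtain ⟨k0, k', kd, k1⟩ := K
    refine ⟨?_, fun t θ => h' t θ + k' t θ, fun t θ => (hd t θ).add (kd t θ), ih h1 k1⟩
    obtain ⟨hc, C, hC, hb⟩ := h0
    obtain ⟨kc, D, hD, kb⟩ := k0
    refine ⟨hc.add kc, C + D, by positivity, fun t θ => (norm_add_le _ _).trans ?_⟩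
    rw [add_mul]
    refine add_le_add ((hb t θ).trans ?_) ((kb t θ).trans ?_)
    · exact mul_le_mul_of_nonneg_left (Real.exp_le_exp.2
        (mul_le_mul_of_nonneg_right (by linarith) (abs_nonneg _))) hC
    · exact mul_le_mul_of_nonneg_left (Real.exp_le_exp.2
        (mul_le_mul_of_nonneg_right (by linarith) (abs_nonneg _))) hD

theorem mul_zeroth {h k : ℝ → ℝ → ℂ} (H : HasExpBound 0 h) (K : HasExpBound 0 k) :
    HasExpBound 0 fun t θ => h t θ * k t θ := by
  obtain ⟨hc, C, hC, hb⟩ := H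
  obtain ⟨kc, D, hD, kb⟩ := K
  refine ⟨hc.mul kc, C * D + (C + D), by positivity, fun t θ => ?_⟩
  rw [norm_mul]
  refine (mul_le_mul (hb t θ) (kb t θ) (norm_nonneg _) (by positivity)).trans ?_
  have : C * Real.exp (C * |t|) * (D * Real.exp (D * |t|)) =
      (C * D) * Real.exp ((C + D) * |t|) := by rw [add_mul, Real.exp_add]; ring
  rw [this]
  have hCD := mul_nonneg hC hD
  refine mul_le_mul (by linarith) (Real.exp_le_exp.2 ?_) (Real.exp_pos _).le (by positivity)
  exact mul_le_mul_of_nonneg_right (by linarith) (abs_nonneg _)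

theorem mul {j : ℕ} {h k : ℝ → ℝ → ℂ} (H : HasExpBound j h) (K : HasExpBound j k) :
    HasExpBound j fun t θ => h t θ * k t θ := by
  induction j generalizing h k with
  | zero => exact mul_zeroth H K
  | succ j ih =>
    obtain ⟨h0, h', hd, h1⟩ := id H
    obtain ⟨k0, k', kd, k1⟩ := id K
    exact ⟨mul_zeroth h0 k0, fun t θ => h' t θ * k t θ + h t θ * k' t θ,
      fun t θ => (hd t θ).mul (kd t θ), (ih h1 K.pred).add (ih H.pred k1)⟩

theorem const (c : ℂ) (j : ℕ) : HasExpBound j fun _ _ => c := by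
  have h0 : ∀ c : ℂ, HasExpBound 0 fun _ _ => c := fun c =>
    ⟨continuous_const, ‖c‖, norm_nonneg _, fun t θ =>
      le_mul_of_one_le_right (norm_nonneg _) (Real.one_le_exp (by positivity))⟩
  induction j generalizing c with
  | zero => exact h0 c
  | succ j ih => exact ⟨h0 c, fun _ _ => 0, fun t θ => hasDerivAt_const _ _, ih 0⟩

theorem cos_sin (j : ℕ) : HasExpBound j (fun _ θ => (Real.cos θ : ℂ)) ∧
    HasExpBound j (fun _ θ => (Real.sin θ : ℂ)) := by
  have h0 : HasExpBound 0 (fun _ θ => (Real.cos θ : ℂ)) := by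
    refine ⟨by fun_prop, 1, zero_le_one, fun t θ => ?_⟩
    rw [norm_real, one_mul, one_mul]
    exact (Real.abs_cos_le_one θ).trans (Real.one_le_exp (abs_nonneg t))
  have h1 : HasExpBound 0 (fun _ θ => (Real.sin θ : ℂ)) := by
    refine ⟨by fun_prop, 1, zero_le_one, fun t θ => ?_⟩
    rw [norm_real, one_mul, one_mul]
    exact (Real.abs_sin_le_one θ).trans (Real.one_le_exp (abs_nonneg t))
  induction j with
  | zero => exact ⟨h0, h1⟩
  | succ j ih =>
    refine ⟨⟨h0, fun _ θ => (-1) * (Real.sin θ : ℂ), fun t θ => ?_, (const (-1) j).mul ih.2⟩,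
      ⟨h1, fun _ θ => (Real.cos θ : ℂ), fun t θ => (Real.hasDerivAt_sin θ).ofReal_comp, ih.1⟩⟩
    have := (Real.hasDerivAt_cos θ).ofReal_comp
    simpa using this

theorem of_fun_time {p : ℝ → ℝ} (hp : Continuous p) (hb : ∀ t, |p t| ≤ Real.exp |t|) (j : ℕ) :
    HasExpBound j (fun t _ => (p t : ℂ)) := by
  have h0 : HasExpBound 0 (fun t _ => (p t : ℂ)) := by
    refine ⟨by fun_prop, 1, zero_le_one, fun t θ => ?_⟩
    rw [norm_real, one_mul, one_mul]
    exact hb t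
  cases j with
  | zero => exact h0
  | succ j => exact ⟨h0, fun _ _ => 0, fun t θ => hasDerivAt_const _ _, const 0 j⟩

theorem abs_sinh_le (t : ℝ) : |Real.sinh t| ≤ Real.exp |t| := by
  rw [Real.abs_sinh]
  have := Real.cosh_add_sinh |t|
  have := Real.cosh_pos |t|
  linarith

theorem abs_cosh_le (t : ℝ) : |Real.cosh t| ≤ Real.exp |t| := by
  rw [abs_of_pos (Real.cosh_pos t), ← Real.cosh_abs]
  have := Real.cosh_add_sinh |t|
  have := Real.sinh_nonneg_iff.2 (abs_nonneg t)
  linarith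

theorem dilFactor (j : ℕ) : HasExpBound j fun t θ => (dilFactor t θ : ℂ) := by
  have := (of_fun_time Real.continuous_cosh abs_cosh_le j).add
    ((of_fun_time Real.continuous_sinh abs_sinh_le j).mul (cos_sin j).1)
  simpa only [WightmanCFT.dilFactor, ofReal_add, ofReal_mul] using this

theorem hasDerivAt_dilFactor (t θ : ℝ) :
    HasDerivAt (fun θ => WightmanCFT.dilFactor t θ) (-(Real.sinh t * Real.sin θ)) θ := by
  have := ((Real.hasDerivAt_cos θ).const_mul (Real.sinh t)).const_add (Real.cosh t)
  simpa [WightmanCFT.dilFactor] using this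

theorem dilFactor_inv (j : ℕ) : HasExpBound j fun t θ => ((WightmanCFT.dilFactor t θ)⁻¹ : ℂ) := by
  have h0 : HasExpBound 0 fun t θ => ((WightmanCFT.dilFactor t θ)⁻¹ : ℂ) := by
    refine ⟨(dilFactor 0).1.inv₀ fun p => ofReal_ne_zero.2 (dilFactor_pos _ _).ne', 1, zero_le_one,
      fun t θ => ?_⟩
    rw [norm_inv, norm_real, Real.norm_of_nonneg (dilFactor_pos _ _).le, one_mul, one_mul]
    refine inv_le_of_inv_le₀ (Real.exp_pos _) ?_
    rw [← Real.exp_neg]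
    exact exp_neg_abs_le_dilFactor t θ
  induction j with
  | zero => exact h0
  | succ j ih =>
    refine ⟨h0, fun t θ => (Real.sinh t : ℂ) * (Real.sin θ : ℂ) *
      ((WightmanCFT.dilFactor t θ : ℂ)⁻¹ * (WightmanCFT.dilFactor t θ : ℂ)⁻¹), fun t θ => ?_,
      ((of_fun_time Real.continuous_sinh abs_sinh_le j).mul (cos_sin j).2).mul (ih.mul ih)⟩
    have h1 := ((hasDerivAt_dilFactor t θ).inv (dilFactor_pos t θ).ne').ofReal_comp
    have h2 : ((-(-(Real.sinh t * Real.sin θ)) / WightmanCFT.dilFactor t θ ^ 2 : ℝ) : ℂ) =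
        (Real.sinh t : ℂ) * (Real.sin θ : ℂ) *
      ((WightmanCFT.dilFactor t θ : ℂ)⁻¹ * (WightmanCFT.dilFactor t θ : ℂ)⁻¹) := by
      rw [neg_neg, div_eq_mul_inv, pow_two, mul_inv]
      push_cast; ring
    rw [h2] at h1
    simpa using h1

/-- By the chain rule a derivative costs one inverse conformal factor and replaces `g` by `g.ddθ`,
so the induction runs over all `g` at once. -/
theorem comp_dilation (g : SmoothCircle) (j : ℕ) :
    HasExpBound j fun t θ => g (dilation (-t) (Circle.exp θ)) := by
  have h0 : ∀ g : SmoothCircle, HasExpBound 0 fun t θ => g (dilation (-t) (Circle.exp θ)) := by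
    intro g
    have hq : Continuous fun p : ℝ × ℝ => ((-p.1, Circle.exp p.2) : ℝ × Circle) := by fun_prop
    have hc := continuous_dilation.comp hq
    simp only [Function.comp_def] at hc
    have hp : 0 ≤ SmoothCircle.supSeminorm 0 g := apply_nonneg _ _
    have hg : Continuous fun p : ℝ × ℝ => g (dilation (-p.1) (Circle.exp p.2)) :=
      Continuous.comp (g := (g : Circle → ℂ)) g.continuous hc
    refine ⟨hg, SmoothCircle.supSeminorm 0 g, hp, fun t θ => ?_⟩
    exact (g.norm_apply_le _).trans
      (le_mul_of_one_le_right hp (Real.one_le_exp (mul_nonneg hp (abs_nonneg t))))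
  induction j generalizing g with
  | zero => exact h0 g
  | succ j ih =>
    refine ⟨h0 g, fun t θ => ((WightmanCFT.dilFactor t θ)⁻¹ : ℂ) *
      g.ddθ (dilation (-t) (Circle.exp θ)), fun t θ => ?_, (dilFactor_inv j).mul (ih g.ddθ)⟩
    have := hasDerivAt_comp_circle g (hasDerivAt_dilation t θ)
    simpa using this

theorem pow {j : ℕ} {h : ℝ → ℝ → ℂ} (H : HasExpBound j h) (n : ℕ) :
    HasExpBound j fun t θ => h t θ ^ n := by
  induction n with
  | zero => simpa using const 1 j
  | succ n ih => simpa only [pow_succ] using ih.mul H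

theorem pull_beta (d : ℕ) (f : SmoothCircle) (j : ℕ) :
    HasExpBound j fun t θ => (beta d (dilation t) f).pull θ := by
  simp only [beta_apply_exp]
  refine HasExpBound.mul ?_ (comp_dilation f j)
  -- The exponent `d - 1` is negative only for `d = 0`, where it is `-1`.
  cases d with
  | zero => simpa using dilFactor_inv j
  | succ n => simpa using (dilFactor j).pow n

/-- The derivatives of a family of smooth functions on the circle. -/
theorem iterate_ddθ {c : ℝ → SmoothCircle} {j : ℕ} (H : HasExpBound j fun t θ => (c t).pull θ) :
    HasExpBound 0 fun t θ => (SmoothCircle.ddθ^[j] (c t)).pull θ := by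
  induction j generalizing c with
  | zero => exact H
  | succ j ih =>
    obtain ⟨-, h', hd, h1⟩ := H
    have he : h' = fun t θ => ((c t).ddθ).pull θ := by
      funext t θ
      exact (hd t θ).unique ((c t).hasDerivAt_pull θ)
    rw [he] at h1
    exact ih h1

end HasExpBound

/-! ## Tame families of test functions -/

/-- A family of smooth functions on the circle that depends continuously on the parameter and is
exponentially bounded in every `C^N` norm. -/
def IsTame (c : ℝ → SmoothCircle) : Prop :=
  Continuous c ∧ ∀ N : ℕ, ∃ C, 0 ≤ C ∧ ∀ t, SmoothCircle.cNorm N (c t) ≤ C * Real.exp (C * |t|)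

/-- Currying turns joint continuity into uniform convergence on the compact period `[0, 2π]`, and
periodicity extends it to all angles. -/
theorem tendsto_supSeminorm {c : ℝ → SmoothCircle} {j : ℕ}
    (h : Continuous fun p : ℝ × ℝ => (SmoothCircle.ddθ^[j] (c p.1)).pull p.2) (t₀ : ℝ) :
    Tendsto (fun t => SmoothCircle.supSeminorm j (c t - c t₀)) (𝓝 t₀) (𝓝 0) := by
  set F : C(ℝ × ℝ, ℂ) := ⟨fun p => (SmoothCircle.ddθ^[j] (c p.1)).pull p.2, h⟩ with hF
  have hcont := F.curry.continuous.tendsto t₀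
  rw [ContinuousMap.tendsto_iff_forall_isCompact_tendstoUniformlyOn] at hcont
  have hK := hcont (Icc 0 (2 * Real.pi)) isCompact_Icc
  rw [Metric.tendstoUniformlyOn_iff] at hK
  rw [Metric.tendsto_nhds]
  intro ε hε
  filter_upwards [hK (ε / 2) (half_pos hε)] with t ht
  rw [Real.dist_eq, sub_zero, abs_of_nonneg (apply_nonneg _ _)]
  refine lt_of_le_of_lt (SmoothCircle.supSeminorm_le fun θ => ?_) (half_lt_self hε)
  obtain ⟨y, hy, hxy⟩ :=
    (SmoothCircle.ddθ^[j] (c t - c t₀)).periodic_pull.exists_mem_Ico₀ Real.two_pi_pos θ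
  rw [hxy, SmoothCircle.iterate_ddθ_sub, SmoothCircle.pull_sub, Pi.sub_apply]
  have := ht y ⟨hy.1, hy.2.le⟩
  rw [dist_comm, dist_eq_norm] at this
  exact this.le

theorem isTame_of_hasExpBound {c : ℝ → SmoothCircle}
    (h : ∀ j, HasExpBound j fun t θ => (c t).pull θ) : IsTame c := by
  have h' := fun j => (h j).iterate_ddθ
  constructor
  · rw [continuous_iff_continuousAt]
    intro t₀
    refine (SmoothCircle.withSeminorms_cNorm.tendsto_nhds c (c t₀)).2 fun N ε hε => ?_
    have hsum : Tendsto (fun t => SmoothCircle.cNorm N (c t - c t₀)) (𝓝 t₀) (𝓝 0) := by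
      simp only [SmoothCircle.cNorm_apply]
      have := tendsto_finsetSum (Finset.range (N + 1))
        fun j _ => tendsto_supSeminorm (show IsExpBounded _ from h' j).1 t₀
      simpa using this
    exact hsum.eventually (gt_mem_nhds hε)
  · intro N
    choose C hC hb using fun j => (show IsExpBounded _ from h' j).2
    refine ⟨∑ j ∈ Finset.range (N + 1), C j, Finset.sum_nonneg fun j _ => hC j, fun t => ?_⟩
    rw [SmoothCircle.cNorm_apply, Finset.sum_mul]
    refine Finset.sum_le_sum fun j hj => SmoothCircle.supSeminorm_le fun θ => (hb j t θ).trans ?_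
    refine mul_le_mul_of_nonneg_left (Real.exp_le_exp.2
      (mul_le_mul_of_nonneg_right ?_ (abs_nonneg _))) (hC j)
    exact Finset.single_le_sum (f := C) (fun i _ => hC i) hj

theorem isTame_beta (d : ℕ) (f : SmoothCircle) : IsTame fun t => beta d (dilation t) f :=
  isTame_of_hasExpBound (HasExpBound.pull_beta d f)

/-! ## Products of smeared fields -/

section Smear

variable {D : Type*} [AddCommGroup D] [Module ℂ D]

theorem smear_zero (φ : Fin 0 → SmoothCircle →ₗ[ℂ] Module.End ℂ D) (f : Fin 0 → SmoothCircle) :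
    smear φ f = 1 := by
  simp [smear]

theorem smear_succ {k : ℕ} (φ : Fin (k + 1) → SmoothCircle →ₗ[ℂ] Module.End ℂ D)
    (f : Fin (k + 1) → SmoothCircle) :
    smear φ f = φ 0 (f 0) * smear (fun j => φ j.succ) fun j => f j.succ := by
  simp [smear, List.ofFn_succ]

theorem smear_rev_succ {k : ℕ} (φ : Fin (k + 1) → SmoothCircle →ₗ[ℂ] Module.End ℂ D)
    (f : Fin (k + 1) → SmoothCircle) :
    smear (fun j => φ j.rev) (fun j => f j.rev) =
      smear (fun j : Fin k => φ j.rev.succ) (fun j => f j.rev.succ) * φ 0 (f 0) := by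
  rw [smear, List.ofFn_succ', List.concat_eq_append, List.prod_append, List.prod_singleton, smear]
  simp [Fin.rev_castSucc]

theorem smear_smul {k : ℕ} (φ : Fin k → SmoothCircle →ₗ[ℂ] Module.End ℂ D)
    (c : Fin k → ℂ) (f : Fin k → SmoothCircle) :
    smear φ (fun j => c j • f j) = (∏ j, c j) • smear φ f := by
  induction k with
  | zero => simp [smear_zero]
  | succ k ih =>
    rw [smear_succ, smear_succ φ f, ih (fun j => φ j.succ) (fun j => c j.succ), map_smul,
      smul_mul_smul_comm, Fin.prod_univ_succ]

/-- The multilinear analogue of boundedness of a continuous functional: each argument is rescaled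
into a ball on which the functional is bounded. The added 1 keeps the scaling factor finite when a
norm vanishes. -/
theorem exists_norm_smear_le {F : Set (SmoothCircle →ₗ[ℂ] Module.End ℂ D)} {lam : D →ₗ[ℂ] ℂ}
    (hlam : lam ∈ compatibleDual F) {k : ℕ} {φ : Fin k → SmoothCircle →ₗ[ℂ] Module.End ℂ D}
    (hφ : ∀ j, φ j ∈ F) (Φ : D) :
    ∃ (N : ℕ) (C : ℝ), 0 ≤ C ∧ ∀ f : Fin k → SmoothCircle,
      ‖lam (smear φ f Φ)‖ ≤ C * ∏ j, (SmoothCircle.cNorm N (f j) + 1) := by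
  have hc := hlam k φ hφ Φ
  set B : ℝ := ‖lam (smear φ 0 Φ)‖ + 1 with hB
  have hnhds : {f : Fin k → SmoothCircle | ‖lam (smear φ f Φ)‖ < B} ∈ 𝓝 0 :=
    (isOpen_lt hc.norm continuous_const).mem_nhds (by simp [hB])
  rw [nhds_pi, Filter.mem_pi'] at hnhds
  obtain ⟨I, s, hs, hsub⟩ := hnhds
  obtain ⟨N, δ, hδ, hball⟩ := SmoothCircle.exists_cNorm_ball_subset
    (s := ⋂ j, s j) (Filter.iInter_mem.2 hs)
  refine ⟨N, B * (δ⁻¹) ^ k, by positivity, fun f => ?_⟩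
  set p : Fin k → ℝ := fun j => SmoothCircle.cNorm N (f j) + 1 with hp
  have hp0 : ∀ j, 0 < p j := fun j => by
    have : 0 ≤ SmoothCircle.cNorm N (f j) := apply_nonneg _ _
    simp only [hp]; linarith
  set c : Fin k → ℂ := fun j => ((δ / p j : ℝ) : ℂ) with hcdef
  have hin : ‖lam (smear φ (fun j => c j • f j) Φ)‖ < B := by
    refine hsub fun j _ => ?_
    have : c j • f j ∈ ⋂ j, s j := by
      refine hball _ ?_
      rw [map_smul_eq_mul, hcdef, norm_real, Real.norm_of_nonneg (by have := hp0 j; positivity),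
        div_mul_eq_mul_div, div_lt_iff₀ (hp0 j)]
      simp only [hp]
      nlinarith
    exact mem_iInter.1 this j
  rw [smear_smul, LinearMap.smul_apply, map_smul, norm_smul, norm_prod] at hin
  have hcn : ∏ j, ‖c j‖ = δ ^ k * (∏ j, p j)⁻¹ := by
    have : ∀ j, ‖c j‖ = δ * (p j)⁻¹ := fun j => by
      rw [hcdef, norm_real, Real.norm_of_nonneg (by have := hp0 j; positivity), div_eq_mul_inv]
    simp only [this, Finset.prod_mul_distrib, Finset.prod_const, Finset.card_univ,
      Fintype.card_fin, Finset.prod_inv_distrib]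
  have hP : 0 < ∏ j, p j := Finset.prod_pos fun j _ => hp0 j
  rw [hcn, mul_assoc, ← lt_div_iff₀' (by positivity), inv_mul_lt_iff₀ hP] at hin
  refine hin.le.trans_eq ?_
  rw [inv_pow]
  field_simp

/-- Freezing the leftmost test function preserves joint continuity in the others. Hence a leading
field can be absorbed into the functional, which is how the induction on the number of fields
proceeds. -/
theorem comp_mem_compatibleDual {F : Set (SmoothCircle →ₗ[ℂ] Module.End ℂ D)} {lam : D →ₗ[ℂ] ℂ}
    (hlam : lam ∈ compatibleDual F) {φ : SmoothCircle →ₗ[ℂ] Module.End ℂ D} (hφ : φ ∈ F)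
    (g : SmoothCircle) : lam ∘ₗ φ g ∈ compatibleDual F := by
  intro k ψ hψ Φ
  have h := hlam (k + 1) (Fin.cons φ ψ) (fun j => by
    refine Fin.cases ?_ (fun i => ?_) j
    · simpa using hφ
    · simpa using hψ i) Φ
  have h2 := h.comp (f := fun f : Fin k → SmoothCircle => (Fin.cons g f : Fin (k + 1) → SmoothCircle))
    (by
      refine continuous_pi fun j => ?_
      refine Fin.cases ?_ (fun i => ?_) j
      · simpa using continuous_const
      · simpa using continuous_apply i)
  simpa [Function.comp_def, smear_succ] using h2

theorem comp_smear_mem_compatibleDual {F : Set (SmoothCircle →ₗ[ℂ] Module.End ℂ D)}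
    {lam : D →ₗ[ℂ] ℂ} (hlam : lam ∈ compatibleDual F) {k : ℕ}
    {φ : Fin k → SmoothCircle →ₗ[ℂ] Module.End ℂ D} (hφ : ∀ j, φ j ∈ F)
    (f : Fin k → SmoothCircle) : lam ∘ₗ smear φ f ∈ compatibleDual F := by
  induction k generalizing lam with
  | zero => simpa [smear_zero, Module.End.one_eq_id] using hlam
  | succ k ih =>
    rw [smear_succ, Module.End.mul_eq_comp, ← LinearMap.comp_assoc]
    exact ih (comp_mem_compatibleDual hlam (hφ 0) _) (fun j => hφ j.succ) _

/-- `h (s, t)` is continuous and exponentially bounded. -/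
def IsExpBounded₂ (h : ℝ → ℝ → ℂ) : Prop :=
  Continuous (fun p : ℝ × ℝ => h p.1 p.2) ∧
    ∃ C, 0 ≤ C ∧ ∀ s t, ‖h s t‖ ≤ C * Real.exp (C * (|s| + |t|))

/-- The functions `p j` select which of the two parameters drives the `j`-th field, so that one
statement serves every placement of the distinguished field. -/
theorem isExpBounded₂_smear {F : Set (SmoothCircle →ₗ[ℂ] Module.End ℂ D)} {lam : D →ₗ[ℂ] ℂ}
    (hlam : lam ∈ compatibleDual F) {k : ℕ} {φ : Fin k → SmoothCircle →ₗ[ℂ] Module.End ℂ D}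
    (hφ : ∀ j, φ j ∈ F) (Φ : D) {c : Fin k → ℝ → SmoothCircle} (hc : ∀ j, IsTame (c j))
    {p : Fin k → ℝ → ℝ → ℝ} (hp : ∀ j, Continuous fun q : ℝ × ℝ => p j q.1 q.2)
    (hpb : ∀ j s t, |p j s t| ≤ |s| + |t|) :
    IsExpBounded₂ fun s t => lam (smear φ (fun j => c j (p j s t)) Φ) := by
  constructor
  · have h1 : Continuous fun q : ℝ × ℝ => fun j => c j (p j q.1 q.2) :=
      continuous_pi fun j => (hc j).1.comp (hp j)
    exact (hlam k φ hφ Φ).comp h1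
  · obtain ⟨N, C, hC, hb⟩ := exists_norm_smear_le hlam hφ Φ
    choose A hA hAb using fun j => (hc j).2 N
    set E := C * ∏ j, (A j + 1) with hE
    set S := ∑ j, A j with hS
    have hE0 : 0 ≤ E := mul_nonneg hC (Finset.prod_nonneg fun j _ => by linarith [hA j])
    have hS0 : 0 ≤ S := Finset.sum_nonneg fun j _ => hA j
    refine ⟨E + S, by positivity, fun s t => (hb _).trans ?_⟩
    have hfac : ∀ j, SmoothCircle.cNorm N (c j (p j s t)) + 1 ≤
        (A j + 1) * Real.exp (A j * (|s| + |t|)) := by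
      intro j
      have h1 := hAb j (p j s t)
      have h2 : Real.exp (A j * |p j s t|) ≤ Real.exp (A j * (|s| + |t|)) :=
        Real.exp_le_exp.2 (mul_le_mul_of_nonneg_left (hpb j s t) (hA j))
      have h3 : 1 ≤ Real.exp (A j * (|s| + |t|)) :=
        Real.one_le_exp (mul_nonneg (hA j) (by positivity))
      have h4 := mul_le_mul_of_nonneg_left h2 (hA j)
      linarith
    have hprod : ∏ j, (SmoothCircle.cNorm N (c j (p j s t)) + 1) ≤
        (∏ j, (A j + 1)) * Real.exp (S * (|s| + |t|)) := by
      rw [hS, Finset.sum_mul, Real.exp_sum, ← Finset.prod_mul_distrib]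
      refine Finset.prod_le_prod (fun j _ => ?_) fun j _ => hfac j
      have : 0 ≤ SmoothCircle.cNorm N (c j (p j s t)) := apply_nonneg _ _
      linarith
    refine (mul_le_mul_of_nonneg_left hprod hC).trans ?_
    rw [← mul_assoc]
    refine mul_le_mul (by linarith) (Real.exp_le_exp.2 ?_) (Real.exp_pos _).le (by positivity)
    exact mul_le_mul_of_nonneg_right (by linarith) (by positivity)

end Smear

/-! ## Gaussian damping -/

/-- The Gaussian `exp (-a (t + i η)²)`. -/
def damp (a η t : ℝ) : ℂ := cexp (-a * ((t : ℂ) + η * I) ^ 2)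

theorem norm_damp (a η t : ℝ) : ‖damp a η t‖ = Real.exp (a * η ^ 2) * Real.exp (-a * t ^ 2) := by
  rw [damp, norm_exp, ← Real.exp_add]
  congr 1
  rw [neg_mul, neg_re, re_ofReal_mul]
  simp [pow_two]; ring

theorem isStripBoundary_damp {a : ℝ} (ha : 0 < a) :
    IsStripBoundary (damp a 0) (damp a Real.pi) := by
  have := IsStripBoundary.gaussian ha
  unfold damp
  simpa using this

theorem damp_add (a b η t : ℝ) : damp (a + b) η t = damp a η t * damp b η t := by
  rw [damp, damp, damp, ← exp_add]
  congr 1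
  push_cast; ring

/-- Completing the square: half of the Gaussian absorbs the exponential, and the other half remains
as decay. -/
theorem exp_mul_damp_le {a C : ℝ} (ha : 0 < a) (t : ℝ) :
    Real.exp (C * |t|) * Real.exp (-a * t ^ 2) ≤
      Real.exp (C ^ 2 / (2 * a)) * Real.exp (-(a / 2) * t ^ 2) := by
  rw [← Real.exp_add, ← Real.exp_add, Real.exp_le_exp]
  have h : 0 ≤ (a * |t| - C) ^ 2 / (2 * a) := by positivity
  have h2 : (a * |t| - C) ^ 2 / (2 * a) = a / 2 * t ^ 2 - C * |t| + C ^ 2 / (2 * a) := by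
    rw [sub_sq, mul_pow, sq_abs]; field_simp
  linarith

theorem IsExpBounded₂.exists_norm_mul_damp_le {h : ℝ → ℝ → ℂ} (H : IsExpBounded₂ h) {a : ℝ}
    (ha : 0 < a) (η ζ : ℝ) :
    ∃ M, 0 ≤ M ∧ ∀ s t, ‖h s t * (damp a η s * damp a ζ t)‖ ≤
      M * Real.exp (-(a / 2) * (s ^ 2 + t ^ 2)) := by
  obtain ⟨-, C, hC, hb⟩ := H
  set E := Real.exp (C ^ 2 / (2 * a)) with hE
  refine ⟨C * (Real.exp (a * η ^ 2) * Real.exp (a * ζ ^ 2)) * (E * E), by positivity, fun s t => ?_⟩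
  rw [norm_mul, norm_mul, norm_damp, norm_damp]
  refine (mul_le_mul_of_nonneg_right (hb s t) (by positivity)).trans ?_
  have h1 := mul_le_mul (exp_mul_damp_le (C := C) ha s) (exp_mul_damp_le (C := C) ha t)
    (by positivity) (by positivity)
  have h2 := mul_le_mul_of_nonneg_left h1
    (show 0 ≤ C * (Real.exp (a * η ^ 2) * Real.exp (a * ζ ^ 2)) by positivity)
  rw [mul_add C, Real.exp_add, mul_add (-(a / 2)), Real.exp_add]
  calc _ = _ := by ring
    _ ≤ _ := h2
    _ = _ := by ring

theorem continuous_damp (a η : ℝ) : Continuous (damp a η) := by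
  unfold damp; fun_prop

/-- Damping in both variables makes the function vanish at infinity, and a continuous function with
a limit at infinity is uniformly continuous. -/
theorem IsExpBounded₂.uniformContinuous_mul_damp {h : ℝ → ℝ → ℂ} (H : IsExpBounded₂ h) {a : ℝ}
    (ha : 0 < a) (η ζ : ℝ) :
    UniformContinuous fun p : ℝ × ℝ => h p.1 p.2 * (damp a η p.1 * damp a ζ p.2) := by
  obtain ⟨M, hM, hb⟩ := H.exists_norm_mul_damp_le ha η ζ
  refine Continuous.uniformContinuous_of_tendsto_cocompact (x := 0) ?_ ?_
  · exact H.1.mul (((continuous_damp a η).comp continuous_fst).mul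
      ((continuous_damp a ζ).comp continuous_snd))
  · have hlim : Tendsto (fun p : ℝ × ℝ => M * Real.exp (-(a / 2) * ‖p‖ ^ 2)) (cocompact _) (𝓝 0) := by
      have h1 : Tendsto (fun p : ℝ × ℝ => ‖p‖ ^ 2) (cocompact _) atTop :=
        (tendsto_pow_atTop two_ne_zero).comp (tendsto_norm_cocompact_atTop (E := ℝ × ℝ))
      have h2 := (Real.tendsto_exp_atBot.comp
        (h1.const_mul_atTop_of_neg (show -(a / 2) < 0 by linarith))).const_mul M
      simpa [Function.comp_def] using h2
    refine squeeze_zero_norm (fun p => (hb p.1 p.2).trans ?_) hlim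
    refine mul_le_mul_of_nonneg_left (Real.exp_le_exp.2 ?_) hM
    rw [neg_mul, neg_mul, neg_le_neg_iff]
    refine mul_le_mul_of_nonneg_left ?_ (by positivity)
    rw [Prod.norm_def, Real.norm_eq_abs, Real.norm_eq_abs]
    rcases max_choice |p.1| |p.2| with h | h <;> rw [h, sq_abs] <;>
      nlinarith [sq_nonneg p.1, sq_nonneg p.2]

theorem IsExpBounded₂.exists_bound_mul_damp {h : ℝ → ℝ → ℂ} (H : IsExpBounded₂ h) {a : ℝ}
    (ha : 0 < a) (η ζ : ℝ) : ∃ M, ∀ s t, ‖h s t * (damp a η s * damp a ζ t)‖ ≤ M := by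
  obtain ⟨M, hM, hb⟩ := H.exists_norm_mul_damp_le ha η ζ
  refine ⟨M, fun s t => (hb s t).trans (mul_le_of_le_one_right hM (Real.exp_le_one_iff.2 ?_))⟩
  nlinarith [sq_nonneg s, sq_nonneg t, mul_nonneg ha.le (add_nonneg (sq_nonneg s) (sq_nonneg t))]

/-- The diagonal principle for exponentially bounded functions. -/
theorem isStripBoundary_diagonal_damp {H K H' : ℝ → ℝ → ℂ} (hH : IsExpBounded₂ H)
    (hK : IsExpBounded₂ K) (hH' : IsExpBounded₂ H') {a : ℝ} (ha : 0 < a)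
    (h₂ : ∀ s, IsStripBoundary (fun t => H s t * damp a 0 t) (fun t => K s t * damp a Real.pi t))
    (h₁ : ∀ t, IsStripBoundary (fun s => K s t * damp a 0 s) (fun s => H' s t * damp a Real.pi s)) :
    IsStripBoundary (fun t => H t t * damp (a + a) 0 t)
      (fun t => H' t t * damp (a + a) Real.pi t) := by
  obtain ⟨M₁, hM₁⟩ := hH.exists_bound_mul_damp ha 0 0
  obtain ⟨M₂, hM₂⟩ := hK.exists_bound_mul_damp ha 0 Real.pi
  obtain ⟨M₃, hM₃⟩ := hH'.exists_bound_mul_damp ha Real.pi Real.pi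
  have key := IsStripBoundary.diagonal (M := max M₁ (max M₂ M₃))
    (hH.uniformContinuous_mul_damp ha 0 0)
    (hK.uniformContinuous_mul_damp ha 0 Real.pi).continuous
    (hH'.uniformContinuous_mul_damp ha Real.pi Real.pi)
    (fun s t => (hM₁ s t).trans (le_max_left _ _))
    (fun s t => (hM₂ s t).trans ((le_max_left _ _).trans (le_max_right _ _)))
    (fun s t => (hM₃ s t).trans ((le_max_right _ _).trans (le_max_right _ _)))
    (fun s => ?_) (fun t => ?_)
  · simpa only [damp_add] using key
  -- With one variable fixed, its damping factor is a constant. It sits at height 0 here and at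
  -- height `π` in the other variable's turn, since `t` is continued before `s`.
  · have := (h₂ s).mul (IsStripBoundary.const (damp a 0 s))
    convert! this using 2 <;> ring
  · have := (h₁ t).mul (IsStripBoundary.const (damp a Real.pi t))
    convert! this using 2 <;> ring

/-! ## Supports -/

/-- The dilations have real coefficients of determinant 1, so they rescale imaginary parts by the
inverse squared modulus of the denominator. In particular both semicircles are invariant. -/
theorem dilation_im (t : ℝ) (z : Circle) :
    ∃ r > 0, (dilation t z : ℂ).im = r * (z : ℂ).im := by
  have hd := dilation_den_ne_zero t z
  have hs := Real.cosh_sq_sub_sinh_sq (t / 2)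
  obtain ⟨c, hc⟩ : ∃ c : ℝ, c = Real.cosh (t / 2) := ⟨_, rfl⟩
  obtain ⟨s, hs'⟩ : ∃ s : ℝ, s = Real.sinh (t / 2) := ⟨_, rfl⟩
  rw [← hc, ← hs'] at hs hd
  refine ⟨(normSq (-s * z + c : ℂ))⁻¹, inv_pos.2 (normSq_pos.2 hd), ?_⟩
  rw [dilation_apply, ← hc, ← hs', div_eq_mul_inv, inv_def, ← mul_assoc, im_mul_ofReal, mul_comm]
  congr 1
  simp only [map_add, map_mul, map_neg, conj_ofReal, mul_im, sub_re, sub_im, add_re, add_im, mul_re,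
    neg_re, neg_im, ofReal_re, ofReal_im, conj_re, conj_im]
  linear_combination ((z : ℂ).im) * hs

theorem tsupport_beta_subset {I : Set Circle} (hI : ∀ (t : ℝ) (z : Circle), dilation t z ∈ I → z ∈ I)
    {f : SmoothCircle} (hf : tsupport f ⊆ I) (d : ℕ) (t : ℝ) :
    tsupport (beta d (dilation t) f) ⊆ I := by
  have hcont : Continuous fun z : Circle => dilation (-t) z := by
    have := continuous_dilation.comp (Continuous.prodMk_right (-t))
    simpa only [Function.comp_def] using this
  have hcl : IsClosed {z : Circle | dilation (-t) z ∈ tsupport f} :=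
    (isClosed_tsupport _).preimage hcont
  refine (closure_minimal (fun z hz => ?_) hcl).trans fun z hz => hI (-t) z (hf hz)
  refine subset_tsupport _ ?_
  rw [Function.mem_support] at hz ⊢
  intro h0
  apply hz
  change _ * f (((dilation t)⁻¹ : Mob) z) = 0
  rw [dilation_inv, h0, mul_zero]

theorem tsupport_beta_upper {f : SmoothCircle} (hf : tsupport f ⊆ upperArc) (d : ℕ) (t : ℝ) :
    tsupport (beta d (dilation t) f) ⊆ upperArc := by
  refine tsupport_beta_subset (fun t z hz => ?_) hf d t
  obtain ⟨r, hr, h⟩ := dilation_im t z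
  have h2 : 0 < (dilation t z : ℂ).im := hz
  rw [h] at h2
  exact (pos_iff_pos_of_mul_pos h2).1 hr

theorem tsupport_beta_lower {f : SmoothCircle} (hf : tsupport f ⊆ lowerArc) (d : ℕ) (t : ℝ) :
    tsupport (beta d (dilation t) f) ⊆ lowerArc := by
  refine tsupport_beta_subset (fun t z hz => ?_) hf d t
  obtain ⟨r, hr, h⟩ := dilation_im t z
  have h2 : (dilation t z : ℂ).im < 0 := hz
  rw [h] at h2
  exact neg_of_mul_neg_right h2 hr.le

theorem tsupport_reflect (f : SmoothCircle) : tsupport f.reflect = {z | z⁻¹ ∈ tsupport f} :=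
  tsupport_comp_eq_preimage (f : Circle → ℂ) (Homeomorph.inv Circle)

theorem tsupport_reflect_lower {f : SmoothCircle} (hf : tsupport f ⊆ upperArc) :
    tsupport f.reflect ⊆ lowerArc := by
  rw [tsupport_reflect]
  intro z hz
  have : 0 < ((z⁻¹ : Circle) : ℂ).im := hf hz
  simpa [lowerArc, Circle.coe_inv_eq_conj] using this

theorem tsupport_reflect_upper {f : SmoothCircle} (hf : tsupport f ⊆ lowerArc) :
    tsupport f.reflect ⊆ upperArc := by
  rw [tsupport_reflect]
  intro z hz
  have : ((z⁻¹ : Circle) : ℂ).im < 0 := hf hz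
  simpa [upperArc, Circle.coe_inv_eq_conj] using this

theorem reflect_reflect (f : SmoothCircle) : f.reflect.reflect = f := by
  ext z
  change f (z⁻¹)⁻¹ = f z
  rw [inv_inv]

theorem disjoint_upper_lower : Disjoint upperArc lowerArc := by
  rw [Set.disjoint_left]
  intro z hz hz'
  exact lt_asymm (show 0 < (z : ℂ).im from hz) hz'

/-! ## Fourier series of smooth functions on the circle -/

namespace SmoothCircle

/-- The function `z ↦ z ^ n`. -/
def monomial (n : ℤ) : SmoothCircle :=
  ⟨fun z => (z : ℂ) ^ n, by
    have h : (fun θ : ℝ => ((Circle.exp θ : Circle) : ℂ) ^ n) = fun θ : ℝ => cexp (n * (θ * I)) := by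
      funext θ
      rw [Circle.coe_exp, Complex.exp_int_mul]
    change ContDiff ℝ ∞ fun θ : ℝ => ((Circle.exp θ : Circle) : ℂ) ^ n
    rw [h]
    exact (contDiff_const.mul (ofRealCLM.contDiff.mul contDiff_const)).cexp⟩

theorem monomial_apply (n : ℤ) (z : Circle) : monomial n z = (z : ℂ) ^ n := rfl

theorem pull_monomial (n : ℤ) (θ : ℝ) : (monomial n).pull θ = cexp (n * (θ * I)) := by
  rw [pull, monomial_apply, Circle.coe_exp, Complex.exp_int_mul]

theorem ddθ_add (f g : SmoothCircle) : (f + g).ddθ = f.ddθ + g.ddθ := by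
  apply pull_injective
  funext θ
  exact ((f + g).hasDerivAt_pull θ).unique ((f.hasDerivAt_pull θ).add (g.hasDerivAt_pull θ))

theorem ddθ_smul (c : ℂ) (f : SmoothCircle) : (c • f).ddθ = c • f.ddθ := by
  apply pull_injective
  funext θ
  exact ((c • f).hasDerivAt_pull θ).unique ((f.hasDerivAt_pull θ).const_smul c)

theorem hasDerivAt_cexp_int (n : ℤ) (θ : ℝ) :
    HasDerivAt (fun θ : ℝ => cexp (n * (θ * I))) (n * I * cexp (n * (θ * I))) θ := by
  have h := (((ofRealCLM.hasDerivAt (x := θ)).mul_const I).const_mul (n : ℂ)).cexp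
  refine (h.congr_deriv ?_)
  simp; ring

theorem ddθ_monomial (n : ℤ) : (monomial n).ddθ = (n * I : ℂ) • monomial n := by
  apply pull_injective
  funext θ
  refine ((monomial n).hasDerivAt_pull θ).unique ?_
  have : (monomial n).pull = fun θ : ℝ => cexp (n * (θ * I)) := funext (pull_monomial n)
  rw [pull_smul, this]
  exact hasDerivAt_cexp_int n θ

/-- The Fourier coefficients. -/
def coef (n : ℤ) (g : SmoothCircle) : ℂ :=
  (1 / (2 * Real.pi) : ℝ) • ∫ θ in (-Real.pi)..Real.pi, cexp (-n * (θ * I)) * g.pull θ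

theorem norm_coef_le (n : ℤ) (g : SmoothCircle) : ‖coef n g‖ ≤ supSeminorm 0 g := by
  have hpi := Real.pi_pos
  rw [coef, norm_smul, Real.norm_of_nonneg (by positivity)]
  have h := intervalIntegral.norm_integral_le_of_norm_le_const (a := -Real.pi) (b := Real.pi)
    (C := supSeminorm 0 g) (f := fun θ : ℝ => cexp (-n * (θ * I)) * g.pull θ) (fun θ _ => by
      rw [norm_mul, show (-n * (θ * I) : ℂ) = ((-n * θ : ℝ) : ℂ) * I by push_cast; ring,
        norm_exp_ofReal_mul_I, one_mul]
      exact g.norm_pull_le 0 θ)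
  have h2 : |Real.pi - -Real.pi| = 2 * Real.pi := by
    rw [sub_neg_eq_add, ← two_mul, abs_of_pos (by positivity)]
  rw [h2] at h
  rw [div_mul_eq_mul_div, one_mul, div_le_iff₀ (by positivity)]
  exact h

theorem continuous_pull (g : SmoothCircle) : Continuous g.pull := g.contDiff_pull.continuous

theorem coef_ddθ (n : ℤ) (g : SmoothCircle) : coef n g.ddθ = n * I * coef n g := by
  have hd : ∀ θ : ℝ, HasDerivAt (fun θ : ℝ => cexp (-n * (θ * I)) * g.pull θ)
      (-n * I * cexp (-n * (θ * I)) * g.pull θ + cexp (-n * (θ * I)) * g.ddθ.pull θ) θ := by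
    intro θ
    have h1 := hasDerivAt_cexp_int (-n) θ
    push_cast at h1
    exact h1.mul (g.hasDerivAt_pull θ)
  have c1 := g.continuous_pull
  have c2 := g.ddθ.continuous_pull
  have hI := intervalIntegral.integral_eq_sub_of_hasDerivAt (a := -Real.pi) (b := Real.pi)
    (fun θ _ => hd θ) (Continuous.intervalIntegrable (by fun_prop) _ _)
  have hper : cexp (-n * ((Real.pi : ℝ) * I)) * g.pull Real.pi -
      cexp (-n * (((-Real.pi : ℝ) : ℂ) * I)) * g.pull (-Real.pi) = 0 := by
    have h1 : g.pull Real.pi = g.pull (-Real.pi) := by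
      have := g.periodic_pull (-Real.pi)
      rw [← this]; congr 1; ring
    have h2 : cexp (-n * ((Real.pi : ℝ) * I)) = cexp (-n * (((-Real.pi : ℝ) : ℂ) * I)) := by
      rw [Complex.exp_eq_exp_iff_exists_int]
      refine ⟨-n, ?_⟩
      push_cast; ring
    rw [h1, h2, sub_self]
  rw [hper, intervalIntegral.integral_add (Continuous.intervalIntegrable (by fun_prop) _ _)
    (Continuous.intervalIntegrable (by fun_prop) _ _)] at hI
  have h3 : ∫ θ in (-Real.pi)..Real.pi, -n * I * cexp (-n * (θ * I)) * g.pull θ =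
      -n * I * ∫ θ in (-Real.pi)..Real.pi, cexp (-n * (θ * I)) * g.pull θ := by
    rw [← intervalIntegral.integral_const_mul]
    refine intervalIntegral.integral_congr fun θ _ => ?_
    ring
  rw [h3] at hI
  rw [coef, coef, mul_smul_comm]
  congr 1
  linear_combination hI

/-- Two integrations by parts give the weight `n²`, enough for absolute summability over the
integers. -/
theorem norm_coef_le_cNorm (n : ℤ) (g : SmoothCircle) :
    ‖coef n g‖ ≤ cNorm 2 g * (1 + (n : ℝ) ^ 2)⁻¹ := by
  rw [← div_eq_mul_inv, le_div_iff₀ (by positivity)]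
  have h1 := norm_coef_le n g
  have h2 := norm_coef_le n g.ddθ.ddθ
  have h3 : supSeminorm 0 g.ddθ.ddθ = supSeminorm 2 g := by
    rw [supSeminorm_apply, supSeminorm_apply]; rfl
  have h4 : ‖coef n g.ddθ.ddθ‖ = (n : ℝ) ^ 2 * ‖coef n g‖ := by
    rw [coef_ddθ, coef_ddθ, ← mul_assoc, norm_mul, norm_mul, norm_mul, norm_I, mul_one,
      norm_intCast, ← pow_two, sq_abs]
  rw [h3, h4] at h2
  have h5 : supSeminorm 0 g + supSeminorm 2 g ≤ cNorm 2 g := by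
    have : 0 ≤ supSeminorm 1 g := apply_nonneg _ _
    rw [cNorm_apply, Finset.sum_range_succ, Finset.sum_range_succ, Finset.sum_range_one]
    linarith
  linarith

theorem summable_weight : Summable fun n : ℤ => (1 + (n : ℝ) ^ 2)⁻¹ := by
  have h2 : Summable fun n : ℕ => (1 + (n : ℝ) ^ 2)⁻¹ := by
    refine Summable.of_norm_bounded_eventually_nat (g := fun n : ℕ => ((n : ℝ) ^ 2)⁻¹)
      (Real.summable_nat_pow_inv.2 one_lt_two) ?_
    filter_upwards [eventually_ge_atTop 1] with n hn
    have : (1 : ℝ) ≤ n := by exact_mod_cast hn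
    rw [Real.norm_of_nonneg (by positivity)]
    exact inv_anti₀ (by positivity) (by linarith)
  refine Summable.of_nat_of_neg (by simpa using h2) (by simpa using h2)

theorem summable_coef (g : SmoothCircle) : Summable fun n => coef n g :=
  Summable.of_norm_bounded (summable_weight.mul_left (cNorm 2 g)) fun n => norm_coef_le_cNorm n g

theorem hasSum_coef (g : SmoothCircle) (θ : ℝ) :
    HasSum (fun n : ℤ => coef n g * cexp (n * (θ * I))) (g.pull θ) := by
  have : Fact (0 < 2 * Real.pi) := ⟨Real.two_pi_pos⟩
  have hcirc : ∀ x : ℝ, AddCircle.toCircle (x : AddCircle (2 * Real.pi)) = Circle.exp x := by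
    intro x
    rw [AddCircle.toCircle_apply_mk, div_self Real.two_pi_pos.ne', one_mul]
  set F : C(AddCircle (2 * Real.pi), ℂ) :=
    ⟨fun x => g (AddCircle.toCircle x), g.continuous.comp AddCircle.continuous_toCircle⟩ with hF
  have hFx : ∀ x : ℝ, F (x : AddCircle (2 * Real.pi)) = g.pull x := by
    intro x
    change g (AddCircle.toCircle (x : AddCircle (2 * Real.pi))) = g (Circle.exp x)
    rw [hcirc]
  have hfour : ∀ (n : ℤ) (x : ℝ), fourier n (x : AddCircle (2 * Real.pi)) = cexp (n * (x * I)) := by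
    intro n x
    rw [fourier_coe_apply]
    congr 1
    have : (Real.pi : ℂ) ≠ 0 := ofReal_ne_zero.2 Real.pi_pos.ne'
    push_cast
    field_simp
  have hcoef : ∀ n, fourierCoeff F n = coef n g := by
    intro n
    rw [fourierCoeff_eq_intervalIntegral F n (-Real.pi), coef]
    have : -Real.pi + 2 * Real.pi = Real.pi := by ring
    rw [this]
    congr 1
    refine intervalIntegral.integral_congr fun x _ => ?_
    rw [hfour, hFx, smul_eq_mul]
    push_cast; rfl
  have hs : Summable (fourierCoeff F) := by
    simpa only [funext hcoef] using summable_coef g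
  have := has_pointwise_sum_fourier_series_of_summable hs (θ : AddCircle (2 * Real.pi))
  simpa only [hcoef, hfour, hFx, smul_eq_mul] using this

/-- A partial sum of the Fourier series. -/
def partialSum (s : Finset ℤ) (g : SmoothCircle) : SmoothCircle := ∑ n ∈ s, coef n g • monomial n

theorem pull_sum {ι : Type*} (s : Finset ι) (f : ι → SmoothCircle) (θ : ℝ) :
    (∑ i ∈ s, f i).pull θ = ∑ i ∈ s, (f i).pull θ := by
  classical
  induction s using Finset.induction_on with
  | empty => rfl
  | insert i s hi ih => rw [Finset.sum_insert hi, Finset.sum_insert hi, ← ih]; rfl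

/-- Truncation commutes with differentiation, so every `C^N` estimate reduces to a sup-norm estimate
for derivatives. -/
theorem ddθ_partialSum (s : Finset ℤ) (g : SmoothCircle) :
    (partialSum s g).ddθ = partialSum s g.ddθ := by
  classical
  unfold partialSum
  induction s using Finset.induction_on with
  | empty =>
    have := ddθ_smul 0 (0 : SmoothCircle)
    simpa using this
  | insert i s hi ih =>
    rw [Finset.sum_insert hi, Finset.sum_insert hi, ddθ_add, ih, ddθ_smul, ddθ_monomial, coef_ddθ,
      smul_smul, mul_comm (coef i g)]

theorem iterate_ddθ_partialSum (s : Finset ℤ) (g : SmoothCircle) (j : ℕ) :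
    ddθ^[j] (partialSum s g) = partialSum s (ddθ^[j] g) := by
  induction j generalizing g with
  | zero => rfl
  | succ j ih => rw [Function.iterate_succ_apply, ddθ_partialSum, ih, Function.iterate_succ_apply]

/-- The tail `∑_{n ∉ s} 1 / (1 + n²)`. -/
def tailWeight (s : Finset ℤ) : ℝ := ∑' n : {n : ℤ // n ∉ s}, (1 + ((n : ℤ) : ℝ) ^ 2)⁻¹

theorem norm_pull_sub_partialSum_le (s : Finset ℤ) (g : SmoothCircle) (θ : ℝ) :
    ‖(g - partialSum s g).pull θ‖ ≤ tailWeight s * cNorm 2 g := by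
  have hsum := hasSum_coef g θ
  have h1 : (g - partialSum s g).pull θ =
      ∑' n : {n : ℤ // n ∉ s}, coef n g * cexp ((n : ℤ) * (θ * I)) := by
    rw [pull_sub, Pi.sub_apply, partialSum, pull_sum, ← hsum.tsum_eq,
      ← hsum.summable.sum_add_tsum_subtype_compl s]
    simp only [pull_smul, Pi.smul_apply, pull_monomial, smul_eq_mul, add_sub_cancel_left]
  rw [h1, tailWeight, ← tsum_mul_right]
  refine tsum_of_norm_bounded
    (((summable_weight.subtype _).mul_right (cNorm 2 g)).hasSum) fun n => ?_
  rw [norm_mul, show ((n : ℤ) * (θ * I) : ℂ) = (((n : ℤ) * θ : ℝ) : ℂ) * I by push_cast; ring,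
        norm_exp_ofReal_mul_I, mul_one, mul_comm]
  exact norm_coef_le_cNorm n g

theorem cNorm_iterate_le (j : ℕ) (g : SmoothCircle) : cNorm 2 (ddθ^[j] g) ≤ 3 * cNorm (j + 2) g := by
  rw [cNorm_apply]
  have : ∀ i ∈ Finset.range (2 + 1), supSeminorm i (ddθ^[j] g) ≤ cNorm (j + 2) g := by
    intro i hi
    have h : supSeminorm i (ddθ^[j] g) = supSeminorm (i + j) g := by
      rw [supSeminorm_apply, supSeminorm_apply, Function.iterate_add_apply]
    rw [h]
    exact supSeminorm_le_cNorm (by have := Finset.mem_range.1 hi; omega) g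
  refine (Finset.sum_le_sum this).trans_eq ?_
  simp

theorem tailWeight_nonneg (s : Finset ℤ) : 0 ≤ tailWeight s :=
  tsum_nonneg fun _ => by positivity

/-- Two derivatives are lost to absolute convergence. In return the truncation set is independent of
`g`, which enters only through a norm; this permits truncating a whole family of functions at once.
-/
theorem cNorm_sub_partialSum_le (N : ℕ) (s : Finset ℤ) (g : SmoothCircle) :
    cNorm N (g - partialSum s g) ≤ tailWeight s * (3 * (N + 1) * cNorm (N + 2) g) := by
  rw [cNorm_apply]
  have : ∀ j ∈ Finset.range (N + 1), supSeminorm j (g - partialSum s g) ≤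
      tailWeight s * (3 * cNorm (N + 2) g) := by
    intro j hj
    refine supSeminorm_le fun θ => ?_
    rw [iterate_ddθ_sub, iterate_ddθ_partialSum]
    refine (norm_pull_sub_partialSum_le s _ θ).trans
      (mul_le_mul_of_nonneg_left ((cNorm_iterate_le j g).trans ?_) (tailWeight_nonneg s))
    exact mul_le_mul_of_nonneg_left
      (cNorm_mono (by have := Finset.mem_range.1 hj; omega) g) (by norm_num)
  refine (Finset.sum_le_sum this).trans_eq ?_
  simp; ring

theorem tendsto_tailWeight : Tendsto tailWeight atTop (𝓝 0) :=
  tendsto_tsum_compl_atTop_zero fun n : ℤ => (1 + (n : ℝ) ^ 2)⁻¹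

theorem exists_norm_le_cNorm {L : SmoothCircle →ₗ[ℂ] ℂ} (hL : Continuous L) :
    ∃ (N : ℕ) (C : ℝ), 0 ≤ C ∧ ∀ g, ‖L g‖ ≤ C * cNorm N g := by
  obtain ⟨s, C, -, h⟩ := Seminorm.bound_of_continuous withSeminorms_cNorm
    ((normSeminorm ℂ ℂ).comp L) (by
      change Continuous fun g => ‖L g‖
      exact hL.norm)
  refine ⟨s.sup id, C, C.2, fun g => (h g).trans ?_⟩
  rw [smul_apply]
  refine mul_le_mul_of_nonneg_left ?_ C.2
  refine Seminorm.finset_sup_apply_le (apply_nonneg _ _) fun i hi => ?_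
  exact cNorm_mono (Finset.le_sup (f := id) hi) g

/-- A continuous functional is approximated by finitely many Fourier coefficients. -/
theorem exists_forall_norm_sub_sum_coef_le {L : SmoothCircle →ₗ[ℂ] ℂ} (hL : Continuous L) :
    ∃ N : ℕ, ∀ δ > 0, ∃ s₀ : Finset ℤ, ∀ s, s₀ ⊆ s → ∀ g : SmoothCircle,
      ‖∑ n ∈ s, coef n g * L (monomial n) - L g‖ ≤ δ * cNorm N g := by
  obtain ⟨N, C, hC, hb⟩ := exists_norm_le_cNorm hL
  refine ⟨N + 2, fun δ hδ => ?_⟩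
  have hlim := tendsto_tailWeight.const_mul (C * (3 * (N + 1)))
  rw [mul_zero] at hlim
  obtain ⟨s₀, hs₀⟩ := (hlim.eventually (gt_mem_nhds hδ)).exists_forall_of_atTop
  refine ⟨s₀, fun s hs g => ?_⟩
  have h1 : ∑ n ∈ s, coef n g * L (monomial n) = L (partialSum s g) := by
    rw [partialSum, map_sum]
    simp only [map_smul, smul_eq_mul]
  rw [h1, norm_sub_rev, ← map_sub]
  refine (hb _).trans ((mul_le_mul_of_nonneg_left (cNorm_sub_partialSum_le N s g) hC).trans ?_)
  have h2 := mul_le_mul_of_nonneg_right (hs₀ s hs).le (apply_nonneg (cNorm (N + 2)) g)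
  linarith

theorem coef_neg_reflect (n : ℤ) (g : SmoothCircle) : coef (-n) g.reflect = coef n g := by
  have hr : ∀ θ, g.reflect.pull θ = g.pull (-θ) := by
    intro θ
    change g (Circle.exp θ)⁻¹ = g (Circle.exp (-θ))
    rw [Circle.exp_neg]
  rw [coef, coef]
  congr 1
  have := intervalIntegral.integral_comp_neg (a := -Real.pi) (b := Real.pi)
    fun θ : ℝ => cexp (-n * (θ * I)) * g.pull θ
  rw [neg_neg] at this
  rw [← this]
  refine intervalIntegral.integral_congr fun θ _ => ?_
  simp only [hr]
  push_cast
  congr 2; ring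

end SmoothCircle

/-! ## The logarithmic coordinate on the upper semicircle -/

/-- The conformal map from the strip `0 < Im w < π` onto the unit disk. -/
def stripMap (w : ℂ) : ℂ := (1 + I * cexp w) / (1 - I * cexp w)

/-- The angle of the point `stripMap x`. -/
def stripAngle (x : ℝ) : ℝ := 2 * Real.arctan (Real.exp x)

theorem normSq_one_add_mul_exp (σ : ℝ) (w : ℂ) : normSq (1 + σ * I * cexp w) =
    1 - 2 * σ * Real.exp w.re * Real.sin w.im + σ ^ 2 * Real.exp w.re ^ 2 := by
  have h1 : (1 + σ * I * cexp w : ℂ).re = 1 - σ * (Real.exp w.re * Real.sin w.im) := by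
    rw [mul_assoc, add_re, re_ofReal_mul, I_mul_re, exp_im, one_re]; ring
  have h2 : (1 + σ * I * cexp w : ℂ).im = σ * (Real.exp w.re * Real.cos w.im) := by
    rw [mul_assoc, add_im, im_ofReal_mul, I_mul_im, exp_re, one_im]; ring
  rw [normSq_apply, h1, h2]
  linear_combination σ ^ 2 * Real.exp w.re ^ 2 * Real.sin_sq_add_cos_sq w.im

theorem normSq_stripMap_den (w : ℂ) : normSq (1 - I * cexp w) =
    1 + 2 * Real.exp w.re * Real.sin w.im + Real.exp w.re ^ 2 := by
  have := normSq_one_add_mul_exp (-1) w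
  push_cast at this
  rw [show (1 - I * cexp w : ℂ) = 1 + -1 * I * cexp w by ring, this]; ring

theorem normSq_stripMap_num (w : ℂ) : normSq (1 + I * cexp w) =
    1 - 2 * Real.exp w.re * Real.sin w.im + Real.exp w.re ^ 2 := by
  have := normSq_one_add_mul_exp 1 w
  push_cast at this
  rw [show (1 + I * cexp w : ℂ) = 1 + 1 * I * cexp w by ring, this]; ring

theorem sin_im_nonneg {w : ℂ} (hw : w ∈ cstrip) : 0 ≤ Real.sin w.im :=
  Real.sin_nonneg_of_nonneg_of_le_pi hw.1 hw.2

theorem stripMap_den_ne_zero {w : ℂ} (hw : w ∈ cstrip) : 1 - I * cexp w ≠ 0 := by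
  rw [← normSq_pos, normSq_stripMap_den]
  have := mul_nonneg (Real.exp_pos w.re).le (sin_im_nonneg hw)
  nlinarith [Real.exp_pos w.re]

theorem norm_stripMap_le {w : ℂ} (hw : w ∈ cstrip) : ‖stripMap w‖ ≤ 1 := by
  have h0 := stripMap_den_ne_zero hw
  rw [stripMap, norm_div, div_le_one (norm_pos_iff.2 h0)]
  refine abs_le_of_sq_le_sq' ?_ (norm_nonneg _) |>.2
  rw [← normSq_eq_norm_sq, ← normSq_eq_norm_sq, normSq_stripMap_den, normSq_stripMap_num]
  have := mul_nonneg (Real.exp_pos w.re).le (sin_im_nonneg hw)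
  linarith

/-- The continuation of `stripMap x / cosh x`. -/
def stripDensity (w : ℂ) : ℂ := 2 * cexp w / (1 - I * cexp w) ^ 2

/-- On the strip `sin (Im w) ≥ 0`, so the squared modulus of the denominator is at least `1 + e^{2
Re w}`, which dominates `2 e^{Re w}`. -/
theorem norm_stripDensity_le {w : ℂ} (hw : w ∈ cstrip) : ‖stripDensity w‖ ≤ 1 := by
  have h0 := stripMap_den_ne_zero hw
  rw [stripDensity, norm_div, norm_pow, div_le_one (by positivity), ← normSq_eq_norm_sq,
    normSq_stripMap_den, norm_mul, norm_exp]
  have := mul_nonneg (Real.exp_pos w.re).le (sin_im_nonneg hw)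
  have h2 : ‖(2 : ℂ)‖ = 2 := by simp
  rw [h2]
  nlinarith [sq_nonneg (Real.exp w.re - 1)]

theorem differentiableAt_stripMap {w : ℂ} (hw : w ∈ cstrip) : DifferentiableAt ℂ stripMap w := by
  unfold stripMap
  exact DifferentiableAt.div (by fun_prop) (by fun_prop) (stripMap_den_ne_zero hw)

theorem differentiableAt_stripDensity {w : ℂ} (hw : w ∈ cstrip) :
    DifferentiableAt ℂ stripDensity w := by
  unfold stripDensity
  exact DifferentiableAt.div (by fun_prop) (by fun_prop) (pow_ne_zero 2 (stripMap_den_ne_zero hw))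

theorem one_add_ne_zero (x : ℝ) : (1 + I * cexp x : ℂ) ≠ 0 := by
  rw [← normSq_pos, normSq_stripMap_num]
  simp only [ofReal_im, Real.sin_zero, mul_zero, sub_zero]
  positivity

theorem one_sub_ne_zero (x : ℝ) : (1 - I * cexp x : ℂ) ≠ 0 :=
  stripMap_den_ne_zero (ofReal_mem_cstrip x)

theorem stripMap_ne_zero (x : ℝ) : stripMap x ≠ 0 :=
  div_ne_zero (one_add_ne_zero x) (one_sub_ne_zero x)

/-- A shift by `iπ` changes the sign of the exponential and exchanges numerator and denominator.
This is the source of the reflection `z ↦ z⁻¹`. -/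
theorem stripMap_add_pi (x : ℝ) : stripMap (x + Real.pi * I) = (stripMap x)⁻¹ := by
  rw [stripMap, stripMap, exp_add, exp_pi_mul_I, inv_div]
  congr 1 <;> ring

theorem cosh_eq_mul (x : ℝ) :
    2 * cexp x * (Real.cosh x : ℂ) = (1 + I * cexp x) * (1 - I * cexp x) := by
  rw [ofReal_cosh, Complex.cosh, exp_neg]
  have := exp_ne_zero (x : ℂ)
  field_simp
  linear_combination cexp x ^ 2 * I_sq

theorem cosh_ne_zero (x : ℝ) : (Real.cosh x : ℂ) ≠ 0 := ofReal_ne_zero.2 (Real.cosh_pos x).ne'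

theorem stripDensity_ofReal (x : ℝ) : stripDensity x = stripMap x * (Real.cosh x : ℂ)⁻¹ := by
  have h1 := one_sub_ne_zero x
  have h2 := cosh_ne_zero x
  rw [stripDensity, stripMap, ← div_eq_mul_inv, div_div, div_eq_div_iff (pow_ne_zero 2 h1)
    (mul_ne_zero h1 h2)]
  linear_combination (1 - I * cexp x) * cosh_eq_mul x

/-- The numerator of `stripDensity` changes sign under the shift; compared with
`stripDensity_ofReal`, this is the origin of the factor `(-1)^d`. -/
theorem stripDensity_add_pi (x : ℝ) :
    stripDensity (x + Real.pi * I) = -((stripMap x)⁻¹ * (Real.cosh x : ℂ)⁻¹) := by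
  have h1 := one_sub_ne_zero x
  have h2 := cosh_ne_zero x
  have h3 := one_add_ne_zero x
  rw [stripDensity, stripMap, inv_div, exp_add, exp_pi_mul_I, ← div_eq_mul_inv, div_div, ← neg_div,
    div_eq_div_iff (by simpa using h3) (mul_ne_zero h3 h2)]
  linear_combination -(1 + I * cexp x) * cosh_eq_mul x

theorem exp_stripAngle (x : ℝ) : (Circle.exp (stripAngle x) : ℂ) = stripMap x := by
  have h1 := one_sub_ne_zero x
  have hpos : (0 : ℝ) < 1 + Real.exp x ^ 2 := by positivity
  have hsq : (√(1 + Real.exp x ^ 2) : ℂ) ^ 2 = 1 + cexp x ^ 2 := by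
    rw [← ofReal_pow, Real.sq_sqrt hpos.le]; push_cast; rfl
  have hs0 : (√(1 + Real.exp x ^ 2) : ℂ) ≠ 0 := ofReal_ne_zero.2 (Real.sqrt_pos.2 hpos).ne'
  have ha : cexp (Real.arctan (Real.exp x) * I) = (1 + I * cexp x) / √(1 + Real.exp x ^ 2) := by
    rw [exp_mul_I, ← ofReal_cos, ← ofReal_sin, Real.cos_arctan, Real.sin_arctan]
    push_cast
    field_simp
  rw [Circle.coe_exp, stripAngle]
  have : (((2 * Real.arctan (Real.exp x) : ℝ) : ℂ) * I) =
      Real.arctan (Real.exp x) * I + Real.arctan (Real.exp x) * I := by push_cast; ring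
  rw [this, exp_add, ha, stripMap, div_mul_div_comm, ← pow_two (√_ : ℂ), hsq, div_eq_div_iff _ h1]
  · linear_combination -(1 + I * cexp x) * cexp x ^ 2 * I_sq
  · rw [← hsq]; exact pow_ne_zero 2 hs0

theorem hasDerivAt_stripAngle (x : ℝ) : HasDerivAt stripAngle (Real.cosh x)⁻¹ x := by
  have := ((Real.hasDerivAt_exp x).arctan).const_mul 2
  refine HasDerivAt.congr_deriv this ?_
  rw [Real.cosh_eq, Real.exp_neg]
  have := Real.exp_pos x
  field_simp
  ring

theorem injective_stripAngle : Function.Injective stripAngle := by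
  intro x y h
  have := mul_left_cancel₀ two_ne_zero h
  exact Real.exp_injective (Real.arctan_injective this)

theorem image_stripAngle : stripAngle '' univ = Ioo 0 Real.pi := by
  ext θ
  simp only [image_univ, mem_range, mem_Ioo]
  constructor
  · rintro ⟨x, rfl⟩
    have h1 := Real.arctan_lt_pi_div_two (Real.exp x)
    have h2 := Real.arctan_pos.2 (Real.exp_pos x)
    constructor <;> unfold stripAngle <;> linarith
  · rintro ⟨h0, h1⟩
    refine ⟨Real.log (Real.tan (θ / 2)), ?_⟩
    rw [stripAngle, Real.exp_log (Real.tan_pos_of_pos_of_lt_pi_div_two (by linarith) (by linarith)),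
      Real.arctan_tan (by linarith) (by linarith)]
    ring

/-- This is the purpose of the coordinate: continuing in the group parameter becomes a shift of the
argument of `stripMap`. -/
theorem dilation_stripAngle (t x : ℝ) :
    dilation t (Circle.exp (stripAngle x)) = Circle.exp (stripAngle (x + t)) := by
  apply Circle.ext
  have h1 := one_sub_ne_zero x
  have h2 := one_sub_ne_zero (x + t)
  have hd := dilation_den_ne_zero t (Circle.exp (stripAngle x))
  rw [dilation_apply]
  rw [exp_stripAngle] at hd ⊢
  rw [exp_stripAngle, div_eq_iff hd]
  rw [stripMap, stripMap, ofReal_add, exp_add]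
  rw [ofReal_add, exp_add] at h2
  have hE : cexp t = cexp (t / 2) ^ 2 := by
    rw [pow_two, ← exp_add]; congr 1; ring
  have he := exp_ne_zero ((t : ℂ) / 2)
  rw [hE] at h2 ⊢
  have hc : (Real.cosh (t / 2) : ℂ) = (cexp (t / 2) + (cexp (t / 2))⁻¹) / 2 := by
    rw [ofReal_cosh, Complex.cosh, exp_neg]; push_cast; rfl
  have hs : (Real.sinh (t / 2) : ℂ) = (cexp (t / 2) - (cexp (t / 2))⁻¹) / 2 := by
    rw [ofReal_sinh, Complex.sinh, exp_neg]; push_cast; rfl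
  rw [hc, hs]
  generalize cexp (x : ℂ) = X at *
  generalize cexp ((t : ℂ) / 2) = E at *
  rw [div_mul_eq_mul_div _ (1 - I * (X * E ^ 2)), eq_div_iff h2]
  field_simp
  ring

theorem dilFactor_stripAngle (t x : ℝ) :
    dilFactor t (stripAngle x) = Real.cosh (x - t) / Real.cosh x := by
  have hcos : Real.cos (stripAngle x) = -(Real.sinh x / Real.cosh x) := by
    have hpos : (0 : ℝ) < 1 + Real.exp x ^ 2 := by positivity
    rw [stripAngle, Real.cos_two_mul, Real.cos_arctan, div_pow, Real.sq_sqrt hpos.le, Real.sinh_eq,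
      Real.cosh_eq, Real.exp_neg]
    have := Real.exp_pos x
    field_simp
    ring
  rw [dilFactor, hcos, Real.cosh_sub]
  have := (Real.cosh_pos x).ne'
  field_simp
  ring

theorem continuous_stripAngle : Continuous stripAngle := by
  unfold stripAngle; fun_prop

namespace SmoothCircle

/-- The Fourier coefficients of a function supported in the upper semicircle, in the logarithmic
coordinate. -/
theorem coef_eq_integral {g : SmoothCircle} (hg : ∀ z : Circle, (z : ℂ).im ≤ 0 → g z = 0) (n : ℤ) :
    coef n g = (1 / (2 * Real.pi) : ℝ) •
      ∫ x : ℝ, (Real.cosh x : ℂ)⁻¹ * (stripMap x ^ (-n) * g.pull (stripAngle x)) := by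
  have hpi := Real.pi_pos
  rw [coef]
  congr 1
  have c1 := g.continuous_pull
  rw [← intervalIntegral.integral_add_adjacent_intervals (b := 0)
    (Continuous.intervalIntegrable (by fun_prop) _ _)
    (Continuous.intervalIntegrable (by fun_prop) _ _)]
  have hz : ∫ θ in (-Real.pi)..0, cexp (-n * (θ * I)) * g.pull θ = 0 := by
    refine (intervalIntegral.integral_congr (g := fun _ => (0 : ℂ)) fun θ hθ => ?_).trans (by simp)
    rw [uIcc_of_le (by linarith)] at hθ
    have : g.pull θ = 0 := by
      refine hg _ ?_
      rw [Circle.coe_exp, exp_ofReal_mul_I_im]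
      exact Real.sin_nonpos_of_nonpos_of_neg_pi_le hθ.2 hθ.1
    simp [this]
  rw [hz, zero_add, intervalIntegral.integral_of_le hpi.le, integral_Ioc_eq_integral_Ioo,
    ← image_stripAngle, integral_image_eq_integral_abs_deriv_smul MeasurableSet.univ
      (fun x _ => (hasDerivAt_stripAngle x).hasDerivWithinAt) injective_stripAngle.injOn,
    Measure.restrict_univ]
  refine integral_congr_ae (Eventually.of_forall fun x => ?_)
  simp only
  rw [abs_of_pos (inv_pos.2 (Real.cosh_pos x)), real_smul, ofReal_inv, ← exp_stripAngle,
    Circle.coe_exp, ← Complex.exp_int_mul]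
  push_cast; rfl

/-- A function supported in the upper semicircle, in the logarithmic coordinate. -/
def profile (d : ℕ) (f : SmoothCircle) (x : ℝ) : ℂ :=
  (Real.cosh x : ℂ) ^ ((d : ℤ) - 1) * f.pull (stripAngle x)

theorem apply_eq_zero_of_im_nonpos {f : SmoothCircle} (hf : tsupport f ⊆ upperArc) {z : Circle}
    (hz : (z : ℂ).im ≤ 0) : f z = 0 := by
  by_contra h
  have : 0 < (z : ℂ).im := hf (subset_tsupport _ h)
  linarith

theorem continuous_profile (d : ℕ) (f : SmoothCircle) : Continuous (profile d f) := by
  have h1 := f.continuous_pull.comp continuous_stripAngle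
  refine Continuous.mul ?_ h1
  refine Continuous.zpow₀ ?_ _ fun x => Or.inl (cosh_ne_zero x)
  exact continuous_ofReal.comp Real.continuous_cosh

theorem im_exp_stripAngle (x : ℝ) : (Circle.exp (stripAngle x) : ℂ).im = (Real.cosh x)⁻¹ := by
  have hpos : (0 : ℝ) < 1 + Real.exp x ^ 2 := by positivity
  rw [Circle.coe_exp, exp_ofReal_mul_I_im, stripAngle, Real.sin_two_mul, Real.sin_arctan,
    Real.cos_arctan, Real.cosh_eq, Real.exp_neg]
  have := Real.exp_pos x
  have h2 := Real.sq_sqrt hpos.le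
  have h3 := Real.sqrt_pos.2 hpos
  field_simp
  rw [h2]; ring

/-- A compact subset of the open semicircle has imaginary part bounded below by some `c > 0`, and in
this coordinate the imaginary part is `1 / cosh x`. -/
theorem hasCompactSupport_profile {f : SmoothCircle} (hf : tsupport f ⊆ upperArc) (d : ℕ) :
    HasCompactSupport (profile d f) := by
  have hK : IsCompact (tsupport f) := (isClosed_tsupport _).isCompact
  have him : Continuous fun z : Circle => (z : ℂ).im := continuous_im.comp continuous_subtype_val
  obtain ⟨c, hc, hb⟩ : ∃ c > 0, ∀ z ∈ tsupport f, c ≤ (z : ℂ).im := by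
    rcases (tsupport (f : Circle → ℂ)).eq_empty_or_nonempty with h | h
    · exact ⟨1, one_pos, fun z hz => by rw [h] at hz; exact absurd hz (notMem_empty z)⟩
    · obtain ⟨z, hz, hmin⟩ := hK.exists_isMinOn h him.continuousOn
      exact ⟨(z : ℂ).im, hf hz, fun w hw => hmin hw⟩
  -- The bound `2 / c` comes from `|x| < e^{|x|} ≤ 2 cosh x ≤ 2 / c` at points where `f` does not
  -- vanish.
  refine HasCompactSupport.intro (K := Icc (-(2 / c)) (2 / c)) isCompact_Icc fun x hx => ?_
  have hx' : 2 / c < |x| := by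
    by_contra! h
    exact hx (abs_le.1 h)
  have hzero : f.pull (stripAngle x) = 0 := by
    by_contra h
    have h1 := hb _ (subset_tsupport _ h)
    rw [im_exp_stripAngle, le_inv_comm₀ hc (Real.cosh_pos x)] at h1
    have h2 : Real.exp |x| ≤ 2 * Real.cosh x := by
      rw [← Real.cosh_abs, Real.cosh_eq]
      have := Real.exp_pos (-|x|)
      linarith
    have h3 := Real.add_one_le_exp |x|
    rw [div_eq_mul_inv] at hx'
    linarith
  rw [profile, hzero, mul_zero]

/-- The substitution `x = y + t` moves all dependence on `t` from the function into an explicit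
kernel. Of the `d` inverse powers of `cosh (y + t)`, one is the Jacobian and `d - 1` come from the
conformal factor. -/
theorem coef_beta {f : SmoothCircle} (hf : tsupport f ⊆ upperArc) (d : ℕ) (t : ℝ) (n : ℤ) :
    coef n (beta d (dilation t) f) = (1 / (2 * Real.pi) : ℝ) •
      ∫ y : ℝ, stripMap ((y + t : ℝ) : ℂ) ^ (-n) * ((Real.cosh (y + t) : ℂ)⁻¹) ^ d * profile d f y := by
  have hsupp := tsupport_beta_upper hf d t
  rw [coef_eq_integral (fun z hz => apply_eq_zero_of_im_nonpos hsupp hz),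
    ← integral_add_right_eq_self _ t]
  congr 1
  refine integral_congr_ae (Eventually.of_forall fun y => ?_)
  simp only
  have h1 := cosh_ne_zero (y + t)
  have h2 : f (dilation (-t) (Circle.exp (stripAngle (y + t)))) = f.pull (stripAngle y) := by
    rw [dilation_stripAngle, add_neg_cancel_right]; rfl
  rw [beta_apply_exp, dilFactor_stripAngle, h2, profile, add_sub_cancel_right, ofReal_div, div_zpow]
  have h3 : ((Real.cosh (y + t) : ℂ)⁻¹) ^ d =
      (Real.cosh (y + t) : ℂ)⁻¹ * ((Real.cosh (y + t) : ℂ) ^ ((d : ℤ) - 1))⁻¹ := by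
    rw [zpow_sub_one₀ h1, zpow_natCast, mul_inv, inv_inv, inv_pow]
    field_simp
  rw [h3]
  ring

/-- Dilations have real coefficients, so they commute with complex conjugation, which is inversion
on the circle; the conformal factor is even in the angle. -/
theorem beta_reflect (d : ℕ) (t : ℝ) (f : SmoothCircle) :
    beta d (dilation t) f.reflect = (beta d (dilation t) f).reflect := by
  apply pull_injective
  funext θ
  have h1 : (beta d (dilation t) f).reflect.pull θ = (beta d (dilation t) f).pull (-θ) := by
    change (beta d (dilation t) f) (Circle.exp θ)⁻¹ = (beta d (dilation t) f) (Circle.exp (-θ))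
    rw [Circle.exp_neg]
  have h2 : f.reflect (dilation (-t) (Circle.exp θ)) = f (dilation (-t) (Circle.exp (-θ))) := by
    change f (dilation (-t) (Circle.exp θ))⁻¹ = _
    refine congrArg (f : Circle → ℂ) (Circle.ext ?_)
    rw [Circle.coe_inv_eq_conj, dilation_apply, dilation_apply, Circle.exp_neg,
      Circle.coe_inv_eq_conj]
    simp only [map_div₀, map_add, map_sub, map_mul, map_neg, conj_ofReal]
  rw [h1, beta_apply_exp, beta_apply_exp, h2, dilFactor, dilFactor, Real.cos_neg]

/-- The high Fourier modes of a transported function continue to the strip. -/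
theorem isStripBoundary_coef {f : SmoothCircle} (hf : tsupport f ⊆ upperArc) {d n : ℕ}
    (hn : d ≤ n) :
    IsStripBoundary (fun t => coef (-n) (beta d (dilation t) f))
      (fun t => (-1) ^ d * coef (-n) (beta d (dilation t) f.reflect)) := by
  have hint : Integrable (profile d f) :=
    (continuous_profile d f).integrable_of_hasCompactSupport (hasCompactSupport_profile hf d)
  -- On the real line `Q` is `stripMap ^ n` divided by `cosh ^ d`. Pairing `d` of the powers with
  -- the hyperbolic cosines removes the poles, and `d ≤ n` leaves a nonnegative power of `stripMap`.
  set Q : ℂ → ℂ := fun w => stripMap w ^ (n - d) * stripDensity w ^ d with hQ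
  have hQd : ∀ w ∈ cstrip, DifferentiableAt ℂ Q w := fun w hw =>
    ((differentiableAt_stripMap hw).pow _).mul ((differentiableAt_stripDensity hw).pow _)
  have hQb : ∀ w ∈ cstrip, ‖Q w‖ ≤ 1 := by
    intro w hw
    rw [hQ, norm_mul, norm_pow, norm_pow]
    exact mul_le_one₀ (pow_le_one₀ (norm_nonneg _) (norm_stripMap_le hw)) (by positivity)
      (pow_le_one₀ (norm_nonneg _) (norm_stripDensity_le hw))
  have hshift : ∀ w ∈ cstrip, ∀ y : ℝ, (y : ℂ) + w ∈ cstrip := by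
    intro w hw y
    simpa [cstrip] using hw
  have hshift' : ∀ w ∈ ostrip, ∀ y : ℝ, (y : ℂ) + w ∈ ostrip := by
    intro w hw y
    simpa [ostrip] using hw
  set F : ℂ → ℝ → ℂ := fun w y => Q (y + w) * profile d f y with hF
  have hFb : ∀ w ∈ cstrip, ∀ y, ‖F w y‖ ≤ ‖profile d f y‖ := by
    intro w hw y
    rw [hF, norm_mul]
    exact mul_le_of_le_one_left (norm_nonneg _) (hQb _ (hshift w hw y))
  have hFm : ∀ w ∈ cstrip, AEStronglyMeasurable (F w) volume := by
    intro w hw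
    refine Continuous.aestronglyMeasurable (Continuous.mul ?_ (continuous_profile d f))
    refine continuous_iff_continuousAt.2 fun y => ?_
    exact ContinuousAt.comp (f := fun y : ℝ => (y : ℂ) + w)
      (hQd _ (hshift w hw y)).continuousAt (by fun_prop)
  refine ⟨fun w => (1 / (2 * Real.pi) : ℝ) • ∫ y, F w y, ?_, ?_, ?_, ?_, ?_⟩
  · have hc : ContinuousOn (fun w => ∫ y, F w y) cstrip := continuousOn_of_dominated hFm
      (fun w hw => Eventually.of_forall (hFb w hw)) hint.norm (Eventually.of_forall fun y => ?_)
    · exact (hc.const_smul (1 / (2 * Real.pi) : ℝ) :)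
    refine ContinuousOn.mul (fun w hw => ?_) continuousOn_const
    exact (ContinuousAt.comp (f := fun w : ℂ => (y : ℂ) + w)
      (hQd _ (hshift w hw y)).continuousAt (by fun_prop)).continuousWithinAt
  · refine DifferentiableOn.fun_const_smul (differentiableOn_integral_of_norm_le isOpen_ostrip
      (fun w hw => hFm w (ostrip_subset_cstrip hw)) (fun y w hw => ?_)
      (fun w hw => hFb w (ostrip_subset_cstrip hw)) hint.norm) _
    refine (DifferentiableAt.mul_const ?_ _).differentiableWithinAt
    exact DifferentiableAt.comp (f := fun w : ℂ => (y : ℂ) + w) w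
      (hQd _ (hshift w (ostrip_subset_cstrip hw) y)) (by fun_prop)
  · refine ⟨‖(1 / (2 * Real.pi) : ℝ)‖ * ∫ y, ‖profile d f y‖, fun w hw => ?_⟩
    rw [norm_smul]
    exact mul_le_mul_of_nonneg_left
      (norm_integral_le_of_norm_le hint.norm (Eventually.of_forall (hFb w hw))) (norm_nonneg _)
  · intro t
    beta_reduce
    rw [coef_beta hf]
    congr 1
    refine integral_congr_ae (Eventually.of_forall fun y => ?_)
    simp only [hF, hQ]
    have h0 := stripMap_ne_zero (y + t)
    rw [← ofReal_add, stripDensity_ofReal, mul_pow, ← mul_assoc, ← pow_add, Nat.sub_add_cancel hn,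
      neg_neg, zpow_natCast]
  · intro t
    have h1 : coef (-n) (beta d (dilation t) f.reflect) = coef n (beta d (dilation t) f) := by
      rw [beta_reflect, coef_neg_reflect]
    beta_reduce
    rw [h1, coef_beta hf, mul_smul_comm]
    congr 1
    rw [← integral_const_mul]
    refine integral_congr_ae (Eventually.of_forall fun y => ?_)
    simp only [hF, hQ]
    have h0 := stripMap_ne_zero (y + t)
    rw [← add_assoc, ← ofReal_add, stripDensity_add_pi, stripMap_add_pi, neg_pow, mul_pow]
    have h2 : (stripMap ((y + t : ℝ) : ℂ))⁻¹ ^ (n - d) * (stripMap ((y + t : ℝ) : ℂ))⁻¹ ^ d =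
        stripMap ((y + t : ℝ) : ℂ) ^ (-(n : ℤ)) := by
      rw [← pow_add, Nat.sub_add_cancel hn, zpow_neg, zpow_natCast, inv_pow]
    rw [← h2]
    ring

end SmoothCircle

/-! ## Vanishing of the modes on the vacuum -/

namespace SmoothCircle

theorem coef_add (n : ℤ) (f g : SmoothCircle) : coef n (f + g) = coef n f + coef n g := by
  have c1 := f.continuous_pull
  have c2 := g.continuous_pull
  rw [coef, coef, coef, ← smul_add, ← intervalIntegral.integral_add
    (Continuous.intervalIntegrable (by fun_prop) _ _)
    (Continuous.intervalIntegrable (by fun_prop) _ _)]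
  simp only [pull_add, Pi.add_apply, mul_add]

theorem coef_smul (n : ℤ) (c : ℂ) (f : SmoothCircle) : coef n (c • f) = c * coef n f := by
  rw [coef, coef, mul_smul_comm, ← intervalIntegral.integral_const_mul]
  simp only [pull_smul, Pi.smul_apply, smul_eq_mul, mul_left_comm]

theorem coef_sum {ι : Type*} (n : ℤ) (s : Finset ι) (f : ι → SmoothCircle) :
    coef n (∑ i ∈ s, f i) = ∑ i ∈ s, coef n (f i) := by
  classical
  induction s using Finset.induction_on with
  | empty =>
    have := coef_smul n 0 0
    simpa using this
  | insert i s hi ih => rw [Finset.sum_insert hi, Finset.sum_insert hi, coef_add, ih]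

theorem coef_monomial (n m : ℤ) : coef n (monomial m) = if n = m then 1 else 0 := by
  split_ifs with h
  · subst h
    rw [coef]
    have : ∀ θ : ℝ, cexp (-n * (θ * I)) * (monomial n).pull θ = 1 := by
      intro θ
      rw [pull_monomial, ← exp_add, neg_mul, neg_add_cancel, exp_zero]
    simp only [this, intervalIntegral.integral_const, smul_smul]
    have hpi := Real.pi_pos
    rw [show 1 / (2 * Real.pi) * (Real.pi - -Real.pi) = 1 by field_simp; ring, one_smul]
  · have h1 := coef_ddθ n (monomial m)
    rw [ddθ_monomial, coef_smul] at h1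
    have h2 : ((n : ℂ) - m) * I * coef n (monomial m) = 0 := by linear_combination -h1
    rcases mul_eq_zero.1 h2 with h3 | h3
    · rcases mul_eq_zero.1 h3 with h4 | h4
      · exact absurd (by exact_mod_cast sub_eq_zero.1 h4) h
      · exact absurd h4 I_ne_zero
    · exact h3

/-- The rotated function `z ↦ f (e^{-iθ} z)`. -/
def rotate (θ : ℝ) (f : SmoothCircle) : SmoothCircle :=
  ⟨fun z => f (Circle.exp (-θ) * z), by
    have h : (fun s : ℝ => f (Circle.exp (-θ) * Circle.exp s)) = fun s : ℝ => f.pull (s - θ) := by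
      funext s
      rw [← Circle.exp_add, pull, neg_add_eq_sub]
    change ContDiff ℝ ∞ fun s : ℝ => f (Circle.exp (-θ) * Circle.exp s)
    rw [h]
    exact f.contDiff_pull.comp (contDiff_id.sub contDiff_const)⟩

theorem pull_rotate (θ : ℝ) (f : SmoothCircle) : (rotate θ f).pull = fun s => f.pull (s - θ) := by
  funext s
  change f (Circle.exp (-θ) * Circle.exp s) = _
  rw [← Circle.exp_add, pull, neg_add_eq_sub]

theorem cNorm_rotate_le (N : ℕ) (θ : ℝ) (f : SmoothCircle) : cNorm N (rotate θ f) ≤ cNorm N f := by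
  rw [cNorm_apply, cNorm_apply]
  refine Finset.sum_le_sum fun j _ => supSeminorm_le fun s => ?_
  rw [← iteratedDeriv_pull, pull_rotate, iteratedDeriv_comp_sub_const, iteratedDeriv_pull]
  exact norm_pull_le j f _

theorem coef_rotate (n : ℤ) (θ : ℝ) (f : SmoothCircle) :
    coef n (rotate θ f) = cexp (-n * (θ * I)) * coef n f := by
  have hper : Function.Periodic (fun s : ℝ => cexp (-n * ((s : ℂ) * I)) * f.pull s)
      (2 * Real.pi) := by
    intro s
    simp only
    rw [f.periodic_pull, show (-n * (((s + 2 * Real.pi : ℝ) : ℂ) * I) : ℂ) =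
      -n * (s * I) + ((-n : ℤ) : ℂ) * (2 * Real.pi * I) by push_cast; ring, exp_add,
      exp_int_mul_two_pi_mul_I, mul_one]
  rw [coef, coef, mul_smul_comm]
  congr 1
  have h1 := intervalIntegral.integral_comp_sub_right (a := -Real.pi) (b := Real.pi)
    (fun s : ℝ => cexp (-n * ((s : ℂ) * I)) * f.pull s) θ
  have h2 := hper.intervalIntegral_add_eq (-Real.pi - θ) (-Real.pi)
  rw [show -Real.pi - θ + 2 * Real.pi = Real.pi - θ by ring,
    show -Real.pi + 2 * Real.pi = Real.pi by ring, ← h1] at h2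
  rw [← h2, ← intervalIntegral.integral_const_mul]
  refine intervalIntegral.integral_congr fun s _ => ?_
  have he : cexp (-n * ((s : ℂ) * I)) =
      cexp (-n * ((θ : ℂ) * I)) * cexp (-n * (((s - θ : ℝ) : ℂ) * I)) := by
    rw [← exp_add]; congr 1; push_cast; ring
  simp only [pull_rotate, he, mul_assoc]

/-- If a continuous functional annihilates all rotated copies of `f`, then it annihilates all Fourier
modes of `f`. -/
theorem coef_mul_eq_zero_of_rotate {L : SmoothCircle →ₗ[ℂ] ℂ} (hL : Continuous L)
    {f : SmoothCircle} (h : ∀ θ, L (rotate θ f) = 0) (k : ℤ) : coef k f * L (monomial k) = 0 := by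
  classical
  obtain ⟨N, hN⟩ := exists_forall_norm_sub_sum_coef_le hL
  have hC : 0 ≤ cNorm N f := apply_nonneg _ _
  rw [← norm_le_zero_iff]
  refine le_of_forall_pos_le_add fun ε hε => ?_
  -- The `+ 1` avoids dividing by a vanishing norm.
  obtain ⟨s₀, hs₀⟩ := hN (ε / (cNorm N f + 1)) (by positivity)
  have hs := hs₀ (insert k s₀) (Finset.subset_insert k s₀)
  set s := insert k s₀ with hsdef
  -- As a function of the rotation angle, `g` is `L` applied to the truncated Fourier series of the
  -- rotated `f`. It is uniformly small because `L` kills every rotated copy, and its coefficient of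
  -- index `-k` is the wanted product.
  set g : SmoothCircle := ∑ n ∈ s, (coef n f * L (monomial n)) • monomial (-n) with hg
  have hcoef : coef (-k) g = coef k f * L (monomial k) := by
    rw [hg, coef_sum]
    simp only [coef_smul, coef_monomial, neg_inj, mul_ite, mul_one, mul_zero]
    rw [Finset.sum_ite_eq]
    simp [hsdef]
  rw [← hcoef, zero_add]
  refine (norm_coef_le _ _).trans (supSeminorm_le fun θ => ?_)
  have h1 := hs (rotate θ f)
  rw [h θ, sub_zero] at h1
  have h2 : (ddθ^[0] g).pull θ = ∑ n ∈ s, coef n (rotate θ f) * L (monomial n) := by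
    change g.pull θ = _
    rw [hg, pull_sum]
    refine Finset.sum_congr rfl fun n _ => ?_
    rw [pull_smul, Pi.smul_apply, pull_monomial, coef_rotate, smul_eq_mul]
    push_cast; ring
  rw [h2]
  refine h1.trans ((mul_le_mul_of_nonneg_left (cNorm_rotate_le N θ f) (by positivity)).trans ?_)
  rw [div_mul_eq_mul_div, div_le_iff₀ (by positivity)]
  nlinarith

theorem beta_rotation (d : ℕ) (θ : ℝ) (f : SmoothCircle) : beta d (rotation θ) f = rotate θ f := by
  ext z
  have h1 : ((rotation θ)⁻¹ : Mob) z = Circle.exp (-θ) * z := by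
    change ((rotation θ).1⁻¹ : Equiv.Perm Circle) z = _
    rw [Equiv.Perm.inv_eq_iff_eq]
    rw [rotation_apply, ← mul_assoc, ← Circle.exp_add, add_neg_cancel, Circle.exp_zero, one_mul]
  have h2 : xFactor (rotation θ) (((rotation θ)⁻¹ : Mob) z) = 1 := by
    have hm : IsMobius (rotation θ).1 (Complex.exp (θ / 2 * Complex.I)) 0 := isMobius_mobPerm _ _ _
    rw [xFactor_inv_eq hm, map_zero, zero_mul, sub_zero, mul_conj, normSq_eq_norm_sq]
    rw [show (θ / 2 * I : ℂ) = ((θ / 2 : ℝ) : ℂ) * I by push_cast; ring, norm_exp_ofReal_mul_I]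
    simp
  change xFactor (rotation θ) (((rotation θ)⁻¹ : Mob) z) ^ ((d : ℤ) - 1) *
    f (((rotation θ)⁻¹ : Mob) z) = f (Circle.exp (-θ) * z)
  rw [h1] at h2 ⊢
  rw [h2, one_zpow, one_mul]

theorem rotate_monomial (θ : ℝ) (n : ℤ) :
    rotate θ (monomial n) = cexp (I * ((-n : ℤ) : ℂ) * θ) • monomial n := by
  apply pull_injective
  funext s
  rw [pull_smul, Pi.smul_apply, smul_eq_mul]
  simp only [pull_rotate, pull_monomial]
  rw [← exp_add]
  congr 1
  push_cast; ring

theorem dilation_neg_apply (t : ℝ) (z : Circle) : (dilation (-t) z : ℂ) =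
    (Real.cosh (t / 2) * z + Real.sinh (t / 2)) / (Real.sinh (t / 2) * z + Real.cosh (t / 2)) := by
  rw [dilation_apply]
  simp only [neg_div, Real.cosh_neg, Real.sinh_neg, ofReal_neg, neg_neg, sub_neg_eq_add]

/-- The conformal factor is `(s z + c)(s z⁻¹ + c)` on the circle; its first factor cancels the
denominator of the dilation and its second is the numerator divided by `z`. Powers of this identity
are therefore Laurent polynomials. -/
theorem dilFactor_mul_dilation (t θ : ℝ) :
    (dilFactor t θ : ℂ) * (dilation (-t) (Circle.exp θ) : ℂ) =
      (Real.cosh (t / 2) * Circle.exp θ + Real.sinh (t / 2)) ^ 2 * (Circle.exp θ : ℂ)⁻¹ := by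
  have hn : (dilFactor t θ : ℂ) = (Real.sinh (t / 2) * Circle.exp θ + Real.cosh (t / 2)) *
      (Real.sinh (t / 2) * conj (Circle.exp θ : ℂ) + Real.cosh (t / 2)) := by
    rw [← normSq_dilation_den, ← mul_conj, map_add, map_mul, conj_ofReal, conj_ofReal]
    ring
  have hden := dilation_den_ne_zero (-t) (Circle.exp θ)
  simp only [neg_div, Real.cosh_neg, Real.sinh_neg, ofReal_neg, neg_neg] at hden
  have hz := circle_mul_conj (Circle.exp θ)
  have hz0 := Circle.coe_ne_zero (Circle.exp θ)
  rw [hn, dilation_neg_apply, ← Circle.coe_inv_eq_conj, Circle.coe_inv]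
  field_simp
  ring

/-- The transport of `z ^ e` with conformal dimension `e + 1` is a Laurent polynomial. -/
theorem beta_monomial_eq (e : ℕ) (t : ℝ) :
    beta (e + 1) (dilation t) (monomial e) = ∑ m ∈ Finset.range (2 * e + 1),
      ((Real.cosh (t / 2) : ℂ) ^ m * (Real.sinh (t / 2) : ℂ) ^ (2 * e - m) * (2 * e).choose m) •
        monomial ((m : ℤ) - e) := by
  apply pull_injective
  funext θ
  have hz0 := Circle.coe_ne_zero (Circle.exp θ)
  rw [beta_apply_exp, pull_sum, monomial_apply, Nat.cast_add, Nat.cast_one, add_sub_cancel_right,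
    zpow_natCast, zpow_natCast, ← mul_pow, dilFactor_mul_dilation, mul_pow, ← pow_mul, add_pow,
    Finset.sum_mul]
  refine Finset.sum_congr rfl fun m _ => ?_
  rw [pull_smul, Pi.smul_apply, smul_eq_mul, pull, monomial_apply, zpow_sub₀ hz0, zpow_natCast,
    zpow_natCast, mul_pow, inv_pow]
  ring

/-- All coefficients in the binomial expansion are positive at `t = 1`, so the dilation spreads `z ^
e` over every mode between `-e` and `e`. -/
theorem coef_beta_monomial_ne_zero {e : ℕ} {k : ℤ} (hk : -(e : ℤ) ≤ k) (hk' : k ≤ e) :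
    coef k (beta (e + 1) (dilation 1) (monomial e)) ≠ 0 := by
  obtain ⟨m, hm⟩ : ∃ m : ℕ, (m : ℤ) = k + e := ⟨(k + e).toNat, by omega⟩
  rw [beta_monomial_eq, coef_sum, Finset.sum_eq_single_of_mem m (Finset.mem_range.2 (by omega))]
  · rw [coef_smul, coef_monomial, if_pos (by omega), mul_one]
    refine mul_ne_zero (mul_ne_zero (pow_ne_zero _ ?_) (pow_ne_zero _ ?_)) ?_
    · exact cosh_ne_zero _
    · exact ofReal_ne_zero.2 (Real.sinh_pos_iff.2 (by norm_num)).ne'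
    · exact Nat.cast_ne_zero.2 (Nat.choose_pos (by omega)).ne'
  · intro j _ hj
    rw [coef_smul, coef_monomial, if_neg (by omega), mul_zero]

/-- The mean value of a dilation over the circle does not vanish. -/
theorem coef_zero_beta_one_ne_zero : coef 0 (beta 1 (dilation 1) (monomial 1)) ≠ 0 := by
  obtain ⟨c, hc⟩ : ∃ c : ℝ, c = Real.cosh (1 / 2) := ⟨_, rfl⟩
  obtain ⟨s, hs⟩ : ∃ s : ℝ, s = Real.sinh (1 / 2) := ⟨_, rfl⟩
  have hcs : c ^ 2 - s ^ 2 = 1 := by rw [hc, hs]; exact Real.cosh_sq_sub_sinh_sq _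
  have hc0 : 0 < c := hc ▸ Real.cosh_pos _
  have hs0 : 0 < s := hs ▸ Real.sinh_pos_iff.2 (by norm_num)
  have hsc : s < c := by nlinarith
  set F : ℂ → ℂ := fun z => (c * z + s) / (s * z + c) with hF
  have hden : ∀ z : ℂ, ‖z‖ ≤ 1 → (s * z + c : ℂ) ≠ 0 := by
    intro z hz h0
    have h1 : (c : ℂ) = -(s * z) := by linear_combination h0
    have h2 := congrArg norm h1
    rw [norm_neg, norm_mul, norm_real, norm_real, Real.norm_of_nonneg hc0.le,
      Real.norm_of_nonneg hs0.le] at h2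
    nlinarith
  have hd : DiffContOnCl ℂ F (Metric.ball 0 |1|) := by
    refine DifferentiableOn.diffContOnCl fun z hz => ?_
    have hz' : ‖z‖ ≤ 1 := by
      have := Metric.closure_ball_subset_closedBall hz
      simpa using this
    have h1 : DifferentiableAt ℂ (fun z : ℂ => (c * z + s : ℂ)) z := by fun_prop
    have h2 : DifferentiableAt ℂ (fun z : ℂ => (s * z + c : ℂ)) z := by fun_prop
    exact (h1.div h2 (hden z hz')).differentiableWithinAt
  -- The dilation extends holomorphically over the closed disk, so its mean over the circle is its
  -- value at 0, namely `s / c`.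
  have havg := hd.circleAverage
  rw [Real.circleAverage] at havg
  have hpull : ∀ θ : ℝ, F (circleMap 0 1 θ) = (beta 1 (dilation 1) (monomial 1)).pull θ := by
    intro θ
    rw [beta_apply_exp, Nat.cast_one, sub_self, zpow_zero, one_mul, monomial_apply, zpow_one,
      dilation_neg_apply, ← hc, ← hs, Circle.coe_exp, circleMap, ofReal_one, one_mul, zero_add]
  have hcoef : coef 0 (beta 1 (dilation 1) (monomial 1)) = F 0 := by
    rw [← havg, coef]
    have hper := (periodic_pull (beta 1 (dilation 1) (monomial 1))).intervalIntegral_add_eq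
      (-Real.pi) 0
    rw [show -Real.pi + 2 * Real.pi = Real.pi by ring, zero_add] at hper
    simp only [hpull, Int.cast_zero, neg_zero, zero_mul, exp_zero, one_mul, hper, one_div]
  rw [hcoef, hF]
  simp only [mul_zero, zero_add]
  exact div_ne_zero (ofReal_ne_zero.2 hs0.ne') (ofReal_ne_zero.2 hc0.ne')

end SmoothCircle

namespace MobiusWightmanCFT

variable {D : Type*} [AddCommGroup D] [Module ℂ D] (W : MobiusWightmanCFT D)

open SmoothCircle

variable {W} in
theorem U_mul_field {φ : SmoothCircle →ₗ[ℂ] Module.End ℂ D} {d : ℕ} (h : IsCovariant W.U φ d)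
    (γ : Mob) (f : SmoothCircle) : W.U γ * φ f = φ (beta d γ f) * W.U γ := by
  rw [← h γ f, mul_assoc, mul_assoc, ← map_mul, inv_mul_cancel, map_one, mul_one]

variable {W} in
theorem U_field_vacuum {φ : SmoothCircle →ₗ[ℂ] Module.End ℂ D} {d : ℕ} (h : IsCovariant W.U φ d)
    (γ : Mob) (f : SmoothCircle) : W.U γ (φ f W.Ω) = φ (beta d γ f) W.Ω := by
  have := congrArg (fun T : Module.End ℂ D => T W.Ω) (U_mul_field h γ f)
  simpa [W.vacuum_invariant] using this

/-- The functional `f ↦ lam (φ(f) Ω)`. -/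
def onePoint (lam : D →ₗ[ℂ] ℂ) (φ : SmoothCircle →ₗ[ℂ] Module.End ℂ D) : SmoothCircle →ₗ[ℂ] ℂ :=
  lam ∘ₗ (LinearMap.applyₗ W.Ω) ∘ₗ φ

theorem onePoint_apply (lam : D →ₗ[ℂ] ℂ) (φ : SmoothCircle →ₗ[ℂ] Module.End ℂ D)
    (f : SmoothCircle) : W.onePoint lam φ f = lam (φ f W.Ω) := rfl

variable {W} in
theorem continuous_onePoint {lam : D →ₗ[ℂ] ℂ} (hlam : lam ∈ compatibleDual W.F)
    {φ : SmoothCircle →ₗ[ℂ] Module.End ℂ D} (hφ : φ ∈ W.F) : Continuous (W.onePoint lam φ) := by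
  have h := (hlam 1 (fun _ => φ) (fun _ => hφ) W.Ω).comp
    (f := fun f : SmoothCircle => fun _ : Fin 1 => f) (by fun_prop)
  simp only [Function.comp_def, smear_succ, smear_zero, mul_one] at h
  exact h

variable {W} in
-- Rotations multiply this vector by `e^{-inθ}`, so it has negative weight and the spectrum
-- condition forces it to vanish.
theorem field_monomial_vacuum_of_pos {φ : SmoothCircle →ₗ[ℂ] Module.End ℂ D} {d : ℕ}
    (hcov : IsCovariant W.U φ d) {n : ℤ} (hn : 0 < n) : φ (monomial n) W.Ω = 0 := by
  refine W.spectrum (-n) _ (by omega) fun θ => ?_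
  rw [U_field_vacuum hcov, beta_rotation, rotate_monomial, map_smul, LinearMap.smul_apply]

variable {W} in
-- Covariance under rotations and invariance of the vacuum show that every rotated copy of `f` also
-- annihilates it; compatible functionals then detect each mode occurring in `f` separately.
theorem coef_smul_field_monomial_vacuum {φ : SmoothCircle →ₗ[ℂ] Module.End ℂ D} (hφ : φ ∈ W.F)
    {d : ℕ} (hcov : IsCovariant W.U φ d) {f : SmoothCircle} (hf : φ f W.Ω = 0) {k : ℤ}
    (hk : coef k f ≠ 0) : φ (monomial k) W.Ω = 0 := by
  by_contra hne
  obtain ⟨lam, hlam, h⟩ := W.regular _ hne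
  have h1 := coef_mul_eq_zero_of_rotate (continuous_onePoint hlam hφ) (f := f) (fun θ => by
    rw [onePoint_apply, ← beta_rotation d, ← U_field_vacuum hcov, hf, map_zero, map_zero]) k
  exact (mul_ne_zero hk h) h1

variable {W} in
/-- The modes `φ(zⁿ)` with `n > -d` annihilate the vacuum. -/
theorem field_monomial_vacuum {φ : SmoothCircle →ₗ[ℂ] Module.End ℂ D} (hφ : φ ∈ W.F) {d : ℕ}
    (hcov : IsCovariant W.U φ d) {n : ℤ} (hn : -(d : ℤ) < n) : φ (monomial n) W.Ω = 0 := by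
  rcases lt_or_ge 0 n with h | h
  · exact field_monomial_vacuum_of_pos hcov h
  · obtain ⟨e, rfl⟩ : ∃ e, d = e + 1 := ⟨d - 1, by omega⟩
    rcases Nat.eq_zero_or_pos e with rfl | he
    -- In dimension 1 only the constant mode remains. It is reached from `z`, since `z ^ e` would be
    -- constant for `e = 0` and is not covered by the spectrum condition.
    · obtain rfl : n = 0 := by omega
      refine coef_smul_field_monomial_vacuum hφ hcov (f := beta 1 (dilation 1) (monomial 1)) ?_
        coef_zero_beta_one_ne_zero
      rw [← U_field_vacuum hcov, field_monomial_vacuum_of_pos hcov one_pos, map_zero]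
    -- Here `z ^ e` has positive degree, and its transport contains all modes from `-e = -(d - 1)`
    -- upwards to `e`, which includes every remaining `n`.
    · refine coef_smul_field_monomial_vacuum hφ hcov
        (f := beta (e + 1) (dilation 1) (monomial e)) ?_ (coef_beta_monomial_ne_zero (by omega) (by omega))
      rw [← U_field_vacuum hcov, field_monomial_vacuum_of_pos hcov (by omega), map_zero]

end MobiusWightmanCFT

/-! ### Uniform bounds for damped families and for products with two parameters. -/

theorem IsTame.exists_cNorm_mul_damp_le {c : ℝ → SmoothCircle} (hc : IsTame c) (N : ℕ) {a : ℝ}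
    (ha : 0 < a) (η : ℝ) :
    ∃ M, 0 ≤ M ∧ ∀ t, SmoothCircle.cNorm N (c t) * ‖damp a η t‖ ≤ M := by
  obtain ⟨C, hC, hb⟩ := hc.2 N
  refine ⟨C * Real.exp (a * η ^ 2) * Real.exp (C ^ 2 / (2 * a)), by positivity, fun t => ?_⟩
  rw [norm_damp]
  have h1 : Real.exp (C * |t|) * Real.exp (-a * t ^ 2) ≤ Real.exp (C ^ 2 / (2 * a)) := by
    refine (exp_mul_damp_le ha t).trans (mul_le_of_le_one_right (Real.exp_pos _).le
      (Real.exp_le_one_iff.2 ?_))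
    nlinarith [sq_nonneg t, mul_nonneg ha.le (sq_nonneg t)]
  calc _ ≤ C * Real.exp (C * |t|) * (Real.exp (a * η ^ 2) * Real.exp (-a * t ^ 2)) :=
        mul_le_mul_of_nonneg_right (hb t) (by positivity)
    _ = C * Real.exp (a * η ^ 2) * (Real.exp (C * |t|) * Real.exp (-a * t ^ 2)) := by ring
    _ ≤ _ := mul_le_mul_of_nonneg_left h1 (by positivity)

theorem IsExpBounded₂.const_mul {h : ℝ → ℝ → ℂ} (H : IsExpBounded₂ h) (c : ℂ) :
    IsExpBounded₂ fun s t => c * h s t := by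
  obtain ⟨hc, C, hC, hb⟩ := H
  refine ⟨hc.const_mul c, C + ‖c‖ * C, by positivity, fun s t => ?_⟩
  rw [norm_mul]
  refine (mul_le_mul_of_nonneg_left (hb s t) (norm_nonneg c)).trans ?_
  rw [← mul_assoc]
  refine mul_le_mul (by linarith) (Real.exp_le_exp.2 ?_) (Real.exp_pos _).le (by positivity)
  exact mul_le_mul_of_nonneg_right (le_add_of_nonneg_right (by positivity)) (by positivity)

section Smear

variable {D : Type*} [AddCommGroup D] [Module ℂ D]

theorem smear_snoc {k : ℕ} (φ : Fin k → SmoothCircle →ₗ[ℂ] Module.End ℂ D)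
    (φ₀ : SmoothCircle →ₗ[ℂ] Module.End ℂ D) (f : Fin k → SmoothCircle) (f₀ : SmoothCircle) :
    smear (Fin.snoc φ φ₀ : Fin (k + 1) → SmoothCircle →ₗ[ℂ] Module.End ℂ D)
      (Fin.snoc f f₀ : Fin (k + 1) → SmoothCircle) = smear φ f * φ₀ f₀ := by
  rw [smear, List.ofFn_succ', List.concat_eq_append, List.prod_append, List.prod_singleton, smear]
  simp

theorem isExpBounded₂_mul_smear {F : Set (SmoothCircle →ₗ[ℂ] Module.End ℂ D)} {lam : D →ₗ[ℂ] ℂ}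
    (hlam : lam ∈ compatibleDual F) {k : ℕ} {φ : Fin k → SmoothCircle →ₗ[ℂ] Module.End ℂ D}
    (hφ : ∀ j, φ j ∈ F) {φ₀ : SmoothCircle →ₗ[ℂ] Module.End ℂ D} (hφ₀ : φ₀ ∈ F) (Φ : D)
    {c : Fin k → ℝ → SmoothCircle} (hc : ∀ j, IsTame (c j)) {c₀ : ℝ → SmoothCircle}
    (hc₀ : IsTame c₀) :
    IsExpBounded₂ fun s t => lam (φ₀ (c₀ s) (smear φ (fun j => c j t) Φ)) := by
  have h := isExpBounded₂_smear hlam (φ := (Fin.cons φ₀ φ : Fin (k + 1) → _))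
    (Fin.cases hφ₀ hφ) Φ
    (c := (Fin.cons c₀ c : Fin (k + 1) → ℝ → SmoothCircle)) (Fin.cases hc₀ hc)
    (p := (Fin.cons (fun s _ => s) fun _ _ t => t : Fin (k + 1) → ℝ → ℝ → ℝ))
    (Fin.cases continuous_fst fun _ => continuous_snd)
    (Fin.cases (fun s t => le_add_of_nonneg_right (abs_nonneg t))
      fun _ s t => le_add_of_nonneg_left (abs_nonneg s))
  simp only [smear_succ, Fin.cons_zero, Fin.cons_succ] at h
  exact h

theorem isExpBounded₂_smear_mul {F : Set (SmoothCircle →ₗ[ℂ] Module.End ℂ D)} {lam : D →ₗ[ℂ] ℂ}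
    (hlam : lam ∈ compatibleDual F) {k : ℕ} {φ : Fin k → SmoothCircle →ₗ[ℂ] Module.End ℂ D}
    (hφ : ∀ j, φ j ∈ F) {φ₀ : SmoothCircle →ₗ[ℂ] Module.End ℂ D} (hφ₀ : φ₀ ∈ F) (Φ : D)
    {c : Fin k → ℝ → SmoothCircle} (hc : ∀ j, IsTame (c j)) {c₀ : ℝ → SmoothCircle}
    (hc₀ : IsTame c₀) :
    IsExpBounded₂ fun s t => lam (smear φ (fun j => c j t) (φ₀ (c₀ s) Φ)) := by
  have h := isExpBounded₂_smear hlam (φ := (Fin.snoc φ φ₀ : Fin (k + 1) → _))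
    (Fin.lastCases (by simpa using hφ₀) (by simpa using hφ)) Φ
    (c := (Fin.snoc c c₀ : Fin (k + 1) → ℝ → SmoothCircle))
    (Fin.lastCases (by simpa using hc₀) (by simpa using hc))
    (p := (Fin.snoc (fun _ _ t => t) fun s _ => s : Fin (k + 1) → ℝ → ℝ → ℝ))
    (Fin.lastCases (by simpa using continuous_fst) (by simpa using fun _ => continuous_snd))
    (Fin.lastCases (by simp) (by simp))
  have h2 : ∀ s t, (fun j => (Fin.snoc c c₀ : Fin (k + 1) → ℝ → SmoothCircle) j
      ((Fin.snoc (fun _ _ t => t) fun s _ => s : Fin (k + 1) → ℝ → ℝ → ℝ) j s t)) =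
      (Fin.snoc (fun j => c j t) (c₀ s) : Fin (k + 1) → SmoothCircle) := by
    intro s t
    funext j
    refine Fin.lastCases ?_ (fun i => ?_) j <;> simp
  simp only [h2, smear_snoc] at h
  exact h

end Smear

/-! ### Strip continuation of damped vacuum correlations. -/

namespace MobiusWightmanCFT

variable {D : Type*} [AddCommGroup D] [Module ℂ D] {W : MobiusWightmanCFT D}

open SmoothCircle

/-- Each Fourier mode of the test function continues or annihilates the vacuum. Damping makes the
truncation error uniform on both boundary lines, so the limit of the finite sums continues as well.
-/
theorem isStripBoundary_field {lam : D →ₗ[ℂ] ℂ} (hlam : lam ∈ compatibleDual W.F)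
    {φ : SmoothCircle →ₗ[ℂ] Module.End ℂ D} (hφ : φ ∈ W.F) {d : ℕ} (hcov : IsCovariant W.U φ d)
    {f : SmoothCircle} (hf : tsupport f ⊆ upperArc) {a : ℝ} (ha : 0 < a) :
    IsStripBoundary (fun t => lam (φ (beta d (dilation t) f) W.Ω) * damp a 0 t)
      (fun t => (-1) ^ d * lam (φ (beta d (dilation t) f.reflect) W.Ω) * damp a Real.pi t) := by
  obtain ⟨N, hN⟩ := exists_forall_norm_sub_sum_coef_le (continuous_onePoint hlam hφ)
  obtain ⟨M, hM, hMb⟩ := (isTame_beta d f).exists_cNorm_mul_damp_le N ha 0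
  obtain ⟨M', hM', hMb'⟩ := (isTame_beta d f.reflect).exists_cNorm_mul_damp_le N ha Real.pi
  refine IsStripBoundary.of_approx fun δ hδ => ?_
  -- `M` and `M'` bound the damped norms on the two lines; dividing by their sum plus 1 lets one
  -- truncation serve both.
  obtain ⟨s, hs⟩ := hN (δ / (M + M' + 1)) (by positivity)
  replace hs := hs s subset_rfl
  have hsmall : ∀ {x}, x ≤ M + M' + 1 → δ / (M + M' + 1) * x ≤ δ := fun {x} hx => by
    rw [div_mul_eq_mul_div, div_le_iff₀ (by positivity)]
    exact mul_le_mul_of_nonneg_left hx hδ.le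
  refine ⟨fun t => (∑ n ∈ s, coef n (beta d (dilation t) f) * W.onePoint lam φ (monomial n)) *
      damp a 0 t, fun t => (∑ n ∈ s, (-1) ^ d * coef n (beta d (dilation t) f.reflect) *
      W.onePoint lam φ (monomial n)) * damp a Real.pi t, ?_, fun t => ⟨?_, ?_⟩⟩
  · refine (IsStripBoundary.sum s fun n _ => ?_).mul (isStripBoundary_damp ha)
    by_cases hn : -(d : ℤ) < n
    · rw [onePoint_apply, field_monomial_vacuum hφ hcov hn, map_zero]
      simpa using IsStripBoundary.zero
    · obtain ⟨m, rfl⟩ : ∃ m : ℕ, n = -(m : ℤ) := ⟨(-n).toNat, by omega⟩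
      exact (isStripBoundary_coef hf (by omega)).mul (IsStripBoundary.const _)
  · rw [← sub_mul, norm_mul, ← onePoint_apply]
    refine (mul_le_mul_of_nonneg_right (hs _) (norm_nonneg _)).trans ?_
    rw [mul_assoc]
    exact hsmall ((hMb t).trans (by linarith))
  · rw [← sub_mul, norm_mul, ← onePoint_apply]
    simp only [mul_assoc]
    rw [← Finset.mul_sum, ← mul_sub, norm_mul, norm_pow, norm_neg, norm_one, one_pow, one_mul]
    refine (mul_le_mul_of_nonneg_right (hs _) (norm_nonneg _)).trans ?_
    rw [mul_assoc]
    exact hsmall ((hMb' t).trans (by linarith))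

/-- This is where locality enters: the fields already continued have supports in the lower
semicircle and those not yet continued in the upper one. -/
theorem commute_smear {k : ℕ} {φ : Fin k → SmoothCircle →ₗ[ℂ] Module.End ℂ D}
    (hφ : ∀ j, φ j ∈ W.F) {φ₀ : SmoothCircle →ₗ[ℂ] Module.End ℂ D} (hφ₀ : φ₀ ∈ W.F)
    {f : Fin k → SmoothCircle} (hf : ∀ j, tsupport (f j) ⊆ lowerArc) {f₀ : SmoothCircle}
    (hf₀ : tsupport f₀ ⊆ upperArc) : Commute (φ₀ f₀) (smear φ f) := by
  refine Commute.list_prod_right _ _ fun T hT => ?_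
  obtain ⟨j, rfl⟩ := List.mem_ofFn.1 hT
  exact W.locality _ hφ₀ _ (hφ j) _ _ (disjoint_upper_lower.mono hf₀ (hf j))

theorem isStripBoundary_smear {k : ℕ} {φ : Fin k → SmoothCircle →ₗ[ℂ] Module.End ℂ D}
    (hφ : ∀ j, φ j ∈ W.F) {d : Fin k → ℕ} (hcov : ∀ j, IsCovariant W.U (φ j) (d j))
    {f : Fin k → SmoothCircle} (hf : ∀ j, tsupport (f j) ⊆ upperArc)
    {lam : D →ₗ[ℂ] ℂ} (hlam : lam ∈ compatibleDual W.F) {a : ℝ} (ha : 0 < a) :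
    IsStripBoundary
      (fun t => lam (smear φ (fun j => beta (d j) (dilation t) (f j)) W.Ω) * damp a 0 t)
      (fun t => (-1) ^ (∑ j, d j) * lam (smear (fun j => φ j.rev)
        (fun j => beta (d j.rev) (dilation t) (f j.rev).reflect) W.Ω) * damp a Real.pi t) := by
  -- The functional varies because the leftmost field is absorbed into it, and `a` varies because
  -- passing to the diagonal doubles the damping, so the hypothesis is used at `a / 2`.
  induction k generalizing lam a with
  | zero =>
    simp only [smear_zero, Finset.univ_eq_empty, Finset.sum_empty, pow_zero, one_mul,
      Module.End.one_apply]
    exact (IsStripBoundary.const _).mul (isStripBoundary_damp ha)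
  | succ k ih =>
    have hsupp : ∀ (j : Fin (k + 1)) t,
        tsupport (beta (d j) (dilation t) (f j).reflect) ⊆ lowerArc := fun j t =>
      tsupport_beta_lower (tsupport_reflect_lower (hf j)) _ t
    have hφr : ∀ j : Fin k, φ j.rev.succ ∈ W.F := fun j => hφ _
    have key := isStripBoundary_diagonal_damp (a := a / 2)
      (H := fun s t => lam (φ 0 (beta (d 0) (dilation s) (f 0))
        (smear (fun j : Fin k => φ j.succ)
          (fun j => beta (d j.succ) (dilation t) (f j.succ)) W.Ω)))
      (K := fun s t => (-1) ^ (∑ j : Fin k, d j.succ) *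
        lam (φ 0 (beta (d 0) (dilation s) (f 0)) (smear (fun j : Fin k => φ j.rev.succ)
          (fun j => beta (d j.rev.succ) (dilation t) (f j.rev.succ).reflect) W.Ω)))
      (H' := fun s t => (-1) ^ (∑ j, d j) * lam (smear (fun j : Fin k => φ j.rev.succ)
          (fun j => beta (d j.rev.succ) (dilation t) (f j.rev.succ).reflect)
          (φ 0 (beta (d 0) (dilation s) (f 0).reflect) W.Ω)))
      (isExpBounded₂_mul_smear hlam (fun j => hφ j.succ) (hφ 0) W.Ω
        (fun j => isTame_beta (d j.succ) (f j.succ)) (isTame_beta _ _))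
      ((isExpBounded₂_mul_smear hlam hφr (hφ 0) W.Ω
        (fun j => isTame_beta (d j.rev.succ) (f j.rev.succ).reflect) (isTame_beta _ _)).const_mul _)
      ((isExpBounded₂_smear_mul hlam hφr (hφ 0) W.Ω
        (fun j => isTame_beta (d j.rev.succ) (f j.rev.succ).reflect) (isTame_beta _ _)).const_mul _)
      (half_pos ha) (fun s => ?_) (fun t => ?_)
    · rw [add_halves] at key
      convert! key using 3
      · rw [smear_succ]; rfl
      · rw [smear_rev_succ φ fun j => beta (d j) (dilation _) (f j).reflect]; rfl
    · exact ih (fun j => hφ j.succ) (fun j => hcov j.succ) (fun j => hf j.succ)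
        (comp_mem_compatibleDual hlam (hφ 0) _) (half_pos ha)
    -- The reversed product at fixed `t` is absorbed into the functional, so that the distinguished
    -- field acts directly on the vacuum. Below, `commute_smear` identifies the lower boundary value
    -- with `K`.
    · have h := (IsStripBoundary.const ((-1) ^ (∑ j : Fin k, d j.succ))).mul
        (isStripBoundary_field (comp_smear_mem_compatibleDual hlam hφr fun j =>
          beta (d j.rev.succ) (dilation t) (f j.rev.succ).reflect) (hφ 0) (hcov 0) (hf 0)
          (half_pos ha))
      convert! h using 2 with s s
      · rw [← mul_assoc]
        congr 2
        rw [LinearMap.comp_apply, ← Module.End.mul_apply, ← Module.End.mul_apply]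
        rw [(commute_smear hφr (hφ 0) (fun j => hsupp j.rev.succ t)
          (tsupport_beta_upper (hf 0) (d 0) s)).eq]
      · rw [Fin.sum_univ_succ, pow_add, LinearMap.comp_apply]
        ring

theorem V_smear {k : ℕ} {φ : Fin k → SmoothCircle →ₗ[ℂ] Module.End ℂ D} {d : Fin k → ℕ}
    (hcov : ∀ j, IsCovariant W.U (φ j) (d j)) (f : Fin k → SmoothCircle) (t : ℝ) :
    W.V t (smear φ f W.Ω) = smear φ (fun j => beta (d j) (dilation t) (f j)) W.Ω := by
  induction k with
  | zero => simp [smear_zero, V, W.vacuum_invariant]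
  | succ k ih =>
    rw [smear_succ, smear_succ, Module.End.mul_apply, Module.End.mul_apply,
      ← ih (fun j => hcov j.succ)]
    exact congrArg (fun T : Module.End ℂ D => T _) (U_mul_field (hcov 0) (dilation t) (f 0))

end MobiusWightmanCFT

/-! ### Analytic continuation of vectors. -/

theorem strip_pi : strip (Real.pi * I) = cstrip := by
  ext z
  simp [strip, cstrip, uIcc_of_le Real.pi_pos.le]

theorem interior_cstrip : interior cstrip = ostrip := by
  have h : cstrip = im ⁻¹' Icc 0 Real.pi := rfl
  rw [h, interior_preimage_im, interior_Icc]
  rfl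

namespace MobiusWightmanCFT

variable {D : Type*} [AddCommGroup D] [Module ℂ D] {W : MobiusWightmanCFT D}

open SmoothCircle

theorem IsContinuation.add {τ : ℂ} {Φ Ψ Φ' Ψ' : D} (h : W.IsContinuation τ Φ Ψ)
    (h' : W.IsContinuation τ Φ' Ψ') : W.IsContinuation τ (Φ + Φ') (Ψ + Ψ') := by
  intro lam hlam
  obtain ⟨G, hc, hd, h0, h1⟩ := h lam hlam
  obtain ⟨G', hc', hd', h0', h1'⟩ := h' lam hlam
  exact ⟨fun z => G z + G' z, hc.add hc', hd.add hd', fun t => by simp [h0, h0'],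
    fun t => by simp [h1, h1']⟩

theorem IsContinuation.smul {τ : ℂ} {Φ Ψ : D} (h : W.IsContinuation τ Φ Ψ) (c : ℂ) :
    W.IsContinuation τ (c • Φ) (c • Ψ) := by
  intro lam hlam
  obtain ⟨G, hc, hd, h0, h1⟩ := h lam hlam
  exact ⟨fun z => c * G z, hc.const_smul c, hd.const_mul c, fun t => by simp [h0],
    fun t => by simp [h1]⟩

/-- Translating the argument by `τ` carries one strip to the other and exchanges the two boundary
lines. -/
theorem IsContinuation.symm {τ : ℂ} {Φ Ψ : D} (h : W.IsContinuation τ Φ Ψ) :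
    W.IsContinuation (-τ) Ψ Φ := by
  intro lam hlam
  obtain ⟨G, hc, hd, h0, h1⟩ := h lam hlam
  have hpre : (fun z => z + τ) ⁻¹' strip τ = strip (-τ) := by
    ext z
    simp only [strip, mem_preimage, mem_ofPred_eq, add_im, neg_im, mem_uIcc]
    constructor <;> rintro (h | h) <;> [right; left; right; left] <;> constructor <;> linarith [h.1, h.2]
  have hint : (fun z => z + τ) ⁻¹' interior (strip τ) = interior (strip (-τ)) := by
    rw [← hpre]
    exact (Homeomorph.addRight τ).preimage_interior _
  refine ⟨fun z => G (z + τ), hc.comp (by fun_prop) hpre.ge, hd.comp (by fun_prop) hint.ge,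
    fun t => ?_, fun t => ?_⟩
  · rw [← h1, add_comm]
  · rw [← h0]
    exact congrArg G (by ring)

/-- The vector given by analytic continuation to `± iπ` is unique. -/
theorem IsContinuation.unique {σ : ℝ} (hσ : σ = 1 ∨ σ = -1) {Φ Ψ Ψ' : D}
    (h : W.IsContinuation (σ * (Real.pi * I)) Φ Ψ)
    (h' : W.IsContinuation (σ * (Real.pi * I)) Φ Ψ') : Ψ = Ψ' := by
  by_contra hne
  obtain ⟨lam, hlam, hl⟩ := W.regular (Ψ - Ψ') (sub_ne_zero.2 hne)
  obtain ⟨G, hc, hd, h0, h1⟩ := h lam hlam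
  obtain ⟨G', hc', hd', h0', h1'⟩ := h' lam hlam
  have hσ0 : σ ≠ 0 := by rcases hσ with rfl | rfl <;> norm_num
  -- Multiplication by `σ = ±1` brings both strips to the standard one, so uniqueness is proved
  -- once.
  have hpre : (fun z : ℂ => (σ : ℂ) * z) ⁻¹' strip (σ * (Real.pi * I)) = cstrip := by
    rw [← strip_pi]
    ext z
    simp only [strip, mem_preimage, mem_ofPred_eq, im_ofReal_mul, mem_uIcc, I_im, mul_one]
    rcases hσ with rfl | rfl
    · simp
    · constructor <;> rintro (h | h) <;> [right; left; right; left] <;> constructor <;>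
        linarith [h.1, h.2]
  have hint : (fun z : ℂ => (σ : ℂ) * z) ⁻¹' interior (strip (σ * (Real.pi * I))) = ostrip := by
    rw [← interior_cstrip, ← hpre]
    exact (Homeomorph.mulLeft₀ (σ : ℂ) (ofReal_ne_zero.2 hσ0)).preimage_interior _
  have key := eq_zero_of_eq_zero_on_real (G := fun z => G (σ * z) - G' (σ * z))
    ((hc.comp (by fun_prop) hpre.ge).sub (hc'.comp (by fun_prop) hpre.ge))
    ((hd.comp (by fun_prop) hint.ge).sub (hd'.comp (by fun_prop) hint.ge))
    (fun t => by
      have := h0 (σ * t)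
      have h2 := h0' (σ * t)
      rw [ofReal_mul] at this h2
      simp only [this, h2, sub_self]) (ofReal_add_pi_mem_cstrip 0)
  have e1 := h1 0
  have e2 := h1' 0
  rw [ofReal_zero, add_zero] at e1 e2
  simp only [ofReal_zero, zero_add, e1, e2] at key
  have hV : W.V 0 = 1 := by
    have : dilation 0 = 1 := by
      refine Subtype.ext (Equiv.ext fun z => Circle.ext ?_)
      change (dilation 0 z : ℂ) = z
      rw [dilation_apply]
      simp
    rw [V, this, map_one]
  rw [hV] at key
  exact hl (by simpa using key)

/-- `contV` is an arbitrary choice among continuations, so exhibiting one continuation computes it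
only thanks to uniqueness. -/
theorem contV_eq {σ : ℝ} (hσ : σ = 1 ∨ σ = -1) {τ : ℂ} (hτ : τ = σ * (Real.pi * I)) {Φ Ψ : D}
    (h : W.IsContinuation τ Φ Ψ) : ∃ h : Φ ∈ W.domV τ, W.contV τ ⟨Φ, h⟩ = Ψ := by
  subst hτ
  exact ⟨⟨Ψ, h⟩, IsContinuation.unique hσ (Classical.choose_spec (p := fun Ψ =>
    W.IsContinuation (σ * (Real.pi * I)) Φ Ψ) ⟨Ψ, h⟩) h⟩

theorem isContinuation_smear_upper {k : ℕ} {φ : Fin k → SmoothCircle →ₗ[ℂ] Module.End ℂ D}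
    (hφ : ∀ j, φ j ∈ W.F) {d : Fin k → ℕ} (hcov : ∀ j, IsCovariant W.U (φ j) (d j))
    {f : Fin k → SmoothCircle} (hf : ∀ j, tsupport (f j) ⊆ upperArc) :
    W.IsContinuation (Real.pi * I) (smear φ f W.Ω) ((-1 : ℂ) ^ (∑ j, d j) •
      smear (fun j => φ j.rev) (fun j => (f j.rev).reflect) W.Ω) := by
  intro lam hlam
  obtain ⟨G, hc, hd, -, h0, h1⟩ := isStripBoundary_smear hφ hcov hf hlam one_pos
  -- The damping is undone by the entire function `exp (z²)`. Boundedness on the strip is lost, but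
  -- `IsContinuation` does not ask for it.
  have hdamp : ∀ η t : ℝ, damp 1 η t * cexp (((t : ℂ) + η * I) ^ 2) = 1 := fun η t => by
    rw [damp, ← exp_add]
    simp
  rw [strip_pi, interior_cstrip]
  refine ⟨fun z => G z * cexp (z ^ 2), hc.mul (by fun_prop), hd.mul (by fun_prop), fun t => ?_,
    fun t => ?_⟩
  · have h2 := hdamp 0 t
    beta_reduce
    rw [ofReal_zero, zero_mul, add_zero] at h2
    rw [h0, mul_assoc, h2, mul_one, V_smear hcov]
  · beta_reduce
    rw [add_comm, h1, mul_assoc, hdamp, mul_one, map_smul, map_smul, smul_eq_mul,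
      V_smear (d := fun j => d j.rev) fun j => hcov j.rev]

theorem isContinuation_smear_lower {k : ℕ} {φ : Fin k → SmoothCircle →ₗ[ℂ] Module.End ℂ D}
    (hφ : ∀ j, φ j ∈ W.F) {d : Fin k → ℕ} (hcov : ∀ j, IsCovariant W.U (φ j) (d j))
    {f : Fin k → SmoothCircle} (hf : ∀ j, tsupport (f j) ⊆ lowerArc) :
    W.IsContinuation (-(Real.pi * I)) (smear φ f W.Ω) ((-1 : ℂ) ^ (∑ j, d j) •
      smear (fun j => φ j.rev) (fun j => (f j.rev).reflect) W.Ω) := by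
  -- The reversed, reflected product lives on the upper semicircle and continues to a sign times the
  -- original one. Reading this backwards gives the claim, since the sign squares to 1.
  have h := (isContinuation_smear_upper (φ := fun j => φ j.rev) (fun j => hφ j.rev)
    (d := fun j => d j.rev) (fun j => hcov j.rev) (f := fun j => (f j.rev).reflect)
    (fun j => tsupport_reflect_upper (hf j.rev))).symm.smul ((-1 : ℂ) ^ (∑ j, d j))
  have hsum : ∑ j : Fin k, d j.rev = ∑ j, d j := Equiv.sum_comp Fin.revPerm d
  have hsq : ((-1 : ℂ) ^ (∑ j, d j)) * (-1) ^ (∑ j, d j) = 1 := by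
    rw [← mul_pow]; simp
  simpa only [hsum, smul_smul, hsq, one_smul, Fin.rev_rev, reflect_reflect] using h

theorem exists_smear_of_mem_closure {I : Set Circle} {T : Module.End ℂ D}
    (hT : T ∈ Submonoid.closure {T | ∃ φ ∈ W.F, ∃ f : SmoothCircle, tsupport f ⊆ I ∧ T = φ f}) :
    ∃ (k : ℕ) (φ : Fin k → SmoothCircle →ₗ[ℂ] Module.End ℂ D) (f : Fin k → SmoothCircle),
      (∀ j, φ j ∈ W.F) ∧ (∀ j, tsupport (f j) ⊆ I) ∧ T = smear φ f := by
  induction hT using Submonoid.closure_induction_left with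
  | one => exact ⟨0, Fin.elim0, Fin.elim0, fun j => j.elim0, fun j => j.elim0, (smear_zero _ _).symm⟩
  | mul_left x hx y _ ih =>
    obtain ⟨φ₀, hφ₀, f₀, hf₀, rfl⟩ := hx
    obtain ⟨k, φ, f, hφ, hf, rfl⟩ := ih
    refine ⟨k + 1, Fin.cons φ₀ φ, Fin.cons f₀ f, Fin.cases hφ₀ hφ, Fin.cases hf₀ hf, ?_⟩
    simp [smear_succ]

/-- The generated algebra is the linear span of products of its generators, and continuations form a
linear relation, so products of fields suffice. -/
theorem polyAlg_vacuum_mem_domV {I : Set Circle} {τ : ℂ}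
    (h : ∀ (k : ℕ) (φ : Fin k → SmoothCircle →ₗ[ℂ] Module.End ℂ D) (d : Fin k → ℕ)
      (f : Fin k → SmoothCircle), (∀ j, φ j ∈ W.F) → (∀ j, IsCovariant W.U (φ j) (d j)) →
      (∀ j, tsupport (f j) ⊆ I) → smear φ f W.Ω ∈ W.domV τ) :
    ∀ x ∈ W.polyAlg I, x W.Ω ∈ W.domV τ := by
  intro x hx
  rw [polyAlg, ← Subalgebra.mem_toSubmodule, Algebra.adjoin_eq_span] at hx
  induction hx using Submodule.span_induction with
  | mem T hT =>
    obtain ⟨k, φ, f, hφ, hf, rfl⟩ := exists_smear_of_mem_closure hT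
    choose d hd using fun j => W.covariance _ (hφ j)
    exact h k φ d f hφ hd hf
  | zero => exact ⟨0, fun lam _ => ⟨0, continuousOn_const, differentiableOn_const 0, by simp, by simp⟩⟩
  | add x y _ _ hx hy =>
    obtain ⟨Ψ, hΨ⟩ := hx
    obtain ⟨Ψ', hΨ'⟩ := hy
    exact ⟨_, hΨ.add hΨ'⟩
  | smul c x _ hx =>
    obtain ⟨Ψ, hΨ⟩ := hx
    exact ⟨_, hΨ.smul c⟩

end MobiusWightmanCFT
end WightmanCFT
end

theorem mainTheorem1 {D : Type*} [AddCommGroup D] [Module ℂ D]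
    (W : WightmanCFT.MobiusWightmanCFT D) :
    ((∀ x ∈ W.polyAlg WightmanCFT.upperArc, x W.Ω ∈ W.domV (Real.pi * Complex.I)) ∧
      ∀ (k : ℕ) (φ : Fin k → WightmanCFT.SmoothCircle →ₗ[ℂ] Module.End ℂ D) (d : Fin k → ℕ)
        (f : Fin k → WightmanCFT.SmoothCircle),
        (∀ j, φ j ∈ W.F) → (∀ j, WightmanCFT.IsCovariant W.U (φ j) (d j)) →
        (∀ j, tsupport (f j) ⊆ WightmanCFT.upperArc) →
        ∃ h : WightmanCFT.smear φ f W.Ω ∈ W.domV (Real.pi * Complex.I),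
          W.contV (Real.pi * Complex.I) ⟨WightmanCFT.smear φ f W.Ω, h⟩ =
            (-1 : ℂ) ^ (∑ j, d j) •
              WightmanCFT.smear (fun j => φ j.rev) (fun j => (f j.rev).reflect) W.Ω) ∧
    ((∀ x ∈ W.polyAlg WightmanCFT.lowerArc, x W.Ω ∈ W.domV (-(Real.pi * Complex.I))) ∧
      ∀ (k : ℕ) (φ : Fin k → WightmanCFT.SmoothCircle →ₗ[ℂ] Module.End ℂ D) (d : Fin k → ℕ)
        (f : Fin k → WightmanCFT.SmoothCircle),
        (∀ j, φ j ∈ W.F) → (∀ j, WightmanCFT.IsCovariant W.U (φ j) (d j)) →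
        (∀ j, tsupport (f j) ⊆ WightmanCFT.lowerArc) →
        ∃ h : WightmanCFT.smear φ f W.Ω ∈ W.domV (-(Real.pi * Complex.I)),
          W.contV (-(Real.pi * Complex.I)) ⟨WightmanCFT.smear φ f W.Ω, h⟩ =
            (-1 : ℂ) ^ (∑ j, d j) •
              WightmanCFT.smear (fun j => φ j.rev) (fun j => (f j.rev).reflect) W.Ω) := by

  have hup := fun (k : ℕ) (φ : Fin k → WightmanCFT.SmoothCircle →ₗ[ℂ] Module.End ℂ D) (d : Fin k → ℕ)
    (f : Fin k → WightmanCFT.SmoothCircle) (hφ : ∀ j, φ j ∈ W.F)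
    (hcov : ∀ j, WightmanCFT.IsCovariant W.U (φ j) (d j))
    (hf : ∀ j, tsupport (f j) ⊆ WightmanCFT.upperArc) =>
    WightmanCFT.MobiusWightmanCFT.contV_eq (Or.inl rfl) (by simp)
      (WightmanCFT.MobiusWightmanCFT.isContinuation_smear_upper hφ hcov hf)
  have hlow := fun (k : ℕ) (φ : Fin k → WightmanCFT.SmoothCircle →ₗ[ℂ] Module.End ℂ D) (d : Fin k → ℕ)
    (f : Fin k → WightmanCFT.SmoothCircle) (hφ : ∀ j, φ j ∈ W.F)
    (hcov : ∀ j, WightmanCFT.IsCovariant W.U (φ j) (d j))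
    (hf : ∀ j, tsupport (f j) ⊆ WightmanCFT.lowerArc) =>
    WightmanCFT.MobiusWightmanCFT.contV_eq (Or.inr rfl) (by simp)
      (WightmanCFT.MobiusWightmanCFT.isContinuation_smear_lower hφ hcov hf)
  exact ⟨⟨WightmanCFT.MobiusWightmanCFT.polyAlg_vacuum_mem_domV fun k φ d f hφ hcov hf =>
      (hup k φ d f hφ hcov hf).1, hup⟩,
    WightmanCFT.MobiusWightmanCFT.polyAlg_vacuum_mem_domV fun k φ d f hφ hcov hf =>
      (hlow k φ d f hφ hcov hf).1, hlow⟩
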